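/- **Zigzag Bound.** Let $k\ge 2$ and consider the infinite looped $k$-ary tree: a rooted tree in which every vertex has $k$ children, ordered from left to right, and in which the root has a self-loop (so the root counts as its own parent). The root is on layer $1$, its children are on layer $2$, and so on. In *labeled chip-firing* on this tree, a vertex holding at least $k+1$ labeled chips can fire: one selects $k+1$ of its chips, sends the $\lceil\frac{k+1}{2}\rceil$-th smallest of them to the parent, and for $1\le i\le k$ sends the $i$-th smallest of the remaining $k$ chips to the $i$-th leftmost child. A configuration is *stable* if no vertex can fire. For $\ell\ge 1$ put $N_{k,\ell}=\frac{k^\ell-1}{k-1}$. When one starts with chips $1,2,\dots,N_{k,m}$ at the root, every stable configuration that is reached has exactly one chip on each vertex of layers $1,\dots,m$; for $\ell \le m$ and a vertex $v$ on layer $m-\ell+1$, the subtree rooted at $v$ thus has $\ell$ layers of chips, $N_{k,\ell}$ chips in all. * $Z_{k,\ell}$ is the number of stable configurations that can be reached by legal firings from the configuration with chips $1,\dots,N_{k,\ell}$ at the root. * $T_{k,\ell}$ is the number of possible orderings of the chips within a subtree of $\ell$ layers, that is, the number of distinct arrangements of $1,\dots,N_{k,\ell}$ on the first $\ell$ layers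 of the tree that arise as follows: for some $m\ge\ell$ take a stable configuration reached from chips $1,\dots,N_{k,m}$ at the root and a vertex $v$ on layer $m-\ell+1$, restrict the configuration to the subtree rooted at $v$, and relabel the chips there by $1,\dots,N_{k,\ell}$ in increasing order. * $A_\ell$ is the Euler zigzag number, the number of permutations $a_1,\dots,a_\ell$ of $\{1,\dots,\ell\}$ with $a_1<a_2>a_3<a_4>\cdots$. * For $\ell\ge 3$, $$\beta_{k,\ell}=\binom{N_{k,\ell}-2}{\ell}\,\frac{(N_{k,\ell}-\ell-2)!}{(N_{k,\ell-1}-1)!\,(N_{k,\ell-1})!^{\,k-2}\,(N_{k,\ell-2}-1)!\,(N_{k,\ell-2})!^{\,k-2}\,\prod_{i=1}^{\ell-3}(N_{k,i})!^{\,k-1}}\,A_\ell .$$ Then for all $k\ge 2$ and $\ell\ge 3$ the numbers $T_{k,\ell}$ and $Z_{k,\ell}$ are finite and $$T_{k,\ell}\le (k-1)^{(k-1)k^{\ell-3}}\,\beta_{k,\ell}\prod_{i=1}^{\ell-3}\beta_{k,\ell-i}^{(k-1)k^{i-1}},\qquad Z_{k,\ell}\le (k-1)^{(k-1)k^{\ell-3}}\,\beta_{k,\ell}\prod_{i=1}^{\ell-3}\beta_{k,\ell-i}^{(k-1)k^{i-1}}.$$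 -/

import Mathlib

/-! Labeled chip-firing on the infinite looped `k`-ary tree.  The vertices are the natural numbers
in breadth-first order: `0` is the root and the `j`-th leftmost child of `v` is `k * v + j`
for `1 ≤ j ≤ k`. -/

namespace ChipFiring

/-- The `j`-th leftmost child (`1 ≤ j ≤ k`) of the vertex `v`. -/
def child (k v j : ℕ) : ℕ := k * v + j

/-- The parent of the vertex `v`.  Because of the self-loop the root counts as its own parent
(natural-number subtraction gives `parent k 0 = 0`). -/
def parent (k v : ℕ) : ℕ := (v - 1) / k

theorem parent_zero (k : ℕ) : parent k 0 = 0 := by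
  simp [parent]

theorem parent_child (k v j : ℕ) (h1 : 1 ≤ j) (hj : j ≤ k) : parent k (child k v j) = v := by
  have h : child k v j - 1 = (j - 1) + k * v := by unfold child; omega
  rw [parent, h, Nat.add_mul_div_left _ _ (by omega), Nat.div_eq_of_lt (by omega), zero_add]

/-- The layer of a vertex; the root is on layer `1`, its children on layer `2`, and so on. -/
def layer (k : ℕ) : ℕ → ℕ
  | 0 => 1
  | u + 1 => layer k (u / k) + 1
  decreasing_by exact Nat.lt_succ_of_le (Nat.div_le_self u k)

/-- `N_{k,ℓ} = (k^ℓ - 1) / (k - 1)`. -/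
def chipCount (k ℓ : ℕ) : ℕ := (k ^ ℓ - 1) / (k - 1)

/-- For `k ≥ 2` the division in `chipCount` is exact. -/
theorem chipCount_eq_sum (k ℓ : ℕ) (hk : 2 ≤ k) :
    chipCount k ℓ = ∑ i ∈ Finset.range ℓ, k ^ i :=
  (Nat.geomSum_eq hk ℓ).symm

/-- A configuration of `n` labeled chips: the vertex on which each chip lies.  The chips are
indexed by `Fin n`, in the order of their labels `1, …, n`. -/
abbrev Configuration (n : ℕ) : Type := Fin n → ℕ

/-- The vertex that receives the `i`-th smallest (`1 ≤ i ≤ k + 1`) of the `k + 1` chips fired from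
`v`: the `⌈(k+1)/2⌉`-th smallest goes to the parent, and of the other `k` chips the `j`-th
smallest goes to the `j`-th leftmost child.  Here `(k + 2) / 2` is `⌈(k+1)/2⌉`. -/
def target (k v i : ℕ) : ℕ :=
  if i < (k + 2) / 2 then child k v i
  else if i = (k + 2) / 2 then parent k v
  else child k v (i - 1)

/-- `C'` arises from `C` by firing the vertex `v` with the chips `s 0 < s 1 < ⋯ < s k`. -/
def FiresWith {n : ℕ} (k v : ℕ) (s : Fin (k + 1) → Fin n) (C C' : Configuration n) : Prop :=
  StrictMono s ∧ (∀ i, C (s i) = v) ∧ (∀ i : Fin (k + 1), C' (s i) = target k v (i + 1)) ∧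
    ∀ c, c ∉ Set.range s → C' c = C c

/-- One legal firing. -/
def Step {n : ℕ} (k : ℕ) (C C' : Configuration n) : Prop :=
  ∃ v s, FiresWith k v s C C'

/-- No vertex can fire: every vertex holds at most `k` chips. -/
def IsStable {n : ℕ} (k : ℕ) (C : Configuration n) : Prop :=
  ∀ v : ℕ, (Finset.univ.filter fun c => C c = v).card < k + 1

/-- The stable configurations that can be reached by legal firings from `n` labeled chips at
the root. -/
def stableConfigurations (k n : ℕ) : Set (Configuration n) :=
  {C | Relation.ReflTransGen (Step k) (fun _ => 0) C ∧ IsStable k C}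

/-- `Z_{k,ℓ}` is the number of elements of this set: the possible stable configurations with
`N_{k,ℓ}` labeled chips at the root. -/
def zConfigurations (k ℓ : ℕ) : Set (Configuration (chipCount k ℓ)) :=
  stableConfigurations k (chipCount k ℓ)

/-- The isomorphism from the whole tree onto the subtree rooted at `v`: it sends `0` to `v` and the
`j`-th child of `u` to the `j`-th child of the image of `u`. -/
def inSubtree (k v : ℕ) : ℕ → ℕ
  | 0 => v
  | u + 1 => child k (inSubtree k v (u / k)) (u % k + 1)
  decreasing_by exact Nat.lt_succ_of_le (Nat.div_le_self u k)

theorem inSubtree_zero (k v : ℕ) : inSubtree k v 0 = v := by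
  rw [inSubtree]

theorem inSubtree_child (k v u j : ℕ) (h1 : 1 ≤ j) (hj : j ≤ k) :
    inSubtree k v (child k u j) = child k (inSubtree k v u) j := by
  obtain ⟨i, rfl⟩ : ∃ i, j = i + 1 := ⟨j - 1, by omega⟩
  have h : child k u (i + 1) = (i + k * u) + 1 := by unfold child; omega
  rw [h, inSubtree, Nat.add_mul_div_left _ _ (by omega), Nat.div_eq_of_lt (by omega), zero_add,
    Nat.add_mul_mod_self_left, Nat.mod_eq_of_lt (by omega)]

/-- `D` is the ordering, in the stable configuration `C`, of the chips within the subtree rooted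
at `v`: that subtree holds exactly `n` chips, and when these are relabeled in increasing order and
the subtree is identified with the whole tree, the resulting configuration is `D`. -/
def IsSubtreeOrdering {n N : ℕ} (k v : ℕ) (C : Configuration N) (D : Configuration n) : Prop :=
  ∃ s : Fin n → Fin N, StrictMono s ∧ Set.range s = {c | C c ∈ Set.range (inSubtree k v)} ∧
    ∀ c, C (s c) = inSubtree k v (D c)

/-- `T_{k,ℓ}` is the number of elements of this set: the possible orderings of the chips within a
subtree consisting of `ℓ` layers.  Starting from `N_{k,m}` chips, the stable configuration occupies
the layers `1, …, m`, so the subtree rooted at `v` consists of `ℓ` layers exactly when `v` is on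
layer `m - ℓ + 1`.  All `m ≥ ℓ` and all such `v` are taken into account. -/
def tOrderings (k ℓ : ℕ) : Set (Configuration (chipCount k ℓ)) :=
  {D | ∃ m : ℕ, ∃ C ∈ stableConfigurations k (chipCount k m), ∃ v : ℕ,
    layer k v + ℓ = m + 1 ∧ IsSubtreeOrdering k v C D}

/-- The Euler zigzag number `A_ℓ`: the number of alternating permutations
`a_1 < a_2 > a_3 < a_4 > ⋯` of `ℓ` letters. -/
noncomputable def zigzagNumber (ℓ : ℕ) : ℕ :=
  Nat.card {σ : Equiv.Perm (Fin ℓ) // ∀ (i : ℕ) (h : i + 1 < ℓ),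
    if Even i then σ ⟨i, by omega⟩ < σ ⟨i + 1, h⟩ else σ ⟨i + 1, h⟩ < σ ⟨i, by omega⟩}

/-- `β_{k,ℓ}`, for `k ≥ 2` and `ℓ ≥ 3`. -/
noncomputable def beta (k ℓ : ℕ) : ℚ :=
  ((chipCount k ℓ - 2).choose ℓ : ℚ) *
    (((chipCount k ℓ - ℓ - 2).factorial : ℚ) /
      (((chipCount k (ℓ - 1) - 1).factorial : ℚ) *
        ((chipCount k (ℓ - 1)).factorial : ℚ) ^ (k - 2) *
        ((chipCount k (ℓ - 2) - 1).factorial : ℚ) *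
        ((chipCount k (ℓ - 2)).factorial : ℚ) ^ (k - 2) *
        ∏ i ∈ Finset.Icc 1 (ℓ - 3), ((chipCount k i).factorial : ℚ) ^ (k - 1))) *
    (zigzagNumber ℓ : ℚ)

/-- The zigzag bound `(k-1)^{(k-1)k^{ℓ-3}} β_{k,ℓ} ∏_{i=1}^{ℓ-3} β_{k,ℓ-i}^{(k-1)k^{i-1}}`. -/
noncomputable def zigzagBound (k ℓ : ℕ) : ℚ :=
  ((k : ℚ) - 1) ^ ((k - 1) * k ^ (ℓ - 3)) * beta k ℓ *
    ∏ i ∈ Finset.Icc 1 (ℓ - 3), beta k (ℓ - i) ^ ((k - 1) * k ^ (i - 1))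

end ChipFiring

/-! The bound is loose enough to follow from a recursion; no alternating permutation is ever read
off from a configuration. Fix `k` and write N_ℓ, T_ℓ, β_ℓ, B_ℓ for the chip count, the number of
orderings, `beta` and `zigzagBound`.

Recursion. A subtree of ℓ+1 layers consists of a root chip and `k` subtrees of ℓ layers, each
carrying an ordering that is itself counted by T_ℓ. It is determined by these orderings and by the
word telling in which branch each chip lies. Counting words by a multinomial coefficient gives
T_{ℓ+1} · N_ℓ!^k ≤ N_{ℓ+1}! · T_ℓ^k (`ncard_tOrderings_succ_mul_le`). On the other side B_{ℓ+1} β_ℓ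
= B_ℓ^k β_{ℓ+1} (`zigzagBound_succ`), and N_{ℓ+1}! β_ℓ ≤ 2 β_{ℓ+1} N_ℓ!^k (`factorial_mul_beta_le`);
the only input about zigzag numbers here is (ℓ+1) A_ℓ ≤ 2 A_{ℓ+1}. So each step loses at most a
factor 2. For k ≥ 3 this is absorbed by proving T_ℓ ≤ (2/3) B_ℓ, since 2 (2/3)^k ≤ 16/27 < 2/3. For
k = 2 it is regained because the largest chip always lies in the right branch, which roughly halves
the number of words (`ncard_tOrderings_two_succ_mul_le`, `factorial_mul_beta_two_le`).

Base ℓ = 3. Here the structure of stable configurations enters: siblings are sorted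
(`Run.children_sorted`); leaves in the same position below successive siblings are sorted
(`Run.columns_sorted`); in the binary tree the smallest and largest chips of a subtree lie in its
left and right branch, and two chips exceed the one on the root (`Run.exists_extreme`,
`Run.exists_two_extreme`).

Dynamics. These facts are invariants of `Run`. The number of firings of each vertex is known in
advance, and conservation of chips (`Run.balance`) ties the chips on a vertex to the firings still
due around it. Towards the end of the run, when `g v + layer k v` is small compared with `m`,
conservation is so tight that a vertex fires only with exactly `k + 1` chips and in alternation with
its neighbours (`Run.fires_window`, `Run.window`). The multisets `R` of chips received from the
parent remember enough of the past to compare siblings (`Run.countP_le_countP`). -/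

namespace ChipFiring

/-! ### Vertices, layers and parents. -/

section Tree

variable {k : ℕ}

theorem layer_zero (k : ℕ) : layer k 0 = 1 := by rw [layer]

theorem layer_child {v j : ℕ} (h1 : 1 ≤ j) (hj : j ≤ k) :
    layer k (child k v j) = layer k v + 1 := by
  obtain ⟨i, rfl⟩ : ∃ i, j = i + 1 := ⟨j - 1, by omega⟩
  have h : child k v (i + 1) = (i + k * v) + 1 := by unfold child; omega
  rw [h, layer, Nat.add_mul_div_left _ _ (by omega), Nat.div_eq_of_lt (by omega), zero_add]

theorem child_ne_zero {v j : ℕ} (h1 : 1 ≤ j) : child k v j ≠ 0 := by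
  unfold child; omega

theorem child_inj {v w i j : ℕ} (hi : 1 ≤ i) (hik : i ≤ k) (hj : 1 ≤ j) (hjk : j ≤ k)
    (h : child k v i = child k w j) : v = w ∧ i = j := by
  have hv : v = w := by
    rw [← parent_child k v i hi hik, h, parent_child k w j hj hjk]
  subst hv
  exact ⟨rfl, by unfold child at h; omega⟩

theorem exists_eq_child (hk : 1 ≤ k) {w : ℕ} (hw : w ≠ 0) :
    ∃ j, 1 ≤ j ∧ j ≤ k ∧ w = child k (parent k w) j := by
  refine ⟨(w - 1) % k + 1, by omega, Nat.mod_lt _ (by omega), ?_⟩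
  have := Nat.div_add_mod (w - 1) k
  unfold child parent
  omega

theorem layer_eq_layer_parent (hk : 1 ≤ k) {w : ℕ} (hw : w ≠ 0) :
    layer k w = layer k (parent k w) + 1 := by
  obtain ⟨j, h1, hj, h⟩ := exists_eq_child hk hw
  conv_lhs => rw [h]
  exact layer_child h1 hj

theorem layer_pos (v : ℕ) : 1 ≤ layer k v := by
  cases v with
  | zero => rw [layer]
  | succ u => rw [layer]; omega

theorem parent_ne_child (hk : 1 ≤ k) {v j : ℕ} (h1 : 1 ≤ j) (hj : j ≤ k) :
    parent k v ≠ child k v j := by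
  intro h
  have h2 := congrArg (layer k) h
  rw [layer_child h1 hj] at h2
  by_cases hv : v = 0
  · subst hv
    rw [parent_zero] at h2
    omega
  · have := layer_eq_layer_parent hk hv
    omega

theorem child_ne_self {v j : ℕ} (h1 : 1 ≤ j) (hj : j ≤ k) : child k v j ≠ v := by
  intro h
  have h2 := congrArg (layer k) h
  rw [layer_child h1 hj] at h2
  omega

theorem parent_ne_self (hk : 1 ≤ k) {v : ℕ} (hv : v ≠ 0) : parent k v ≠ v := by
  intro h
  have := layer_eq_layer_parent hk hv
  rw [h] at this
  omega

/-- The root is its own parent but nobody's child, hence the condition `w ≠ 0`. -/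
theorem sum_child_eq_ite (v w : ℕ) (hk : 1 ≤ k) :
    (∑ j ∈ Finset.Icc 1 k, if child k v j = w then 1 else 0) =
      if parent k w = v ∧ w ≠ 0 then 1 else 0 := by
  split_ifs with h
  · obtain ⟨rfl, hw⟩ := h
    obtain ⟨j, h1, hj, hc⟩ := exists_eq_child hk hw
    rw [Finset.sum_eq_single j]
    · rw [if_pos hc.symm]
    · intro i hi hij
      rw [Finset.mem_Icc] at hi
      rw [if_neg]
      intro h
      exact hij (child_inj hi.1 hi.2 h1 hj (h.trans hc)).2
    · intro h
      exact absurd (Finset.mem_Icc.2 ⟨h1, hj⟩) h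
  · apply Finset.sum_eq_zero
    intro j hj
    rw [Finset.mem_Icc] at hj
    rw [if_neg]
    rintro rfl
    exact h ⟨parent_child k v j hj.1 hj.2, child_ne_zero hj.1⟩

end Tree

/-! ### Bookkeeping for a single firing. -/

section Fire

/-- The position, among the `k + 1` fired chips, of the one that goes to the `j`-th child. -/
def slot (k j : ℕ) : Fin (k + 1) :=
  ⟨min k (if j < (k + 2) / 2 then j - 1 else j), by omega⟩

/-- The position, among the `k + 1` fired chips, of the one that goes to the parent. -/
def midSlot (k : ℕ) : Fin (k + 1) := ⟨(k + 2) / 2 - 1, by omega⟩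

variable {k : ℕ}

theorem slot_val {j : ℕ} (hj : j ≤ k) :
    (slot k j : ℕ) = if j < (k + 2) / 2 then j - 1 else j := by
  unfold slot
  simp only
  split_ifs <;> omega

theorem slot_lt_slot {i j : ℕ} (hi : 1 ≤ i) (hij : i < j) (hj : j ≤ k) :
    slot k i < slot k j := by
  rw [Fin.lt_def, slot_val (by omega), slot_val hj]
  split_ifs <;> omega

theorem slot_ne_midSlot {j : ℕ} (h1 : 1 ≤ j) (hj : j ≤ k) : slot k j ≠ midSlot k := by
  intro h
  have := congrArg Fin.val h
  rw [slot_val hj] at this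
  simp only [midSlot] at this
  split_ifs at this <;> omega

theorem eq_midSlot_or_slot (i : Fin (k + 1)) :
    i = midSlot k ∨ ∃ j, 1 ≤ j ∧ j ≤ k ∧ i = slot k j := by
  have hi := i.isLt
  rcases lt_trichotomy (i : ℕ) ((k + 2) / 2 - 1) with h | h | h
  · right
    refine ⟨i + 1, by omega, by omega, ?_⟩
    ext
    rw [slot_val (by omega), if_pos (by omega)]
    omega
  · left
    ext
    exact h
  · right
    refine ⟨i, by omega, by omega, ?_⟩
    ext
    rw [slot_val (by omega), if_neg (by omega)]

theorem sum_fin_eq_mid_add_slot {A : Type*} [AddCommMonoid A] (F : Fin (k + 1) → A) :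
    ∑ i, F i = F (midSlot k) + ∑ j ∈ Finset.Icc 1 k, F (slot k j) := by
  classical
  rw [← Finset.add_sum_erase _ _ (Finset.mem_univ (midSlot k))]
  congr 1
  symm
  apply Finset.sum_bij (fun j _ => slot k j)
  · intro j hj
    rw [Finset.mem_Icc] at hj
    exact Finset.mem_erase.2 ⟨slot_ne_midSlot hj.1 hj.2, Finset.mem_univ _⟩
  · intro i hi j hj h
    rw [Finset.mem_Icc] at hi hj
    rcases lt_trichotomy i j with hl | hl | hl
    · exact absurd h (slot_lt_slot hi.1 hl hj.2).ne
    · exact hl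
    · exact absurd h (slot_lt_slot hj.1 hl hi.2).ne'
  · intro i hi
    rw [Finset.mem_erase] at hi
    rcases eq_midSlot_or_slot i with h | ⟨j, h1, hj, h⟩
    · exact absurd h hi.1
    · exact ⟨j, Finset.mem_Icc.2 ⟨h1, hj⟩, h.symm⟩
  · intros; rfl

theorem target_slot {v j : ℕ} (h1 : 1 ≤ j) (hj : j ≤ k) :
    target k v (slot k j + 1) = child k v j := by
  rw [slot_val hj]
  unfold target
  split_ifs with h2 h3 h3 h4
  · congr 1; omega
  · omega
  · omega
  · omega
  · omega
  · congr 1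

theorem target_midSlot (hk : 2 ≤ k) (v : ℕ) : target k v (midSlot k + 1) = parent k v := by
  have : ((midSlot k : ℕ) + 1) = (k + 2) / 2 := by
    simp only [midSlot]; omega
  rw [this, target, if_neg (lt_irrefl _), if_pos rfl]

variable {n v : ℕ} {s : Fin (k + 1) → Fin n} {C C' : Configuration n}

theorem FiresWith.strictMono (h : FiresWith k v s C C') : StrictMono s := h.1

theorem FiresWith.apply_fired (h : FiresWith k v s C C') (i : Fin (k + 1)) : C (s i) = v :=
  h.2.1 i

theorem FiresWith.apply_slot (h : FiresWith k v s C C') {j : ℕ} (h1 : 1 ≤ j) (hj : j ≤ k) :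
    C' (s (slot k j)) = child k v j := by
  rw [h.2.2.1, target_slot h1 hj]

theorem FiresWith.apply_mid (h : FiresWith k v s C C') (hk : 2 ≤ k) :
    C' (s (midSlot k)) = parent k v := by
  rw [h.2.2.1, target_midSlot hk]

theorem FiresWith.apply_of_notMem (h : FiresWith k v s C C') {c : Fin n}
    (hc : c ∉ Set.range s) : C' c = C c := h.2.2.2 c hc

theorem FiresWith.apply_of_ne (h : FiresWith k v s C C') {c : Fin n} (hc : C c ≠ v) :
    C' c = C c := by
  apply h.apply_of_notMem
  rintro ⟨i, rfl⟩
  exact hc (h.apply_fired i)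

/-- What happens to a chip in a firing. -/
theorem FiresWith.cases (h : FiresWith k v s C C') (hk : 2 ≤ k) (c : Fin n) :
    (c ∉ Set.range s ∧ C' c = C c) ∨ (c = s (midSlot k) ∧ C c = v ∧ C' c = parent k v) ∨
      ∃ j, 1 ≤ j ∧ j ≤ k ∧ c = s (slot k j) ∧ C c = v ∧ C' c = child k v j := by
  by_cases hc : c ∈ Set.range s
  · right
    obtain ⟨i, rfl⟩ := hc
    rcases eq_midSlot_or_slot i with rfl | ⟨j, h1, hj, rfl⟩
    · exact Or.inl ⟨rfl, h.apply_fired _, h.apply_mid hk⟩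
    · exact Or.inr ⟨j, h1, hj, rfl, h.apply_fired _, h.apply_slot h1 hj⟩
  · exact Or.inl ⟨hc, h.apply_of_notMem hc⟩

/-- Only the fired chips change their contribution. Keeping the lost terms on the left avoids
subtraction, so that the identity can be used in `ℕ`, with indicator functions for `φ`. -/
theorem FiresWith.sum_eq {A : Type*} [AddCommMonoid A] (h : FiresWith k v s C C') (hk : 2 ≤ k)
    (φ : Fin n → ℕ → A) :
    (∑ c, φ c (C' c)) + ∑ i, φ (s i) v =
      (∑ c, φ c (C c)) + (φ (s (midSlot k)) (parent k v) +
        ∑ j ∈ Finset.Icc 1 k, φ (s (slot k j)) (child k v j)) := by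
  classical
  have hs := h.strictMono.injective
  have split : ∀ D : Configuration n, (∑ c, φ c (D c)) =
      (∑ i, φ (s i) (D (s i))) + ∑ c ∈ (Finset.univ.image s)ᶜ, φ c (D c) := by
    intro D
    rw [← Finset.sum_add_sum_compl (Finset.univ.image s),
      Finset.sum_image (fun a _ b _ hab => hs hab)]
  have e1 : (∑ c ∈ (Finset.univ.image s)ᶜ, φ c (C' c)) =
      ∑ c ∈ (Finset.univ.image s)ᶜ, φ c (C c) := by
    apply Finset.sum_congr rfl
    intro c hc
    rw [h.apply_of_notMem]
    rintro ⟨i, rfl⟩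
    simp at hc
  have e2 : (∑ i, φ (s i) (C' (s i))) = φ (s (midSlot k)) (parent k v) +
        ∑ j ∈ Finset.Icc 1 k, φ (s (slot k j)) (child k v j) := by
    rw [sum_fin_eq_mid_add_slot, h.apply_mid hk]
    congr 1
    apply Finset.sum_congr rfl
    intro j hj
    rw [Finset.mem_Icc] at hj
    rw [h.apply_slot hj.1 hj.2]
  have e3 : (∑ i, φ (s i) (C (s i))) = ∑ i, φ (s i) v :=
    Finset.sum_congr rfl fun i _ => by rw [h.apply_fired]
  rw [split C', split C, e1, e2, e3]
  abel

/-- The number of chips on the vertex `w`. -/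
def cnt (C : Configuration n) (w : ℕ) : ℕ := (Finset.univ.filter fun c => C c = w).card

theorem cnt_eq_sum (C : Configuration n) (w : ℕ) :
    cnt C w = ∑ c, if C c = w then 1 else 0 := by
  rw [cnt, Finset.card_filter]

theorem FiresWith.cnt_eq (h : FiresWith k v s C C') (hk : 2 ≤ k) (w : ℕ) :
    cnt C' w + (if w = v then k + 1 else 0) =
      cnt C w + (if w = parent k v then 1 else 0) +
        (if parent k w = v ∧ w ≠ 0 then 1 else 0) := by
  have := h.sum_eq hk (fun _ u => if u = w then 1 else 0)
  rw [← cnt_eq_sum C', ← cnt_eq_sum C, sum_child_eq_ite v w (by omega)] at this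
  have e : (∑ _i : Fin (k + 1), if v = w then 1 else 0) = if w = v then k + 1 else 0 := by
    split_ifs with h1 h2 h2
    · simp
    · exact absurd h1.symm h2
    · exact absurd h2.symm h1
    · simp
  rw [e] at this
  rw [this]
  simp only [eq_comm (a := parent k v)]
  ring

theorem FiresWith.succ_le_cnt (h : FiresWith k v s C C') : k + 1 ≤ cnt C v := by
  classical
  have : (Finset.univ.image s).card = k + 1 := by
    rw [Finset.card_image_of_injective _ h.strictMono.injective, Finset.card_fin]
  rw [← this]
  apply Finset.card_le_card
  intro c hc
  obtain ⟨i, -, rfl⟩ := Finset.mem_image.1 hc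
  simp [h.apply_fired i]

theorem FiresWith.mem_range_of_cnt_eq (h : FiresWith k v s C C') (hc : cnt C v = k + 1)
    {c : Fin n} (hcv : C c = v) : c ∈ Set.range s := by
  classical
  have h1 : (Finset.univ.image s).card = k + 1 := by
    rw [Finset.card_image_of_injective _ h.strictMono.injective, Finset.card_fin]
  have h2 : Finset.univ.image s ⊆ Finset.univ.filter fun c => C c = v := by
    intro c hc
    obtain ⟨i, -, rfl⟩ := Finset.mem_image.1 hc
    simp [h.apply_fired i]
  have h3 := Finset.eq_of_subset_of_card_le h2 (by rw [h1]; exact hc.le)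
  have : c ∈ Finset.univ.image s := by
    rw [h3]; simp [hcv]
  obtain ⟨i, -, rfl⟩ := Finset.mem_image.1 this
  exact ⟨i, rfl⟩

end Fire

/-! ### Chip counts and the prescribed numbers of firings. -/

section ChipCount

variable {k : ℕ}

theorem chipCount_zero (k : ℕ) : chipCount k 0 = 0 := by simp [chipCount]

theorem chipCount_succ (hk : 2 ≤ k) (l : ℕ) :
    chipCount k (l + 1) = k * chipCount k l + 1 := by
  rw [chipCount_eq_sum _ _ hk, chipCount_eq_sum _ _ hk, Finset.sum_range_succ', Finset.mul_sum]
  simp [pow_succ, mul_comm]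

/-- The number of times a vertex with `t` layers of chips strictly below it fires. -/
def fires (k t : ℕ) : ℕ := ∑ i ∈ Finset.range t, chipCount k (i + 1)

theorem fires_zero (k : ℕ) : fires k 0 = 0 := by simp [fires]

theorem fires_succ (k t : ℕ) : fires k (t + 1) = fires k t + chipCount k (t + 1) := by
  rw [fires, Finset.sum_range_succ, fires]

/-- The number of times the vertex `v` fires, from `N_{k,m}` chips at the root. -/
def odometer (k m v : ℕ) : ℕ := fires k (m - layer k v)

/-- Conservation of chips at `w` over a complete run: the initial chips and those received from the
neighbours equal the final chips and those fired. The self-loop is covered by `parent k 0 = 0`. -/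
theorem odometer_balance (hk : 2 ≤ k) (m w : ℕ) :
    (if w = 0 then chipCount k m else 0) + odometer k m (parent k w) +
      ∑ j ∈ Finset.Icc 1 k, odometer k m (child k w j) =
      (if layer k w ≤ m then 1 else 0) + (k + 1) * odometer k m w := by
  have hs : ∑ j ∈ Finset.Icc 1 k, odometer k m (child k w j) =
      k * fires k (m - (layer k w + 1)) := by
    rw [Finset.sum_congr rfl (g := fun _ => fires k (m - (layer k w + 1)))]
    · simp
    · intro j hj
      rw [Finset.mem_Icc] at hj
      rw [odometer, layer_child hj.1 hj.2]
  rw [hs]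
  unfold odometer
  by_cases hw : w = 0
  · subst hw
    rw [parent_zero, layer_zero, if_pos rfl]
    rcases m with _ | _ | h
    · simp [fires_zero, chipCount_zero]
    · simp [fires_zero, chipCount_succ hk, chipCount_zero]
    · simp only [Nat.add_sub_cancel, show h + 1 + 1 - (1 + 1) = h by omega]
      rw [if_pos (by omega), fires_succ, chipCount_succ hk (h + 1)]
      ring
  · rw [if_neg hw, layer_eq_layer_parent (by omega) hw]
    generalize layer k (parent k w) = l
    by_cases h1 : l + 1 ≤ m
    · rw [if_pos h1]
      obtain ⟨d, rfl⟩ : ∃ d, m = l + 1 + d := ⟨m - (l + 1), by omega⟩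
      rw [show l + 1 + d - l = d + 1 by omega, show l + 1 + d - (l + 1) = d by omega]
      rcases d with _ | d
      · simp [fires_zero, fires_succ, chipCount_succ hk, chipCount_zero]
      · rw [show l + 1 + (d + 1) - (l + 1 + 1) = d by omega, fires_succ k (d + 1),
          fires_succ k d, chipCount_succ hk (d + 1)]
        ring
    · rw [if_neg h1, show m - l = 0 by omega, show m - (l + 1) = 0 by omega,
        show m - (l + 1 + 1) = 0 by omega, fires_zero]
      simp

end ChipCount

/-! ### Runs, conservation of chips, and the alternation of firings near the end. -/

section Run

/-- The chips that the vertex `w` receives from its parent when `v` fires the chips `s`. -/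
def receipts {n : ℕ} (k v : ℕ) (s : Fin (k + 1) → Fin n) (w : ℕ) : Multiset (Fin n) :=
  ∑ j ∈ Finset.Icc 1 k, if child k v j = w then {s (slot k j)} else 0

/-- A configuration reached from `N_{k,m}` chips at the root, with the number `g w` of firings that
each vertex `w` has still to perform and the chips `R w` that it has received from its parent. -/
inductive Run (k m : ℕ) {n : ℕ} :
    Configuration n → (ℕ → ℕ) → (ℕ → Multiset (Fin n)) → Prop
  | init : Run k m (fun _ => 0) (odometer k m) (fun _ => 0)
  | fire {C C' : Configuration n} {g : ℕ → ℕ} {R : ℕ → Multiset (Fin n)} {x : ℕ}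
      {s : Fin (k + 1) → Fin n} (h : Run k m C g R) (hf : FiresWith k x s C C') :
      Run k m C' (Function.update g x (g x - 1)) (fun w => R w + receipts k x s w)

variable {k m n x : ℕ} {C C' : Configuration n} {g : ℕ → ℕ} {R : ℕ → Multiset (Fin n)}
  {s : Fin (k + 1) → Fin n}

theorem receipts_child {j : ℕ} (h1 : 1 ≤ j) (hj : j ≤ k) :
    receipts k x s (child k x j) = {s (slot k j)} := by
  rw [receipts, Finset.sum_eq_single j]
  · rw [if_pos rfl]
  · intro i hi hij
    rw [Finset.mem_Icc] at hi
    rw [if_neg]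
    exact fun h => hij (child_inj hi.1 hi.2 h1 hj h).2
  · exact fun h => absurd (Finset.mem_Icc.2 ⟨h1, hj⟩) h

theorem receipts_eq_zero {w : ℕ} (h : ∀ j, 1 ≤ j → j ≤ k → w ≠ child k x j) :
    receipts k x s w = 0 := by
  apply Finset.sum_eq_zero
  intro j hj
  rw [Finset.mem_Icc] at hj
  rw [if_neg]
  exact fun e => h j hj.1 hj.2 e.symm

theorem receipts_child_of_ne {v j : ℕ} (h1 : 1 ≤ j) (hj : j ≤ k) (h : x ≠ v) :
    receipts k x s (child k v j) = 0 :=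
  receipts_eq_zero fun _ hi1 hi e => h (child_inj h1 hj hi1 hi e).1.symm

/-- Conservation for the rest of the run: the chips present and those still to arrive make up the
final chip and those still to be fired. It starts as `odometer_balance` and is preserved by each
firing. -/
theorem Run.balance (hk : 2 ≤ k) (hn : n = chipCount k m) (h : Run k m C g R) (w : ℕ) :
    cnt C w + g (parent k w) + ∑ j ∈ Finset.Icc 1 k, g (child k w j) =
      (if layer k w ≤ m then 1 else 0) + (k + 1) * g w := by
  induction h generalizing w with
  | init =>
    rw [← odometer_balance hk m w, ← hn]
    congr 2
    unfold cnt
    split_ifs with h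
    · simp [h]
    · rw [Finset.card_eq_zero, Finset.filter_eq_empty_iff]
      exact fun _ _ e => h e.symm
  | @fire C C' g R x s hr hf ih =>
    -- With no firing left, the balance at `x` allows at most one chip there, too few to fire. Hence
    -- the truncated subtraction `g x - 1` is exact.
    have hpos : 1 ≤ g x := by
      by_contra hx
      have h1 := ih x
      have h2 := hf.succ_le_cnt
      have h3 : g x = 0 := by omega
      rw [h3] at h1
      split_ifs at h1 <;> omega
    set g' := Function.update g x (g x - 1) with hg'
    have hgg : ∀ u, g u = g' u + if u = x then 1 else 0 := by
      intro u
      by_cases hu : u = x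
      · subst hu
        simp [hg']; omega
      · simp [hg', hu]
    have h1 := ih w
    have h2 := hf.cnt_eq hk w
    have h3 : ∑ j ∈ Finset.Icc 1 k, g (child k w j) =
        (∑ j ∈ Finset.Icc 1 k, g' (child k w j)) + if parent k x = w ∧ x ≠ 0 then 1 else 0 := by
      rw [← sum_child_eq_ite w x (by omega), ← Finset.sum_add_distrib]
      exact Finset.sum_congr rfl fun j _ => hgg _
    rw [h3, hgg (parent k w), hgg w] at h1
    have h4 : (if w = x then k + 1 else 0) = (k + 1) * if w = x then 1 else 0 := by
      split_ifs <;> simp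
    rw [h4] at h2
    have h5 : (if w = parent k x then 1 else 0) + (if parent k w = x ∧ w ≠ 0 then 1 else 0) =
        (if parent k w = x then 1 else 0) + (if parent k x = w ∧ x ≠ 0 then 1 else 0) := by
      by_cases hw : w = 0 <;> by_cases hx : x = 0
      · subst hw hx; simp [parent_zero]
      · subst hw
        simp only [parent_zero, hx, ne_eq, not_true_eq_false, not_false_eq_true, and_false,
          and_true, Ne.symm hx, if_false, eq_comm]
        omega
      · subst hx
        simp [parent_zero, hw, eq_comm]
      · simp only [hw, hx, ne_eq, not_false_eq_true, and_true]
        rw [add_comm]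
        congr 1
        simp only [eq_comm]
    have h6 : (k + 1) * (g' w + if w = x then 1 else 0) =
      (k + 1) * g' w + (k + 1) * if w = x then 1 else 0 := by ring
    rw [h6] at h1
    omega

theorem Run.one_le_of_fires (hk : 2 ≤ k) (hn : n = chipCount k m) (h : Run k m C g R)
    (hf : FiresWith k x s C C') : 1 ≤ g x := by
  by_contra hx
  have h1 := h.balance hk hn x
  have h2 := hf.succ_le_cnt
  have h3 : g x = 0 := by omega
  rw [h3] at h1
  split_ifs at h1 <;> omega

theorem Run.le_odometer (h : Run k m C g R) (w : ℕ) : g w ≤ odometer k m w := by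
  induction h with
  | init => rfl
  | @fire C C' g R x s hr hf ih =>
    refine le_trans ?_ ih
    by_cases hw : w = x
    · subst hw; simp
    · simp [hw]

theorem Run.eq_zero_of_le_layer (h : Run k m C g R) {w : ℕ} (hw : m ≤ layer k w) : g w = 0 := by
  have := h.le_odometer w
  rw [odometer, Nat.sub_eq_zero_of_le hw, fires_zero] at this
  omega

/-- Three lower bounds hold when `x` fires: `k + 1` chips on `x`, at least `g x - 1` firings left at
each child, and at least `g x` at the parent. Each of the last two comes from `hJ` if the neighbour
is already in the window, and from its not being there otherwise. The bounds add up to `(k + 1) * g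
x + 1`, exactly the right-hand side of the balance, so all of them are equalities. -/
theorem Run.fires_window (hk : 2 ≤ k) (hn : n = chipCount k m)
    (h : Run k m C g R)
    (hJ : ∀ v, g v + layer k v < m →
      (∀ j, 1 ≤ j → j ≤ k → g (child k v j) ≤ g v) ∧ g (parent k v) ≤ g v + 1)
    (hf : FiresWith k x s C C') (hx : g x + layer k x ≤ m) :
    cnt C x = k + 1 ∧ (∀ j, 1 ≤ j → j ≤ k → g (child k x j) + 1 = g x) ∧ g (parent k x) = g x := by
  have hpos := h.one_le_of_fires hk hn hf
  have hb := h.balance hk hn x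
  rw [if_pos (by omega)] at hb
  have hc := hf.succ_le_cnt
  have hlow : ∀ j ∈ Finset.Icc 1 k, g x - 1 ≤ g (child k x j) := by
    intro j hj
    rw [Finset.mem_Icc] at hj
    have hl := layer_child (k := k) (v := x) hj.1 hj.2
    by_cases hw : g (child k x j) + layer k (child k x j) < m
    · have := (hJ _ hw).2
      rw [parent_child k x j hj.1 hj.2] at this
      omega
    · omega
  have hpar : g x ≤ g (parent k x) := by
    by_cases hx0 : x = 0
    · subst hx0; rw [parent_zero]
    · have hl := layer_eq_layer_parent (k := k) (by omega) hx0
      by_cases hw : g (parent k x) + layer k (parent k x) < m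
      · obtain ⟨j, h1, hj, e⟩ := exists_eq_child (k := k) (by omega) hx0
        have := (hJ _ hw).1 j h1 hj
        rwa [← e] at this
      · omega
  have hsum : k * (g x - 1) ≤ ∑ j ∈ Finset.Icc 1 k, g (child k x j) := by
    have := Finset.card_nsmul_le_sum _ _ _ hlow
    simpa using this
  obtain ⟨r, hr⟩ : ∃ r, g x = r + 1 := ⟨g x - 1, by omega⟩
  rw [hr] at hb hsum hpar
  rw [Nat.add_sub_cancel] at hsum
  have e : (k + 1) * (r + 1) = k * r + k + r + 1 := by ring
  rw [e] at hb
  have hs : ∑ j ∈ Finset.Icc 1 k, g (child k x j) = k * r := by omega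
  refine ⟨by omega, ?_, by omega⟩
  have heq : ∑ j ∈ Finset.Icc 1 k, (g x - 1) = ∑ j ∈ Finset.Icc 1 k, g (child k x j) := by
    rw [hs]; simp [hr]
  have := (Finset.sum_eq_sum_iff_of_le hlow).1 heq
  intro j h1 hj
  have := this j (Finset.mem_Icc.2 ⟨h1, hj⟩)
  omega

/-- Near the end of a run the firings of adjacent vertices alternate. -/
theorem Run.window (hk : 2 ≤ k) (hn : n = chipCount k m) (h : Run k m C g R) :
    ∀ v, g v + layer k v < m →
      (∀ j, 1 ≤ j → j ≤ k → g (child k v j) ≤ g v) ∧ g (parent k v) ≤ g v + 1 := by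
  induction h with
  | init =>
    intro v hv
    exfalso
    -- At the start no vertex is in the window.
    have h1 : ∀ t, t ≤ fires k t := by
      intro t
      induction t with
      | zero => simp
      | succ t ih => rw [fires_succ, chipCount_succ hk]; omega
    have := h1 (m - layer k v)
    unfold odometer at hv
    omega
  | @fire C C' g R x s hr hf ih =>
    intro v hv
    have hle : ∀ u, Function.update g x (g x - 1) u ≤ g u := by
      intro u
      by_cases hu : u = x
      · subst hu; simp
      · simp [hu]
    by_cases hvx : v = x
    · subst hvx
      rw [Function.update_self] at hv ⊢
      have hpos := hr.one_le_of_fires hk hn hf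
      obtain ⟨-, h1, h2⟩ := hr.fires_window hk hn ih hf (by omega)
      refine ⟨fun j hj1 hj => ?_, ?_⟩
      · rw [Function.update_of_ne (child_ne_self hj1 hj)]
        have := h1 j hj1 hj
        omega
      · exact (hle _).trans (by omega)
    · rw [Function.update_of_ne hvx] at hv ⊢
      obtain ⟨h1, h2⟩ := ih v hv
      exact ⟨fun j hj1 hj => (hle _).trans (h1 j hj1 hj), (hle _).trans h2⟩

/-- A firing near the end of a run uses all the chips on its vertex. -/
theorem Run.exact (hk : 2 ≤ k) (hn : n = chipCount k m) (h : Run k m C g R)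
    (hf : FiresWith k x s C C') (hx : g x + layer k x ≤ m) :
    (∀ c, C c = x → c ∈ Set.range s) ∧
      (∀ j, 1 ≤ j → j ≤ k → g (child k x j) + 1 = g x) ∧ g (parent k x) = g x := by
  obtain ⟨h1, h2⟩ := h.fires_window hk hn (h.window hk hn) hf hx
  exact ⟨fun c hc => hf.mem_range_of_cnt_eq h1 hc, h2⟩

theorem exists_run (h : Relation.ReflTransGen (Step k) (fun _ : Fin n => 0) C) :
    ∃ g R, Run k m C g R := by
  induction h with
  | refl => exact ⟨_, _, Run.init⟩
  | tail _ hs ih =>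
    obtain ⟨g, R, hr⟩ := ih
    obtain ⟨x, s, hf⟩ := hs
    exact ⟨_, _, hr.fire hf⟩

/-- In a stable configuration, the balance and induction from the bottom layer upwards show that a
vertex with firings left has fewer of them than its parent. Climbing to the root contradicts the
self-loop, where the parent is the vertex itself. -/
theorem Run.eq_zero_of_isStable (hk : 2 ≤ k) (hn : n = chipCount k m) (h : Run k m C g R)
    (hs : IsStable k C) (w : ℕ) : g w = 0 := by
  have key : ∀ t w, m ≤ layer k w + t → 1 ≤ g w → g w + 1 ≤ g (parent k w) := by
    intro t
    induction t with
    | zero =>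
      intro w hw hg
      rw [h.eq_zero_of_le_layer (by omega)] at hg
      omega
    | succ t ih =>
      intro w hw hg
      have hb := h.balance hk hn w
      have hsw : cnt C w < k + 1 := hs w
      have hl : layer k w ≤ m := by
        by_contra hl
        rw [h.eq_zero_of_le_layer (by omega)] at hg
        omega
      rw [if_pos hl] at hb
      have hc : ∑ j ∈ Finset.Icc 1 k, g (child k w j) ≤ k * (g w - 1) := by
        have : ∀ j ∈ Finset.Icc 1 k, g (child k w j) ≤ g w - 1 := by
          intro j hj
          rw [Finset.mem_Icc] at hj
          by_cases h0 : 1 ≤ g (child k w j)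
          · have := ih (child k w j) (by rw [layer_child hj.1 hj.2]; omega) h0
            rw [parent_child k w j hj.1 hj.2] at this
            omega
          · omega
        simpa using Finset.sum_le_card_nsmul _ _ _ this
      obtain ⟨r, hr⟩ : ∃ r, g w = r + 1 := ⟨g w - 1, by omega⟩
      rw [hr] at hb hc ⊢
      rw [Nat.add_sub_cancel] at hc
      have e : (k + 1) * (r + 1) = k * r + k + r + 1 := by ring
      rw [e] at hb
      omega
  by_contra hw
  have key2 : ∀ t w, layer k w ≤ t → g w ≠ 0 → False := by
    intro t
    induction t with
    | zero =>
      intro w hw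
      have := layer_pos (k := k) w
      omega
    | succ t ih =>
      intro w hw hg
      have h1 := key m w (by omega) (by omega)
      by_cases h0 : w = 0
      · subst h0
        rw [parent_zero] at h1
        omega
      · have := layer_eq_layer_parent (k := k) (by omega) h0
        exact ih (parent k w) (by omega) (by omega)
  exact key2 _ w le_rfl hw

/-- A stable configuration has exactly one chip on each vertex of the first `m` layers. -/
theorem cnt_of_mem_stableConfigurations (hk : 2 ≤ k) (hn : n = chipCount k m)
    (hC : C ∈ stableConfigurations k n) (w : ℕ) :
    cnt C w = if layer k w ≤ m then 1 else 0 := by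
  obtain ⟨g, R, hr⟩ := exists_run (m := m) hC.1
  have h0 := hr.eq_zero_of_isStable hk hn hC.2
  have := hr.balance hk hn w
  simpa [h0] using this

end Run

/-! ### Sorted siblings, and sorted columns on the bottom layer. -/

section Sorted

variable {k m n x : ℕ} {C C' : Configuration n} {g : ℕ → ℕ} {R : ℕ → Multiset (Fin n)}
  {s : Fin (k + 1) → Fin n}

/-- A chip that lies on `w` after a firing elsewhere has been there before. -/
theorem FiresWith.eq_of_apply_eq (hf : FiresWith k x s C C') (hk : 2 ≤ k) {c : Fin n} {w : ℕ}
    (hc : C' c = w) (hx : parent k x ≠ w) (hw : w = 0 ∨ x ≠ parent k w) : C c = w := by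
  rcases hf.cases hk c with ⟨-, h⟩ | ⟨-, -, h⟩ | ⟨j, h1, hj, -, -, h⟩
  · exact h.symm.trans hc
  · exact absurd (h.symm.trans hc) hx
  · rw [hc] at h
    exfalso
    rcases hw with hw | hw
    · subst hw
      exact child_ne_zero h1 h.symm
    · rw [h, parent_child k x j h1 hj] at hw
      exact hw rfl

theorem FiresWith.eq_slot_of_apply_eq_child (hf : FiresWith k x s C C') (hk : 2 ≤ k) {c : Fin n}
    {j : ℕ} (h1 : 1 ≤ j) (hj : j ≤ k) (hc : C' c = child k x j) :
    C c = child k x j ∨ c = s (slot k j) := by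
  rcases hf.cases hk c with ⟨-, h⟩ | ⟨-, -, h⟩ | ⟨i, hi1, hi, h, -, h'⟩
  · exact Or.inl (h.symm.trans hc)
  · exact absurd (h.symm.trans hc) (parent_ne_child (by omega) h1 hj)
  · have := (child_inj h1 hj hi1 hi (hc.symm.trans h')).2
    subst this
    exact Or.inr h

theorem apply_ne_of_cnt_eq_zero {w : ℕ} (h : cnt C w = 0) (c : Fin n) : C c ≠ w := by
  rw [cnt, Finset.card_eq_zero, Finset.filter_eq_empty_iff] at h
  exact h (Finset.mem_univ c)

/-- The right-hand side of the balance at the child is at most one, and the pending firing of `x`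
uses it up. -/
theorem Run.cnt_child_eq_zero (hk : 2 ≤ k) (hn : n = chipCount k m) (h : Run k m C g R)
    (hpos : 1 ≤ g x) {j : ℕ} (h1 : 1 ≤ j) (hj : j ≤ k) (h0 : g (child k x j) = 0) :
    cnt C (child k x j) = 0 := by
  have := h.balance hk hn (child k x j)
  rw [parent_child k x j h1 hj, h0] at this
  split_ifs at this <;> omega

/-- A vertex below a vertex that has finished firing has finished firing. -/
theorem Run.child_eq_zero (hk : 2 ≤ k) (hn : n = chipCount k m) (h : Run k m C g R)
    {v j : ℕ} (h1 : 1 ≤ j) (hj : j ≤ k) (h0 : g v = 0) : g (child k v j) = 0 := by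
  by_cases hl : layer k v < m
  · have := (h.window hk hn v (by omega)).1 j h1 hj
    omega
  · exact h.eq_zero_of_le_layer (by rw [layer_child h1 hj]; omega)

theorem update_eq_zero_cases {v : ℕ} (h : Function.update g x (g x - 1) v = 0) (hx : 1 ≤ g x) :
    (x = v ∧ g v = 1) ∨ (x ≠ v ∧ g v = 0) := by
  by_cases hv : v = x
  · subst hv
    rw [Function.update_self] at h
    exact Or.inl ⟨rfl, by omega⟩
  · rw [Function.update_of_ne hv] at h
    exact Or.inr ⟨Ne.symm hv, h⟩

theorem parent_eq_imp {w : ℕ} (hk : 1 ≤ k) (h : parent k x = w) (hw : w ≠ 0) :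
    ∃ j, 1 ≤ j ∧ j ≤ k ∧ x = child k w j := by
  have hx : x ≠ 0 := by
    rintro rfl
    exact hw (h.symm.trans (parent_zero k))
  obtain ⟨j, h1, hj, e⟩ := exists_eq_child hk hx
  exact ⟨j, h1, hj, h ▸ e⟩

/-- The chips that a vertex sends to its children in its last firing stay there, sorted. -/
theorem Run.children_sorted (hk : 2 ≤ k) (hn : n = chipCount k m) (h : Run k m C g R) :
    ∀ v, layer k v < m → g v = 0 → ∀ i j, 1 ≤ i → i < j → j ≤ k → ∀ a b,
      C a = child k v i → C b = child k v j → a < b := by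
  induction h with
  | init =>
    intro v _ _ i j hi _ _ a b ha
    exact absurd ha.symm (child_ne_zero hi)
  | @fire C C' g R x s hr hf ih =>
    intro v hl hv i j hi hij hj a b ha hb
    have hpos := hr.one_le_of_fires hk hn hf
    rcases update_eq_zero_cases hv hpos with ⟨rfl, hg⟩ | ⟨hxv, hg⟩
    -- In the last firing of `x` its children have no firing left, hence are empty beforehand;
    -- afterwards each holds just the chip of its slot.
    · obtain ⟨-, h1, -⟩ := hr.exact hk hn hf (by omega)
      have key : ∀ i c, 1 ≤ i → i ≤ k → C' c = child k x i → c = s (slot k i) := by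
        intro i c hi hik hc
        rcases hf.eq_slot_of_apply_eq_child hk hi hik hc with h | h
        · have := h1 i hi hik
          exact absurd h (apply_ne_of_cnt_eq_zero
            (hr.cnt_child_eq_zero hk hn hpos hi hik (by omega)) c)
        · exact h
      rw [key i a hi (by omega) ha, key j b (by omega) hj hb]
      exact hf.strictMono (slot_lt_slot hi hij hj)
    · have key : ∀ i c, 1 ≤ i → i ≤ k → C' c = child k v i → C c = child k v i := by
        intro i c hi hik hc
        apply hf.eq_of_apply_eq hk hc
        · intro e
          obtain ⟨l, hl1, hl, e'⟩ := parent_eq_imp (by omega) e (child_ne_zero hi)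
          have := hr.child_eq_zero hk hn hl1 hl (hr.child_eq_zero hk hn hi hik hg)
          rw [← e'] at this
          omega
        · right
          rwa [parent_child k v i hi hik]
      exact ih v hl hg i j hi hij hj a b (key i a hi (by omega) ha) (key j b (by omega) hj hb)

/-- Of two siblings the right one always receives the larger chip. -/
theorem Run.countP_le_countP (h : Run k m C g R) {p : Fin n → Prop} [DecidablePred p]
    (hp : ∀ a b, a ≤ b → p a → p b) {v i j : ℕ} (hi : 1 ≤ i) (hij : i ≤ j) (hj : j ≤ k) :
    (R (child k v i)).countP p ≤ (R (child k v j)).countP p := by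
  induction h with
  | init => simp
  | @fire C C' g R x s hr hf ih =>
    rw [Multiset.countP_add, Multiset.countP_add]
    refine Nat.add_le_add ih ?_
    by_cases hx : x = v
    · subst hx
      rw [receipts_child hi (by omega), receipts_child (by omega) hj,
        ← Multiset.cons_zero, ← Multiset.cons_zero, Multiset.countP_cons, Multiset.countP_cons]
      refine Nat.add_le_add le_rfl ?_
      have hle : s (slot k i) ≤ s (slot k j) := by
        rcases hij.eq_or_lt with rfl | hlt
        · exact le_rfl
        · exact (hf.strictMono (slot_lt_slot hi hlt hj)).le
      split_ifs with h1 h2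
      · exact le_rfl
      · exact absurd (hp _ _ hle h1) h2
      · exact Nat.zero_le _
      · exact le_rfl
    · rw [receipts_child_of_ne hi (by omega) hx]
      simp

/-- A vertex on the last layer but one fires once and its children never fire. Before that firing
chips reach it only from its parent, and none leaves. -/
theorem Run.received_eq (hk : 2 ≤ k) (hn : n = chipCount k m) (h : Run k m C g R) :
    ∀ c, c ≠ 0 → layer k c + 1 = m → g c = 1 →
      R c = (Finset.univ.filter fun a => C a = c).val := by
  induction h with
  | init =>
    intro c hc _ _
    simp [Ne.symm hc]
  | @fire C C' g R x s hr hf ih =>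
    intro c hc hl hg
    have hpos := hr.one_le_of_fires hk hn hf
    have hxc : x ≠ c := by
      rintro rfl
      have := hr.le_odometer x
      rw [odometer, show m - layer k x = 1 by omega, fires_succ, chipCount_succ hk, fires_zero,
        chipCount_zero] at this
      rw [Function.update_self] at hg
      omega
    rw [Function.update_of_ne (Ne.symm hxc)] at hg
    have hpx : parent k x ≠ c := by
      intro e
      obtain ⟨l, hl1, hl', e'⟩ := parent_eq_imp (by omega) e hc
      have := hr.eq_zero_of_le_layer (w := x) (by rw [e', layer_child hl1 hl']; omega)
      omega
    change R c + receipts k x s c = _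
    rw [ih c hc hl hg]
    obtain ⟨j, h1, hj, e⟩ := exists_eq_child (k := k) (by omega) hc
    by_cases hx : x = parent k c
    · rw [← hx] at e
      have : (Finset.univ.filter fun a => C' a = c) =
          Finset.cons (s (slot k j)) (Finset.univ.filter fun a => C a = c)
            (by simp [hf.apply_fired, hxc]) := by
        ext a
        simp only [Finset.mem_filter, Finset.mem_univ, true_and, Finset.mem_cons]
        constructor
        · intro ha
          rw [e] at ha ⊢
          exact (hf.eq_slot_of_apply_eq_child hk h1 hj ha).symm
        · rintro (rfl | ha)
          · rw [hf.apply_slot h1 hj, e]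
          · rw [hf.apply_of_ne (by rw [ha]; exact Ne.symm hxc), ha]
      rw [this, Finset.cons_val]
      conv_lhs => rw [e, receipts_child h1 hj, ← e]
      rw [add_comm, Multiset.singleton_add]
    · rw [e, receipts_child_of_ne h1 hj hx, ← e, add_zero]
      congr 1
      ext a
      simp only [Finset.mem_filter, Finset.mem_univ, true_and]
      constructor
      · intro ha
        rw [hf.apply_of_ne (by rw [ha]; exact Ne.symm hxc), ha]
      · intro ha
        exact hf.eq_of_apply_eq hk ha hpx (Or.inr hx)

theorem countP_image_le {s : Fin (k + 1) → Fin n} (hs : StrictMono s) (i : Fin (k + 1)) :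
    ((Finset.univ.image s).val.countP fun a => s i ≤ a) + i = k + 1 := by
  rw [Finset.image_val_of_injOn hs.injective.injOn, Multiset.countP_map,
    ← Finset.filter_val, Finset.card_val]
  have : (Finset.univ.filter fun a => s i ≤ s a) = Finset.Ici i := by
    ext a
    simp [hs.le_iff_le]
  rw [this, Fin.card_Ici]
  omega

/-- The rank of the chip on a leaf among the chips that its parent received in time. -/
theorem Run.rank_of_leaf (hk : 2 ≤ k) (hn : n = chipCount k m) (h : Run k m C g R) :
    ∀ c, c ≠ 0 → layer k c + 1 = m → g c = 0 → g (parent k c) = 1 →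
      ∀ i a, 1 ≤ i → i ≤ k → C a = child k c i →
        a ∈ R c ∧ ((R c).countP fun b => a ≤ b) + (slot k i : ℕ) = k + 1 := by
  induction h with
  | init =>
    intro c _ _ _ _ i a hi _ ha
    exact absurd ha.symm (child_ne_zero hi)
  | @fire C C' g R x s hr hf ih =>
    intro c hc hl hg hgp i a hi hik ha
    have hpos := hr.one_le_of_fires hk hn hf
    have hpc : parent k c ≠ c := parent_ne_self (by omega) hc
    obtain ⟨j, h1, hj, e⟩ := exists_eq_child (k := k) (by omega) hc
    rcases update_eq_zero_cases hg hpos with ⟨rfl, hg1⟩ | ⟨hxc, hg0⟩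
    -- The single firing of `c` uses all chips on it, which are all those received so far; so the
    -- slot of a leaf is the rank of its chip in `R c`.
    · have hrc : receipts k x s x = 0 :=
        receipts_eq_zero fun j h1 hj e => child_ne_self h1 hj e.symm
      obtain ⟨hall, hch, -⟩ := hr.exact hk hn hf (by omega)
      have ha' : a = s (slot k i) := by
        rcases hf.eq_slot_of_apply_eq_child hk hi hik ha with h | h
        · have := hch i hi hik
          exact absurd h (apply_ne_of_cnt_eq_zero
            (hr.cnt_child_eq_zero hk hn hpos hi hik (by omega)) a)
        · exact h
      have hR : R x = (Finset.univ.image s).val := by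
        rw [hr.received_eq hk hn x hc hl hg1]
        congr 1
        ext b
        simp only [Finset.mem_filter, Finset.mem_univ, true_and, Finset.mem_image]
        constructor
        · exact fun hb => hall b hb
        · rintro ⟨i, rfl⟩
          exact hf.apply_fired i
      simp only [hrc, add_zero]
      subst ha'
      rw [hR]
      refine ⟨?_, countP_image_le hf.strictMono _⟩
      rw [Finset.mem_val]
      exact Finset.mem_image_of_mem s (Finset.mem_univ _)
    -- If the parent fired now it would have two firings left beforehand, while the window bounds
    -- this by `g c + 1 = 1`. So `R c` is frozen.
    · have hxp : x ≠ parent k c := by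
        intro hx
        have := (hr.window hk hn c (by omega)).2
        rw [← hx] at this hgp
        rw [Function.update_self] at hgp
        omega
      rw [Function.update_of_ne (Ne.symm hxp)] at hgp
      have ha0 : C a = child k c i := by
        apply hf.eq_of_apply_eq hk ha
        · intro e'
          obtain ⟨l, hl1, hl', e''⟩ := parent_eq_imp (by omega) e' (child_ne_zero hi)
          have := hr.eq_zero_of_le_layer (w := x)
            (by rw [e'', layer_child hl1 hl', layer_child hi hik]; omega)
          omega
        · right
          rwa [parent_child k c i hi hik]
      have hrc : receipts k x s c = 0 := by
        rw [e, receipts_child_of_ne h1 hj hxp]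
      simp only [hrc, add_zero]
      exact ih c hc hl hg0 hgp i a hi hik ha0

/-- The chips on the bottom layer increase from one family of siblings to the next. -/
theorem Run.columns_sorted (hk : 2 ≤ k) (hn : n = chipCount k m) (h : Run k m C g R) :
    ∀ v, layer k v + 2 = m → g v = 0 → ∀ i j l, 1 ≤ i → i < j → j ≤ k → 1 ≤ l → l ≤ k →
      ∀ a b, C a = child k (child k v i) l → C b = child k (child k v j) l → a < b := by
  induction h with
  | init =>
    intro v _ _ i j l _ _ _ hl _ a b ha
    exact absurd ha.symm (child_ne_zero hl)
  | @fire C C' g R x s hr hf ih =>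
    intro v hlv hv i j l hi hij hj hl1 hl a b ha hb
    have hpos := hr.one_le_of_fires hk hn hf
    have hlay : ∀ i, 1 ≤ i → i ≤ k → layer k (child k v i) + 1 = m := by
      intro i hi hik
      rw [layer_child hi hik]; omega
    have stay : (∀ i, 1 ≤ i → i ≤ k → x ≠ child k v i) → ∀ i c, 1 ≤ i → i ≤ k →
        C' c = child k (child k v i) l → C c = child k (child k v i) l := by
      intro hx i c hi hik hc
      apply hf.eq_of_apply_eq hk hc
      · intro e
        obtain ⟨l', hl1', hl', e'⟩ := parent_eq_imp (by omega) e (child_ne_zero hl1)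
        have := hr.eq_zero_of_le_layer (w := x)
          (by rw [e', layer_child hl1' hl', layer_child hl1 hl, layer_child hi hik]; omega)
        omega
      · right
        rw [parent_child k _ l hl1 hl]
        exact hx i hi hik
    rcases update_eq_zero_cases hv hpos with ⟨rfl, hg⟩ | ⟨hxv, hg⟩
    · obtain ⟨-, hch, -⟩ := hr.exact hk hn hf (by omega)
      have st := stay fun i hi hik e => child_ne_self hi hik e.symm
      -- The last firing of `x` does not touch the leaves, so the ranks are taken before it, when
      -- the children have finished and `x` has one firing left.
      have rank : ∀ i c, 1 ≤ i → i ≤ k → C' c = child k (child k x i) l →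
          c ∈ R (child k x i) ∧
            ((R (child k x i)).countP fun b => c ≤ b) + (slot k l : ℕ) = k + 1 := by
        intro i c hi hik hc
        have := hch i hi hik
        refine hr.rank_of_leaf hk hn _ (child_ne_zero hi) (hlay i hi hik) (by omega) ?_ l c hl1 hl
          (st i c hi hik hc)
        rw [parent_child k x i hi hik, hg]
      obtain ⟨-, ra⟩ := rank i a hi (by omega) ha
      obtain ⟨mb, rb⟩ := rank j b (by omega) hj hb
      by_contra hab
      have hne : b ≠ a := by
        rintro rfl
        have := (child_inj hl1 hl hl1 hl (ha.symm.trans hb)).1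
        have := (child_inj hi (by omega) (by omega) hj this).2
        omega
      have hlt : b < a := lt_of_le_of_ne (not_lt.1 hab) hne
      -- `a` and `b` have the same rank in their multisets, and that of the right sibling dominates.
      -- If `b < a`, the right one would contain strictly more chips from `b` on than the left one
      -- has from `a` on.
      have h1 := hr.countP_le_countP (p := fun c => a ≤ c) (fun _ _ h h' => h'.trans h)
        (v := x) hi hij.le hj
      obtain ⟨S, hS⟩ := Multiset.exists_cons_of_mem mb
      have h2 : ((R (child k x j)).countP fun c => a ≤ c) + 1 ≤
          (R (child k x j)).countP fun c => b ≤ c := by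
        rw [hS, Multiset.countP_cons, Multiset.countP_cons, if_neg (not_le.2 hlt),
          if_pos le_rfl, add_zero]
        refine Nat.add_le_add_right ?_ 1
        rw [Multiset.countP_eq_card_filter, Multiset.countP_eq_card_filter]
        exact Multiset.card_le_card
          (Multiset.monotone_filter_right _ fun c h => hlt.le.trans h)
      omega
    · have st := stay fun i hi hik e => by
        have := hr.child_eq_zero hk hn hi hik hg
        rw [← e] at this
        omega
      exact ih v hlv hg i j l hi hij hj hl1 hl a b (st i a hi (by omega) ha)
        (st j b (by omega) hj hb)

end Sorted

/-! ### Subtrees, and the chips that have entered them. -/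

section Below

/-- The vertex `w` belongs to the subtree rooted at `c`. -/
def Below (k c w : ℕ) : Prop := ∃ i, (parent k)^[i] w = c

variable {k m n x : ℕ} {C C' : Configuration n} {g : ℕ → ℕ} {R : ℕ → Multiset (Fin n)}
  {s : Fin (k + 1) → Fin n} {c w : ℕ}

theorem below_refl (k c : ℕ) : Below k c c := ⟨0, rfl⟩

theorem below_child {j : ℕ} (h1 : 1 ≤ j) (hj : j ≤ k) (h : Below k c w) :
    Below k c (child k w j) := by
  obtain ⟨i, hi⟩ := h
  exact ⟨i + 1, by rw [Function.iterate_succ_apply, parent_child k w j h1 hj, hi]⟩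

theorem below_parent (h : Below k c w) (hw : w ≠ c) : Below k c (parent k w) := by
  obtain ⟨_ | i, hi⟩ := h
  · exact absurd hi hw
  · exact ⟨i, by rw [← Function.iterate_succ_apply, hi]⟩

theorem below_of_below_parent (h : Below k c (parent k w)) : Below k c w := by
  obtain ⟨i, hi⟩ := h
  exact ⟨i + 1, by rw [Function.iterate_succ_apply, hi]⟩

theorem below_child_cases {j : ℕ} (h1 : 1 ≤ j) (hj : j ≤ k) (h : Below k c (child k w j)) :
    c = child k w j ∨ Below k c w := by
  by_cases hc : child k w j = c
  · exact Or.inl hc.symm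
  · right
    have := below_parent h hc
    rwa [parent_child k w j h1 hj] at this

theorem below_trans {d : ℕ} (h : Below k c d) (h' : Below k d w) : Below k c w := by
  obtain ⟨i, hi⟩ := h
  obtain ⟨j, hj⟩ := h'
  exact ⟨i + j, by rw [Function.iterate_add_apply, hj, hi]⟩

theorem below_zero (hk : 1 ≤ k) (w : ℕ) : Below k 0 w := by
  have : ∀ t w, layer k w ≤ t → Below k 0 w := by
    intro t
    induction t with
    | zero =>
      intro w hw
      have := layer_pos (k := k) w
      omega
    | succ t ih =>
      intro w hw
      by_cases h : w = 0
      · subst h; exact below_refl k 0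
      · have := layer_eq_layer_parent hk h
        exact below_of_below_parent (ih _ (by omega))
  exact this _ w le_rfl

theorem eq_zero_of_below_zero (h : Below k c 0) : c = 0 := by
  obtain ⟨i, hi⟩ := h
  have : ∀ i, (parent k)^[i] 0 = 0 := by
    intro i
    induction i with
    | zero => rfl
    | succ i ih => rw [Function.iterate_succ_apply, parent_zero, ih]
  rw [← hi, this]

theorem layer_le_of_below (hk : 1 ≤ k) (h : Below k c w) : layer k c ≤ layer k w := by
  obtain ⟨i, hi⟩ := h
  induction i generalizing w with
  | zero => exact (congrArg (layer k) hi.symm).le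
  | succ i ih =>
    rw [Function.iterate_succ_apply] at hi
    have := ih hi
    by_cases hw : w = 0
    · subst hw; rwa [parent_zero] at this
    · have := layer_eq_layer_parent hk hw
      omega

theorem not_below_child_self (hk : 1 ≤ k) {v j : ℕ} (h1 : 1 ≤ j) (hj : j ≤ k) :
    ¬ Below k (child k v j) v := by
  intro h
  have := layer_le_of_below hk h
  rw [layer_child h1 hj] at this
  omega

theorem FiresWith.below (hf : FiresWith k x s C C') (hk : 2 ≤ k) {a : Fin n} (hx : x ≠ c)
    (h : Below k c (C a)) : Below k c (C' a) := by
  rcases hf.cases hk a with ⟨-, e⟩ | ⟨-, e1, e2⟩ | ⟨j, h1, hj, -, e1, e2⟩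
  · rwa [e]
  · rw [e1] at h
    rw [e2]
    exact below_parent h hx
  · rw [e1] at h
    rw [e2]
    exact below_child h1 hj h

theorem FiresWith.below_or_eq_mid (hf : FiresWith k x s C C') (hk : 2 ≤ k) {a : Fin n}
    (h : Below k c (C a)) : Below k c (C' a) ∨ (x = c ∧ a = s (midSlot k)) := by
  rcases hf.cases hk a with ⟨-, e⟩ | ⟨e0, e1, e2⟩ | ⟨j, h1, hj, -, e1, e2⟩
  · rw [e]; exact Or.inl h
  · rw [e1] at h
    by_cases hx : x = c
    · exact Or.inr ⟨hx, e0⟩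
    · rw [e2]
      exact Or.inl (below_parent h hx)
  · rw [e1] at h
    rw [e2]
    exact Or.inl (below_child h1 hj h)

open Classical in
/-- All chips in a subtree have been received by its root. -/
theorem Run.card_below_le (hk : 2 ≤ k) (h : Run k m C g R) (p : Fin n → Prop) [DecidablePred p]
    (hc : c ≠ 0) :
    (Finset.univ.filter fun a => p a ∧ Below k c (C a)).card ≤ (R c).countP p := by
  induction h with
  | init =>
    rw [Finset.card_eq_zero.2]
    · exact Nat.zero_le _
    · rw [Finset.filter_eq_empty_iff]
      exact fun _ _ h => hc (eq_zero_of_below_zero h.2)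
  | @fire C C' g R x s hr hf ih =>
    have hsum := hf.sum_eq hk fun a u => if p a ∧ Below k c u then 1 else 0
    rw [sum_fin_eq_mid_add_slot,
      ← Finset.card_filter (fun a => p a ∧ Below k c (C' a)) Finset.univ,
      ← Finset.card_filter (fun a => p a ∧ Below k c (C a)) Finset.univ] at hsum
    change _ ≤ (R c + receipts k x s c).countP p
    rw [Multiset.countP_add]
    -- A firing inside the subtree brings no chip in; one outside brings in a chip only if `c` is a
    -- child of `x`, and this chip is recorded in `R c`.
    by_cases hb : Below k c x
    · have h1 : ∑ j ∈ Finset.Icc 1 k, (if p (s (slot k j)) ∧ Below k c x then 1 else 0) =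
          ∑ j ∈ Finset.Icc 1 k, if p (s (slot k j)) ∧ Below k c (child k x j) then 1 else 0 := by
        apply Finset.sum_congr rfl
        intro j hj
        rw [Finset.mem_Icc] at hj
        simp only [hb, below_child hj.1 hj.2 hb]
      have h2 : (if p (s (midSlot k)) ∧ Below k c (parent k x) then 1 else 0) ≤
          if p (s (midSlot k)) ∧ Below k c x then 1 else 0 := by
        simp only [hb, and_true]
        split_ifs with h3 h4
        · exact le_rfl
        · exact absurd h3.1 h4
        · exact Nat.zero_le _
        · exact le_rfl
      omega
    · have h0 : ¬ Below k c (parent k x) := fun h => hb (below_of_below_parent h)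
      simp only [hb, h0, and_false, if_false, Finset.sum_const_zero, add_zero, zero_add] at hsum
      rw [hsum]
      refine Nat.add_le_add ih ?_
      by_cases hcx : ∃ j, 1 ≤ j ∧ j ≤ k ∧ c = child k x j
      · obtain ⟨j, h1, hj, rfl⟩ := hcx
        rw [receipts_child h1 hj, ← Multiset.cons_zero, Multiset.countP_cons,
          Multiset.countP_zero, zero_add, Finset.sum_eq_single j]
        · simp [below_refl]
        · intro i hi hij
          rw [Finset.mem_Icc] at hi
          rw [if_neg]
          rintro ⟨-, h⟩
          rcases below_child_cases hi.1 hi.2 h with e | e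
          · exact hij (child_inj h1 hj hi.1 hi.2 e).2.symm
          · exact hb e
        · exact fun h => absurd (Finset.mem_Icc.2 ⟨h1, hj⟩) h
      · rw [Finset.sum_eq_zero]
        · exact Nat.zero_le _
        intro j hj
        rw [Finset.mem_Icc] at hj
        rw [if_neg]
        rintro ⟨-, h⟩
        rcases below_child_cases hj.1 hj.2 h with e | e
        · exact hcx ⟨j, hj.1, hj.2, e⟩
        · exact hb e

end Below

/-! ### The binary tree: left and right treated alike. -/

section Binary

theorem Run.card_received {k m n : ℕ} {C : Configuration n} {g : ℕ → ℕ}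
    {R : ℕ → Multiset (Fin n)} (h : Run k m C g R) {v i j : ℕ} (hi : 1 ≤ i) (hik : i ≤ k)
    (hj : 1 ≤ j) (hjk : j ≤ k) : (R (child k v i)).card = (R (child k v j)).card := by
  induction h with
  | init => rfl
  | @fire C C' g R x s hr hf ih =>
    rw [Multiset.card_add, Multiset.card_add, ih]
    by_cases hx : x = v
    · subst hx
      rw [receipts_child hi hik, receipts_child hj hjk]
      simp
    · rw [receipts_child_of_ne hi hik hx, receipts_child_of_ne hj hjk hx]

/-- For the binary tree: the chips are compared in increasing order, and `e`, `e'` are the right and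
the left child; or they are compared in decreasing order, and the children are exchanged. -/
structure Side {n : ℕ} (r : Fin n → Fin n → Prop) (e e' : ℕ) : Prop where
  refl : ∀ a, r a a
  trans : ∀ a b c, r a b → r b c → r a c
  total : ∀ a b, r a b ∨ r b a
  index : (e = 1 ∧ e' = 2) ∨ (e = 2 ∧ e' = 1)
  top : ∀ s : Fin 3 → Fin n, StrictMono s → ∀ i, r (s i) (s (slot 2 e))
  bot : ∀ s : Fin 3 → Fin n, StrictMono s → ∀ i, r (s (slot 2 e')) (s i)
  mid : ∀ s : Fin 3 → Fin n, StrictMono s → ∀ i, i ≠ slot 2 e → r (s i) (s (midSlot 2))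
  dominance : ∀ {m : ℕ} {C : Configuration n} {g : ℕ → ℕ} {R : ℕ → Multiset (Fin n)},
    Run 2 m C g R → ∀ (p : Fin n → Prop) [DecidablePred p], (∀ a b, r a b → p a → p b) →
      ∀ v j, 1 ≤ j → j ≤ 2 → (R (child 2 v j)).countP p ≤ (R (child 2 v e)).countP p

theorem slot_two_one : slot 2 1 = 0 := by decide

theorem slot_two_two : slot 2 2 = 2 := by decide

theorem midSlot_two : midSlot 2 = 1 := by decide

theorem side_le (n : ℕ) : Side (n := n) (fun a b => a ≤ b) 2 1 where
  refl := le_refl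
  trans _ _ _ := le_trans
  total := le_total
  index := Or.inr ⟨rfl, rfl⟩
  top s hs i := hs.monotone (by rw [slot_two_two]; exact Fin.le_last i)
  bot s hs i := hs.monotone (by rw [slot_two_one]; exact Fin.zero_le i)
  mid s hs i hi := hs.monotone (by
    rw [slot_two_two] at hi
    rw [midSlot_two]
    revert i
    decide)
  dominance h p _ hp v j h1 hj := h.countP_le_countP hp h1 hj le_rfl

theorem side_ge (n : ℕ) : Side (n := n) (fun a b => b ≤ a) 1 2 where
  refl := le_refl
  trans _ _ _ h h' := le_trans h' h
  total a b := le_total b a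
  index := Or.inl ⟨rfl, rfl⟩
  top s hs i := hs.monotone (by rw [slot_two_one]; exact Fin.zero_le i)
  bot s hs i := hs.monotone (by rw [slot_two_two]; exact Fin.le_last i)
  mid s hs i hi := hs.monotone (by
    rw [slot_two_one] at hi
    rw [midSlot_two]
    revert i
    decide)
  dominance := by
    intro m C g R h p _ hp v j h1 hj
    -- Siblings receive equally many chips, so domination for the complement of `p` gives the
    -- reversed domination for `p`.
    have h2 := h.countP_le_countP (p := fun a => ¬ p a)
      (fun a b hab ha hb => ha (hp b a hab hb)) (v := v) le_rfl h1 hj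
    have h3 := Multiset.card_eq_countP_add_countP p (R (child 2 v j))
    have h4 := Multiset.card_eq_countP_add_countP p (R (child 2 v 1))
    have h5 := h.card_received (v := v) h1 hj (le_refl 1) (by omega)
    omega

end Binary

/-! ### The binary tree: how many extreme chips a child has received. -/

section BinaryInvariants

variable {m n x : ℕ} {C C' : Configuration n} {g : ℕ → ℕ} {R : ℕ → Multiset (Fin n)}
  {s : Fin (2 + 1) → Fin n} {r : Fin n → Fin n → Prop} {e e' : ℕ}

theorem Side.one_le (hS : Side r e e') : 1 ≤ e := by have := hS.index; omega
theorem Side.le_two (hS : Side r e e') : e ≤ 2 := by have := hS.index; omega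
theorem Side.cases (hS : Side r e e') {j : ℕ} (h1 : 1 ≤ j) (hj : j ≤ 2) : j = e ∨ j = e' := by
  have := hS.index; omega

theorem Side.mid_top (hS : Side r e e') (hf : FiresWith 2 x s C C') :
    r (s (midSlot 2)) (s (slot 2 e)) := hS.top s hf.strictMono _

theorem Side.apply_top (hS : Side r e e') (hf : FiresWith 2 x s C C') :
    C' (s (slot 2 e)) = child 2 x e := hf.apply_slot hS.one_le hS.le_two

theorem Side.mid_ne_top (hS : Side r e e') (hf : FiresWith 2 x s C C') :
    s (midSlot 2) ≠ s (slot 2 e) := fun h =>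
  slot_ne_midSlot hS.one_le hS.le_two (hf.strictMono.injective h).symm

theorem window_fire (hpos : 1 ≤ g x) {v : ℕ} (hxv : v ≠ x ∨ v = x) :
    (v = x ∧ Function.update g x (g x - 1) v + 1 = g v) ∨
      (v ≠ x ∧ Function.update g x (g x - 1) v = g v) := by
  rcases hxv with h | rfl
  · exact Or.inr ⟨h, Function.update_of_ne h _ _⟩
  · left
    rw [Function.update_self]
    exact ⟨rfl, by omega⟩

/-- Makes the initial case of the window invariants below vacuous. -/
theorem not_window_odometer (m v : ℕ) : ¬ odometer 2 m v + layer 2 v < m := by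
  have h1 : ∀ t, t ≤ fires 2 t := by
    intro t
    induction t with
    | zero => simp
    | succ t ih => rw [fires_succ, chipCount_succ le_rfl]; omega
  have := h1 (m - layer 2 v)
  unfold odometer
  omega

variable [DecidableRel r]

/-- The number of chips beyond `q` (in the sense of `r`) received by `w` from its parent. -/
def beyond (r : Fin n → Fin n → Prop) [DecidableRel r] (R : ℕ → Multiset (Fin n)) (q : Fin n)
    (w : ℕ) : ℕ := (R w).countP (r q)

theorem beyond_fire_child (q : Fin n) {j : ℕ} (h1 : 1 ≤ j) (hj : j ≤ 2) :
    beyond r (fun w => R w + receipts 2 x s w) q (child 2 x j) =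
      beyond r R q (child 2 x j) + if r q (s (slot 2 j)) then 1 else 0 := by
  unfold beyond
  rw [Multiset.countP_add, receipts_child h1 hj, ← Multiset.cons_zero, Multiset.countP_cons]
  simp

theorem beyond_fire_child_ne (q : Fin n) {v j : ℕ} (h1 : 1 ≤ j) (hj : j ≤ 2) (hx : x ≠ v) :
    beyond r (fun w => R w + receipts 2 x s w) q (child 2 v j) = beyond r R q (child 2 v j) := by
  unfold beyond
  rw [Multiset.countP_add, receipts_child_of_ne h1 hj hx]
  simp

theorem beyond_fire_cases (q : Fin n) (w : ℕ) :
    beyond r (fun w => R w + receipts 2 x s w) q w = beyond r R q w ∨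
      (beyond r (fun w => R w + receipts 2 x s w) q w = beyond r R q w + 1 ∧
        ∃ j, 1 ≤ j ∧ j ≤ 2 ∧ w = child 2 x j ∧ r q (s (slot 2 j))) := by
  by_cases h : ∃ j, 1 ≤ j ∧ j ≤ 2 ∧ w = child 2 x j
  · obtain ⟨j, h1, hj, rfl⟩ := h
    rw [beyond_fire_child q h1 hj]
    split_ifs with h
    · exact Or.inr ⟨rfl, j, h1, hj, rfl, h⟩
    · exact Or.inl rfl
  · left
    change (R w + receipts 2 x s w).countP (r q) = _
    rw [receipts_eq_zero fun j h1 hj e => h ⟨j, h1, hj, e⟩, add_zero]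
    rfl

theorem beyond_le_fire (q : Fin n) (w : ℕ) :
    beyond r R q w ≤ beyond r (fun w => R w + receipts 2 x s w) q w := by
  unfold beyond
  rw [Multiset.countP_add]
  exact Nat.le_add_right _ _

theorem beyond_anti (hS : Side r e e') {q q' : Fin n} (h : r q q') (w : ℕ) :
    beyond r R q' w ≤ beyond r R q w := by
  unfold beyond
  rw [Multiset.countP_eq_card_filter, Multiset.countP_eq_card_filter]
  exact Multiset.card_le_card
    (Multiset.monotone_filter_right _ fun c hc => hS.trans _ _ _ h hc)

theorem Side.beyond_le (hS : Side r e e') (h : Run 2 m C g R) (q : Fin n) {v j : ℕ}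
    (h1 : 1 ≤ j) (hj : j ≤ 2) : beyond r R q (child 2 v j) ≤ beyond r R q (child 2 v e) :=
  hS.dominance h (r q) (fun _ _ hab ha => hS.trans _ _ _ ha hab) v j h1 hj

theorem Side.beyond_top (hS : Side r e e') (hf : FiresWith 2 x s C C') {q : Fin n}
    {i : Fin (2 + 1)} (h : r q (s i)) :
    beyond r (fun w => R w + receipts 2 x s w) q (child 2 x e) =
      beyond r R q (child 2 x e) + 1 := by
  rw [beyond_fire_child q hS.one_le hS.le_two, if_pos]
  exact hS.trans _ _ _ h (hS.top s hf.strictMono i)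

/-- The chip that a vertex sends to its parent is not the most extreme one it has received. -/
theorem Side.two_le_beyond_mid (hS : Side r e e') (h : Run 2 m C g R)
    (hf : FiresWith 2 x s C C') (hx : x ≠ 0) :
    2 ≤ beyond r R (s (midSlot 2)) (child 2 (parent 2 x) e) := by
  classical
  obtain ⟨j, h1, hj, hxe⟩ := exists_eq_child (k := 2) (by omega) hx
  have h3 := hS.beyond_le h (s (midSlot 2)) (v := parent 2 x) h1 hj
  rw [← hxe] at h3
  refine le_trans ?_ h3
  refine le_trans ?_ (h.card_below_le le_rfl (r (s (midSlot 2))) hx)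
  -- The middle and the most extreme of the fired chips are both in the subtree of `x`, so `x` has
  -- received two such chips, and the extreme sibling no fewer.
  refine (Finset.card_pair (hS.mid_ne_top hf)).symm.trans_le (Finset.card_le_card ?_)
  intro a ha
  rw [Finset.mem_insert, Finset.mem_singleton] at ha
  rw [Finset.mem_filter]
  refine ⟨Finset.mem_univ _, ?_⟩
  rcases ha with rfl | rfl
  · rw [hf.apply_fired]
    exact ⟨hS.refl _, below_refl _ _⟩
  · rw [hf.apply_fired]
    exact ⟨hS.mid_top hf, below_refl _ _⟩

/-- When a chip beyond `q` is fired from `v`, the chip going to the extreme child is at least as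
extreme. -/
theorem Run.exists_or_one_le (hS : Side r e e') (h : Run 2 m C g R) :
    ∀ v q, 1 ≤ beyond r R q v → (∃ a, C a = v ∧ r q a) ∨ 1 ≤ beyond r R q (child 2 v e) := by
  induction h with
  | init => intro v q h; simp [beyond] at h
  | @fire C C' g R x s hr hf ih =>
    intro v q hv
    rcases beyond_fire_cases (r := r) (R := R) (x := x) (s := s) q v with h | ⟨-, j, h1, hj, hvx, hq⟩
    · rw [h] at hv
      rcases ih v q hv with ⟨a, ha, hqa⟩ | h'
      · by_cases hra : a ∈ Set.range s
        · obtain ⟨i, rfl⟩ := hra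
          right
          rw [hf.apply_fired] at ha
          subst ha
          rw [hS.beyond_top hf hqa]
          omega
        · exact Or.inl ⟨a, by rw [hf.apply_of_notMem hra, ha], hqa⟩
      · exact Or.inr (h'.trans (beyond_le_fire _ _))
    · exact Or.inl ⟨_, by rw [hf.apply_slot h1 hj, hvx], hq⟩

/-- If a child has fired since the last firing of its parent `p`, then `p` holds the chip that
it has sent up. -/
theorem Run.exists_at_parent (hS : Side r e e') (hn : n = chipCount 2 m) (h : Run 2 m C g R) :
    ∀ v, v ≠ 0 → g (parent 2 v) + layer 2 (parent 2 v) < m → g v + 1 = g (parent 2 v) →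
      ∃ q, C q = parent 2 v ∧ 1 ≤ beyond r R q (child 2 v e) := by
  induction h with
  | init => intro v _ h; exact absurd h (not_window_odometer m _)
  | @fire C C' g R x s hr hf ih =>
    intro v hv hw hg
    have hpos := hr.one_le_of_fires le_rfl hn hf
    have hpv := parent_ne_self (k := 2) (by omega) hv
    rcases window_fire (x := x) (v := v) hpos (ne_or_eq _ _) with ⟨rfl, h1⟩ | ⟨h0, h1⟩
    · refine ⟨s (midSlot 2), hf.apply_mid le_rfl, ?_⟩
      rw [hS.beyond_top hf (hS.refl _)]
      omega
    · rcases window_fire (x := x) (v := parent 2 v) hpos (ne_or_eq _ _) with ⟨h2, h3⟩ | ⟨h2, h3⟩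
      -- The parent fires in the window only when each child is one firing behind it; afterwards the
      -- two numbers agree, against `hg`.
      · have := (hr.exact le_rfl hn hf (by rw [← h2]; omega)).2.1
        obtain ⟨j, hj1, hj, he⟩ := exists_eq_child (k := 2) (by omega) hv
        have := this j hj1 hj
        rw [← h2, ← he] at this
        omega
      · rw [h3] at hw hg
        obtain ⟨q, hq, hb⟩ := ih v hv hw (by omega)
        exact ⟨q, by rw [hf.apply_of_ne (by rw [hq]; exact h2), hq],
          hb.trans (beyond_le_fire _ _)⟩

/-- Near the end of a run a child of every vertex `v` has received a chip that is more extreme than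
any chip on `v`. -/
theorem Run.one_le_beyond (hS : Side r e e') (hn : n = chipCount 2 m) (h : Run 2 m C g R) :
    ∀ v, g v + layer 2 v < m → ∀ q, C q = v → 1 ≤ beyond r R q (child 2 v e) := by
  induction h with
  | init => intro v h; exact absurd h (not_window_odometer m _)
  | @fire C C' g R x s hr hf ih =>
    intro v hw q hq
    have hpos := hr.one_le_of_fires le_rfl hn hf
    -- The chip `q` was on `v` already, has come up from a child, or has come down from the parent
    -- `x`. The last case is the substantial one.
    rcases hf.cases le_rfl q with ⟨h0, e0⟩ | ⟨rfl, -, e0⟩ | ⟨j, h1, hj, rfl, -, e0⟩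
    · rw [e0] at hq
      rcases window_fire (x := x) (v := v) hpos (ne_or_eq _ _) with ⟨rfl, h1⟩ | ⟨-, h1⟩
      · exact absurd ((hr.exact le_rfl hn hf (by omega)).1 q hq) h0
      · rw [h1] at hw
        exact (ih v hw q hq).trans (beyond_le_fire _ _)
    · rw [hq] at e0
      by_cases hx : x = 0
      · subst hx
        rw [parent_zero] at e0
        subst e0
        rw [hS.beyond_top hf (hS.refl _)]
        omega
      · have := hS.two_le_beyond_mid hr hf hx
        rw [← e0] at this
        exact (le_trans (by omega) this).trans (beyond_le_fire _ _)
    · rw [hq] at e0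
      subst e0
      have hne := child_ne_self (k := 2) (v := x) h1 hj
      rw [Function.update_of_ne hne] at hw
      have hp := parent_child 2 x j h1 hj
      have hl := layer_child (k := 2) (v := x) h1 hj
      have hJ := (hr.window le_rfl hn _ hw).2
      rw [hp] at hJ
      obtain ⟨hall, hch, -⟩ := hr.exact le_rfl hn hf (by omega)
      have hgj := hch j h1 hj
      refine le_trans ?_ (beyond_le_fire _ _)
      rcases hS.cases h1 hj with rfl | rfl
      -- `v` is the extreme child of `x`. By induction at `x` it has received a chip beyond `q`,
      -- which either is matched by one still on `v` or has led to one for the extreme child of `v`.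
      · have hb := ih x (by omega) _ (hf.apply_fired (slot 2 j))
        rcases hr.exists_or_one_le hS _ _ hb with ⟨a, ha, hqa⟩ | h'
        · exact (ih _ hw a ha).trans (beyond_anti hS hqa _)
        · exact h'
      -- `v` is the other child. The chip `a` that it sent up takes part in this firing of `x`, and
      -- `q` is the least extreme of the fired chips.
      · obtain ⟨a, ha, hb⟩ := hr.exists_at_parent hS hn (child 2 x j) (child_ne_zero h1)
          (by rw [hp]; omega) (by rw [hp]; exact hgj)
        rw [hp] at ha
        obtain ⟨i, rfl⟩ := hall a ha
        exact hb.trans (beyond_anti hS (hS.bot s hf.strictMono i) _)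

/-- A firing of `v` in the window empties it. While the parent still lags behind, every chip on `v`
has come up from a child, and `Side.two_le_beyond_mid` applies to it. -/
theorem Run.two_le_beyond_of_waiting (hS : Side r e e') (hn : n = chipCount 2 m)
    (h : Run 2 m C g R) :
    ∀ v, v ≠ 0 → g v + layer 2 v < m → g (parent 2 v) = g v + 1 →
      ∀ q, C q = v → 2 ≤ beyond r R q (child 2 v e) := by
  induction h with
  | init => intro v _ h; exact absurd h (not_window_odometer m _)
  | @fire C C' g R x s hr hf ih =>
    intro v hv hw hg q hq
    have hpos := hr.one_le_of_fires le_rfl hn hf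
    have hxp : x ≠ parent 2 v := by
      rintro rfl
      have hne := (parent_ne_self (k := 2) (by omega) hv).symm
      rw [Function.update_of_ne hne] at hw hg
      have := (hr.window le_rfl hn _ hw).2
      rw [Function.update_self] at hg
      omega
    rw [Function.update_of_ne (Ne.symm hxp)] at hg
    rcases hf.cases le_rfl q with ⟨h0, e0⟩ | ⟨rfl, -, e0⟩ | ⟨j, h1, hj, rfl, -, e0⟩
    · rw [e0] at hq
      rcases window_fire (x := x) (v := v) hpos (ne_or_eq _ _) with ⟨rfl, h1⟩ | ⟨-, h1⟩
      · exact absurd ((hr.exact le_rfl hn hf (by omega)).1 q hq) h0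
      · rw [h1] at hw hg
        exact (ih v hv hw hg q hq).trans (beyond_le_fire _ _)
    · rw [hq] at e0
      have hx : x ≠ 0 := by
        rintro rfl
        rw [parent_zero] at e0
        exact hv e0
      have := hS.two_le_beyond_mid hr hf hx
      rw [← e0] at this
      exact this.trans (beyond_le_fire _ _)
    · rw [hq] at e0
      rw [e0, parent_child 2 x j h1 hj] at hxp
      exact absurd rfl hxp

/-- When the pair forms, either the newcomer comes up from a child, or it comes down from the parent
and the other chip has been waiting on `v`. In both cases one of the two chips already has two
received chips beyond it, and `q` is the less extreme of the pair. At the root a chip returned by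
the self-loop finds the vertex empty. -/
theorem Run.two_le_beyond_of_pair (hS : Side r e e') (hn : n = chipCount 2 m)
    (h : Run 2 m C g R) :
    ∀ v, g v + layer 2 v < m → ∀ q q', q ≠ q' → C q = v → C q' = v → r q q' →
      2 ≤ beyond r R q (child 2 v e) := by
  induction h with
  | init => intro v h; exact absurd h (not_window_odometer m _)
  | @fire C C' g R x s hr hf ih =>
    intro v hw q q' hne hq hq' hqq
    have hpos := hr.one_le_of_fires le_rfl hn hf
    have hxv : x = v → ∀ a, C a = v → a ∈ Set.range s := by
      rintro rfl a ha
      rw [Function.update_self] at hw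
      exact (hr.exact le_rfl hn hf (by omega)).1 a ha
    have hmid : x ≠ 0 → v = parent 2 x → 2 ≤ beyond r R (s (midSlot 2)) (child 2 v e) := by
      rintro hx rfl
      exact hS.two_le_beyond_mid hr hf hx
    have hwait : ∀ j, 1 ≤ j → j ≤ 2 → v = child 2 x j → ∀ a, C a = v →
        2 ≤ beyond r R a (child 2 v e) := by
      rintro j h1 hj rfl a ha
      have hne := child_ne_self (k := 2) (v := x) h1 hj
      rw [Function.update_of_ne hne] at hw
      have hp := parent_child 2 x j h1 hj
      have hl := layer_child (k := 2) (v := x) h1 hj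
      have hJ := (hr.window le_rfl hn _ hw).2
      rw [hp] at hJ
      obtain ⟨-, hch, -⟩ := hr.exact le_rfl hn hf (by omega)
      refine hr.two_le_beyond_of_waiting hS hn _ (child_ne_zero h1) hw ?_ a ha
      rw [hp, hch j h1 hj]
    refine le_trans ?_ (beyond_le_fire _ _)
    rcases hf.cases le_rfl q with ⟨h0, e0⟩ | ⟨rfl, -, e0⟩ | ⟨j, h1, hj, rfl, -, e0⟩
    · have hqv := e0.symm.trans hq
      have hx : x ≠ v := fun hx => h0 (hxv hx q hqv)
      rcases hf.cases le_rfl q' with ⟨h0', e0'⟩ | ⟨rfl, -, e0'⟩ | ⟨j, h1, hj, rfl, -, e0'⟩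
      · rw [Function.update_of_ne (Ne.symm hx)] at hw
        exact ih v hw q q' hne hqv (e0'.symm.trans hq') hqq
      · have hvp := hq'.symm.trans e0'
        refine (hmid ?_ hvp).trans (beyond_anti hS hqq _)
        rintro rfl
        exact hx (by rw [hvp, parent_zero])
      · exact hwait j h1 hj (hq'.symm.trans e0') q hqv
    · have hvp := hq.symm.trans e0
      by_cases hx : x = 0
      · subst hx
        rw [parent_zero] at hvp
        rcases hf.cases le_rfl q' with ⟨h0', e0'⟩ | ⟨rfl, -, e0'⟩ | ⟨j, h1, hj, rfl, -, e0'⟩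
        · exact absurd (hxv hvp.symm q' (e0'.symm.trans hq')) h0'
        · exact absurd rfl hne
        · rw [hq', hvp] at e0'
          exact absurd e0'.symm (child_ne_zero h1)
      · exact hmid hx hvp
    · have hvc := hq.symm.trans e0
      rcases hf.cases le_rfl q' with ⟨h0', e0'⟩ | ⟨rfl, -, e0'⟩ | ⟨i, hi1, hi, rfl, -, e0'⟩
      · exact (hwait j h1 hj hvc q' (e0'.symm.trans hq')).trans (beyond_anti hS hqq _)
      · rw [hq', hvc] at e0'
        exact absurd e0'.symm (parent_ne_child (by omega) h1 hj)
      · rw [hq', hvc] at e0'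
        rw [(child_inj h1 hj hi1 hi e0').2] at hne
        exact absurd rfl hne

/-- The analogue of `Run.exists_at_parent` with two chips: the one sent up was on `v` together with
a more extreme one, so `Run.two_le_beyond_of_pair` applies. This needs `v` in the window before its
firing, whence one more layer in the hypothesis. -/
theorem Run.exists_two_le_at_parent (hS : Side r e e') (hn : n = chipCount 2 m)
    (h : Run 2 m C g R) :
    ∀ v, v ≠ 0 → g (parent 2 v) + layer 2 (parent 2 v) + 1 < m → g v + 1 = g (parent 2 v) →
      ∃ q, C q = parent 2 v ∧ 2 ≤ beyond r R q (child 2 v e) := by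
  induction h with
  | init => intro v _ h; exact absurd (by omega) (not_window_odometer m (parent 2 v))
  | @fire C C' g R x s hr hf ih =>
    intro v hv hw hg
    have hpos := hr.one_le_of_fires le_rfl hn hf
    have hpv := parent_ne_self (k := 2) (by omega) hv
    have hl := layer_eq_layer_parent (k := 2) (by omega) hv
    rcases window_fire (x := x) (v := v) hpos (ne_or_eq _ _) with ⟨rfl, h1⟩ | ⟨h0, h1⟩
    · refine ⟨s (midSlot 2), hf.apply_mid le_rfl, ?_⟩
      rw [Function.update_of_ne hpv] at hw hg
      exact (hr.two_le_beyond_of_pair hS hn v (by omega) _ _ (hS.mid_ne_top hf)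
        (hf.apply_fired _) (hf.apply_fired _) (hS.mid_top hf)).trans (beyond_le_fire _ _)
    · rcases window_fire (x := x) (v := parent 2 v) hpos (ne_or_eq _ _) with ⟨h2, h3⟩ | ⟨h2, h3⟩
      · have := (hr.exact le_rfl hn hf (by rw [← h2]; omega)).2.1
        obtain ⟨j, hj1, hj, he⟩ := exists_eq_child (k := 2) (by omega) hv
        have := this j hj1 hj
        rw [← h2, ← he] at this
        omega
      · rw [h3] at hw hg
        obtain ⟨q, hq, hb⟩ := ih v hv hw (by omega)
        exact ⟨q, by rw [hf.apply_of_ne (by rw [hq]; exact h2), hq],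
          hb.trans (beyond_le_fire _ _)⟩

/-- As long as the extreme child has got nothing beyond `q`, no such chip has ever been fired from
`v`. Those received are all still there and distinct. -/
theorem Run.beyond_le_card (hS : Side r e e') (h : Run 2 m C g R) :
    ∀ v q, beyond r R q (child 2 v e) = 0 →
      beyond r R q v ≤ (Finset.univ.filter fun a => C a = v ∧ r q a).card := by
  induction h with
  | init => intro v q _; simp [beyond]
  | @fire C C' g R x s hr hf ih =>
    intro v q h0
    have h0' : beyond r R q (child 2 v e) = 0 := by
      have := beyond_le_fire (r := r) (R := R) (x := x) (s := s) q (child 2 v e)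
      omega
    have hih := ih v q h0'
    have hsub : (Finset.univ.filter fun a => C a = v ∧ r q a) ⊆
        Finset.univ.filter fun a => C' a = v ∧ r q a := by
      intro a ha
      rw [Finset.mem_filter] at ha ⊢
      obtain ⟨-, ha, hqa⟩ := ha
      refine ⟨Finset.mem_univ _, ?_, hqa⟩
      by_cases hra : a ∈ Set.range s
      · obtain ⟨i, rfl⟩ := hra
        rw [hf.apply_fired] at ha
        subst ha
        rw [hS.beyond_top hf hqa] at h0
        omega
      · rw [hf.apply_of_notMem hra, ha]
    rcases beyond_fire_cases (r := r) (R := R) (x := x) (s := s) q v with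
      h | ⟨h, j, h1, hj, rfl, hq⟩
    · rw [h]
      exact hih.trans (Finset.card_le_card hsub)
    · rw [h]
      refine (Nat.succ_le_succ hih).trans (Finset.card_lt_card ⟨hsub, fun hss => ?_⟩)
      have : s (slot 2 j) ∈ Finset.univ.filter fun a => C' a = child 2 x j ∧ r q a := by
        simp [hf.apply_slot h1 hj, hq]
      have := (Finset.mem_filter.1 (hss this)).2.1
      rw [hf.apply_fired] at this
      exact child_ne_self h1 hj this.symm

/-- Of two chips beyond `q` that the extreme child of `p` has received, firing it passes one further
down. If both are fired together for the first time, the middle chip sent up to `p` is still beyond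
`q`. -/
theorem Run.two_le_beyond_or_exists (hS : Side r e e') (h : Run 2 m C g R) :
    ∀ p q, 2 ≤ beyond r R q (child 2 p e) → 2 ≤ beyond r R q (child 2 (child 2 p e) e) ∨
      (∃ a, C a = child 2 p e ∧ r q a) ∨ ∃ a, C a = p ∧ r q a := by
  induction h with
  | init => intro p q h; simp [beyond] at h
  | @fire C C' g R x s hr hf ih =>
    intro p q h2
    have hpv : child 2 p e ≠ p := child_ne_self hS.one_le hS.le_two
    rcases beyond_fire_cases (r := r) (R := R) (x := x) (s := s) q (child 2 p e) with
      h | ⟨-, j, h1, hj, hvx, hq⟩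
    · rw [h] at h2
      by_cases hx : x = child 2 p e
      · by_cases hQ : ∃ i, r q (s i)
        · obtain ⟨i, hi⟩ := hQ
          have htop := hS.beyond_top (R := R) hf hi
          rw [← hx, htop]
          by_cases h0 : beyond r R q (child 2 x e) = 0
          · have hc := hr.beyond_le_card hS x q h0
            rw [hx] at hc
            obtain ⟨a, b, ha, hb, hab⟩ := Finset.one_lt_card_iff.1 (h2.trans hc)
            rw [Finset.mem_filter] at ha hb
            right
            by_cases hra : a ∈ Set.range s
            · by_cases hrb : b ∈ Set.range s
              · right
                obtain ⟨ia, rfl⟩ := hra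
                obtain ⟨ib, rfl⟩ := hrb
                refine ⟨s (midSlot 2), ?_, ?_⟩
                · rw [hf.apply_mid le_rfl, hx, parent_child 2 p e hS.one_le hS.le_two]
                · by_cases hia : ia = slot 2 e
                  · have : ib ≠ slot 2 e := fun h => hab (by rw [hia, h])
                    exact hS.trans _ _ _ hb.2.2 (hS.mid s hf.strictMono _ this)
                  · exact hS.trans _ _ _ ha.2.2 (hS.mid s hf.strictMono _ hia)
              · exact Or.inl ⟨b, by rw [hf.apply_of_notMem hrb, hb.2.1, hx], hb.2.2⟩
            · exact Or.inl ⟨a, by rw [hf.apply_of_notMem hra, ha.2.1, hx], ha.2.2⟩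
          · left; omega
        · have hstay : ∀ a, r q a → C' a = C a := fun a ha =>
            hf.apply_of_notMem (by rintro ⟨i, rfl⟩; exact hQ ⟨i, ha⟩)
          rcases ih p q h2 with h | ⟨a, ha, hqa⟩ | ⟨a, ha, hqa⟩
          · exact Or.inl (h.trans (beyond_le_fire _ _))
          · exact Or.inr (Or.inl ⟨a, by rw [hstay a hqa, ha], hqa⟩)
          · exact Or.inr (Or.inr ⟨a, by rw [hstay a hqa, ha], hqa⟩)
      · rcases ih p q h2 with h | ⟨a, ha, hqa⟩ | ⟨a, ha, hqa⟩
        · exact Or.inl (h.trans (beyond_le_fire _ _))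
        · exact Or.inr (Or.inl ⟨a, by rw [hf.apply_of_ne (by rw [ha]; exact Ne.symm hx), ha], hqa⟩)
        · by_cases hra : a ∈ Set.range s
          · obtain ⟨i, rfl⟩ := hra
            rw [hf.apply_fired] at ha
            subst ha
            exact Or.inr (Or.inl ⟨_, hS.apply_top hf, hS.trans _ _ _ hqa
              (hS.top s hf.strictMono i)⟩)
          · exact Or.inr (Or.inr ⟨a, by rw [hf.apply_of_notMem hra, ha], hqa⟩)
    · exact Or.inr (Or.inl ⟨_, by rw [hf.apply_slot h1 hj, hvx], hq⟩)

/-- In the window the alternative of a chip left on `p` disappears: `p` enters the window by a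
firing that empties it and sends a chip beyond `q` to the extreme child. -/
theorem Run.two_le_beyond_or_exists_of_window (hS : Side r e e') (hn : n = chipCount 2 m)
    (h : Run 2 m C g R) :
    ∀ p, g p + layer 2 p + 1 < m → ∀ q, 2 ≤ beyond r R q (child 2 p e) →
      2 ≤ beyond r R q (child 2 (child 2 p e) e) ∨ ∃ a, C a = child 2 p e ∧ r q a := by
  induction h with
  | init => intro v h; exact absurd (by omega) (not_window_odometer m v)
  | @fire C C' g R x s hr hf ih =>
    intro p hw q h2
    have hpos := hr.one_le_of_fires le_rfl hn hf
    have hpv : child 2 p e ≠ p := child_ne_self hS.one_le hS.le_two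
    rcases beyond_fire_cases (r := r) (R := R) (x := x) (s := s) q (child 2 p e) with
      h | ⟨-, j, h1, hj, hvx, hq⟩
    · rw [h] at h2
      rcases window_fire (x := x) (v := p) hpos (ne_or_eq _ _) with ⟨rfl, h1⟩ | ⟨hpx, h1⟩
      · obtain ⟨hall, -, -⟩ := hr.exact le_rfl hn hf (by omega)
        rcases hr.two_le_beyond_or_exists hS p q h2 with h | ⟨a, ha, hqa⟩ | ⟨a, ha, hqa⟩
        · exact Or.inl (h.trans (beyond_le_fire _ _))
        · exact Or.inr ⟨a, by rw [hf.apply_of_ne (by rw [ha]; exact hpv), ha], hqa⟩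
        · obtain ⟨i, rfl⟩ := hall a ha
          exact Or.inr ⟨_, hS.apply_top hf, hS.trans _ _ _ hqa (hS.top s hf.strictMono i)⟩
      · rw [h1] at hw
        rcases ih p hw q h2 with h | ⟨a, ha, hqa⟩
        · exact Or.inl (h.trans (beyond_le_fire _ _))
        · by_cases hx : x = child 2 p e
          · left
            have hl := layer_child (k := 2) (v := p) hS.one_le hS.le_two
            have hJ := (hr.window le_rfl hn p (by omega)).1 e hS.one_le hS.le_two
            rw [← hx] at ha hl hJ h2 ⊢
            obtain ⟨hall, -, -⟩ := hr.exact le_rfl hn hf (by omega)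
            -- With a second chip beyond `q` on `x`, the pair gives two receipts below. Otherwise,
            -- by `beyond_le_card`, an earlier one has already gone down, and this firing adds
            -- another.
            by_cases hb : ∃ b, b ≠ a ∧ C b = x ∧ r q b
            · obtain ⟨b, hba, hb, hqb⟩ := hb
              refine le_trans ?_ (beyond_le_fire _ _)
              have hwx : g x + layer 2 x < m := by omega
              rcases hS.total a b with hab | hab
              · exact (hr.two_le_beyond_of_pair hS hn x hwx a b (Ne.symm hba) ha hb hab).trans
                  (beyond_anti hS hqa _)
              · exact (hr.two_le_beyond_of_pair hS hn x hwx b a hba hb ha hab).trans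
                  (beyond_anti hS hqb _)
            · obtain ⟨i, rfl⟩ := hall a ha
              rw [hS.beyond_top hf hqa]
              by_contra hlt
              have h0 : beyond r R q (child 2 x e) = 0 := by omega
              have hc := hr.beyond_le_card hS x q h0
              obtain ⟨a', b', ha', hb', hab'⟩ := Finset.one_lt_card_iff.1 (h2.trans hc)
              rw [Finset.mem_filter] at ha' hb'
              by_cases h' : a' = s i
              · exact hb ⟨b', fun h'' => hab' (h'.trans h''.symm), hb'.2⟩
              · exact hb ⟨a', h', ha'.2⟩
          · exact Or.inr ⟨a, by rw [hf.apply_of_ne (by rw [ha]; exact Ne.symm hx), ha], hqa⟩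
    · exact Or.inr ⟨_, by rw [hf.apply_slot h1 hj, hvx], hq⟩

/-- Near the end of a run a child of every vertex `v` above the last two layers has received two
chips that are more extreme than any chip on `v`. -/
theorem Run.two_le_beyond (hS : Side r e e') (hn : n = chipCount 2 m) (h : Run 2 m C g R) :
    ∀ v, g v + layer 2 v + 1 < m → ∀ q, C q = v → 2 ≤ beyond r R q (child 2 v e) := by
  induction h with
  | init => intro v h; exact absurd (by omega) (not_window_odometer m v)
  | @fire C C' g R x s hr hf ih =>
    intro v hw q hq
    have hpos := hr.one_le_of_fires le_rfl hn hf
    rcases hf.cases le_rfl q with ⟨h0, e0⟩ | ⟨rfl, -, e0⟩ | ⟨j, h1, hj, rfl, -, e0⟩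
    · rw [e0] at hq
      rcases window_fire (x := x) (v := v) hpos (ne_or_eq _ _) with ⟨rfl, h1⟩ | ⟨-, h1⟩
      · exact absurd ((hr.exact le_rfl hn hf (by omega)).1 q hq) h0
      · rw [h1] at hw
        exact (ih v hw q hq).trans (beyond_le_fire _ _)
    · rw [hq] at e0
      by_cases hx : x = 0
      · subst hx
        rw [parent_zero] at e0
        subst e0
        rw [Function.update_self] at hw
        -- The self-loop returns the middle chip to the root: one receipt beyond it dates from
        -- before, the second comes from this very firing.
        rw [hS.beyond_top hf (hS.refl _)]
        have := hr.one_le_beyond hS hn 0 (by omega) _ (hf.apply_fired (midSlot 2))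
        omega
      · have := hS.two_le_beyond_mid hr hf hx
        rw [← e0] at this
        exact this.trans (beyond_le_fire _ _)
    · rw [hq] at e0
      subst e0
      have hne := child_ne_self (k := 2) (v := x) h1 hj
      rw [Function.update_of_ne hne] at hw
      have hp := parent_child 2 x j h1 hj
      have hl := layer_child (k := 2) (v := x) h1 hj
      have hJ := (hr.window le_rfl hn (child 2 x j) (by omega)).2
      rw [hp] at hJ
      obtain ⟨hall, hch, -⟩ := hr.exact le_rfl hn hf (by omega)
      have hgj := hch j h1 hj
      refine le_trans ?_ (beyond_le_fire _ _)
      rcases hS.cases h1 hj with rfl | rfl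
      · have hb := ih x (by omega) _ (hf.apply_fired (slot 2 j))
        rcases hr.two_le_beyond_or_exists_of_window hS hn x (by omega) _ hb with h' | ⟨a, ha, hqa⟩
        · exact h'
        · refine le_trans ?_ (beyond_anti hS hqa _)
          refine hr.two_le_beyond_of_waiting hS hn _ (child_ne_zero h1) (by omega) ?_ a ha
          rw [hp, hgj]
      · obtain ⟨a, ha, hb⟩ := hr.exists_two_le_at_parent hS hn (child 2 x j) (child_ne_zero h1)
          (by rw [hp]; omega) (by rw [hp]; exact hgj)
        rw [hp] at ha
        obtain ⟨i, rfl⟩ := hall a ha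
        exact hb.trans (beyond_anti hS (hS.bot s hf.strictMono i) _)

end BinaryInvariants

/-! ### The binary tree: from received chips to chips now in a subtree. -/

section BinaryExtremes

theorem exists_below_child {k v w : ℕ} (hk : 1 ≤ k) (h : Below k v w) (hw : w ≠ v) :
    ∃ j, 1 ≤ j ∧ j ≤ k ∧ Below k (child k v j) w := by
  obtain ⟨i, hi⟩ := h
  induction i generalizing w with
  | zero => exact absurd hi hw
  | succ i ih =>
    rw [Function.iterate_succ_apply] at hi
    by_cases hp : parent k w = v
    · have h0 : w ≠ 0 := by
        rintro rfl
        rw [parent_zero] at hp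
        exact hw hp
      obtain ⟨j, h1, hj, he⟩ := exists_eq_child hk h0
      rw [hp] at he
      exact ⟨j, h1, hj, by rw [← he]; exact below_refl k w⟩
    · obtain ⟨j, h1, hj, hb⟩ := ih hp hi
      exact ⟨j, h1, hj, below_of_below_parent hb⟩

variable {m n x : ℕ} {C C' : Configuration n} {g : ℕ → ℕ} {R : ℕ → Multiset (Fin n)}
  {s : Fin (2 + 1) → Fin n} {r : Fin n → Fin n → Prop} {e e' : ℕ} [DecidableRel r]

/-- A chip leaves the subtree of `c` only as the middle chip of a firing of `c`, and that firing
keeps a more extreme chip inside. -/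
theorem Run.exists_below (hS : Side r e e') (h : Run 2 m C g R) :
    ∀ c, c ≠ 0 → ∀ q, 1 ≤ beyond r R q c → ∃ a, Below 2 c (C a) ∧ r q a := by
  induction h with
  | init => intro c _ q h; simp [beyond] at h
  | @fire C C' g R x s hr hf ih =>
    intro c hc q hq
    rcases beyond_fire_cases (r := r) (R := R) (x := x) (s := s) q c with
      h | ⟨-, j, h1, hj, rfl, hj'⟩
    · rw [h] at hq
      obtain ⟨a, ha, hqa⟩ := ih c hc q hq
      rcases hf.below_or_eq_mid le_rfl ha with hb | ⟨rfl, rfl⟩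
      · exact ⟨a, hb, hqa⟩
      · refine ⟨s (slot 2 e), ?_, hS.trans _ _ _ hqa (hS.mid_top hf)⟩
        rw [hS.apply_top hf]
        exact below_child hS.one_le hS.le_two (below_refl _ _)
    · exact ⟨_, by rw [hf.apply_slot h1 hj]; exact below_refl _ _, hj'⟩

/-- One chip is already below the extreme child by `Run.exists_below`; the other is just being sent
there, and was on `x` before. -/
theorem Side.exists_pair_of_top (hS : Side r e e') (h : Run 2 m C g R) (hf : FiresWith 2 x s C C')
    {q : Fin n} {i : Fin (2 + 1)} (hi : r q (s i))
    (h2 : 2 ≤ beyond r (fun w => R w + receipts 2 x s w) q (child 2 x e)) :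
    ∃ a b, a ≠ b ∧ (Below 2 (child 2 x e) (C' a) ∧ r q a) ∧
      Below 2 (child 2 x e) (C' b) ∧ r q b := by
  rw [hS.beyond_top hf hi] at h2
  have hc : child 2 x e ≠ 0 := child_ne_zero hS.one_le
  have hne : x ≠ child 2 x e := (child_ne_self hS.one_le hS.le_two).symm
  obtain ⟨a, ha, hqa⟩ := h.exists_below hS _ hc q (by omega)
  refine ⟨a, s (slot 2 e), ?_, ⟨hf.below le_rfl hne ha, hqa⟩, ?_,
    hS.trans _ _ _ hi (hS.top s hf.strictMono i)⟩
  · rintro rfl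
    rw [hf.apply_fired] at ha
    exact not_below_child_self (by omega) hS.one_le hS.le_two ha
  · rw [hS.apply_top hf]
    exact below_refl _ _

/-- A chip of the pair that leaves the subtree lands on `v`, where it serves for the second
alternative. -/
theorem Run.exists_pair_or_exists (hS : Side r e e') (h : Run 2 m C g R) :
    ∀ v q, 2 ≤ beyond r R q (child 2 v e) →
      (∃ a b, a ≠ b ∧ (Below 2 (child 2 v e) (C a) ∧ r q a) ∧
        Below 2 (child 2 v e) (C b) ∧ r q b) ∨ ∃ a, C a = v ∧ r q a := by
  induction h with
  | init => intro v q h; simp [beyond] at h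
  | @fire C C' g R x s hr hf ih =>
    intro v q h2
    by_cases hx : x = v
    · subst hx
      by_cases hQ : ∃ i, r q (s i)
      · obtain ⟨i, hi⟩ := hQ
        exact Or.inl (hS.exists_pair_of_top hr hf hi h2)
      · rw [beyond_fire_child q hS.one_le hS.le_two, if_neg fun h => hQ ⟨_, h⟩, add_zero] at h2
        have hne : x ≠ child 2 x e := (child_ne_self hS.one_le hS.le_two).symm
        rcases ih x q h2 with ⟨a, b, hab, ⟨ha, hqa⟩, hb, hqb⟩ | ⟨a, ha, hqa⟩
        · exact Or.inl ⟨a, b, hab, ⟨hf.below le_rfl hne ha, hqa⟩, hf.below le_rfl hne hb, hqb⟩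
        · refine Or.inr ⟨a, ?_, hqa⟩
          rw [hf.apply_of_notMem, ha]
          rintro ⟨i, rfl⟩
          exact hQ ⟨i, hqa⟩
    · rw [beyond_fire_child_ne q hS.one_le hS.le_two hx] at h2
      rcases ih v q h2 with ⟨a, b, hab, ⟨ha, hqa⟩, hb, hqb⟩ | ⟨a, ha, hqa⟩
      · have hmid : x = child 2 v e → C' (s (midSlot 2)) = v := fun hxc => by
          rw [hf.apply_mid le_rfl, hxc, parent_child 2 v e hS.one_le hS.le_two]
        rcases hf.below_or_eq_mid le_rfl ha with ha' | ⟨hxc, rfl⟩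
        · rcases hf.below_or_eq_mid le_rfl hb with hb' | ⟨hxc, rfl⟩
          · exact Or.inl ⟨a, b, hab, ⟨ha', hqa⟩, hb', hqb⟩
          · exact Or.inr ⟨_, hmid hxc, hqb⟩
        · exact Or.inr ⟨_, hmid hxc, hqa⟩
      · exact Or.inr ⟨a, by rw [hf.apply_of_ne (by rw [ha]; exact Ne.symm hx), ha], hqa⟩

/-- The last firing of `v` clears `v`, which excludes a chip left there. Afterwards the extreme
child has finished too, so nothing leaves its subtree. -/
theorem Run.exists_pair (hS : Side r e e') (hn : n = chipCount 2 m) (h : Run 2 m C g R) :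
    ∀ v, layer 2 v < m → g v = 0 → ∀ q, 2 ≤ beyond r R q (child 2 v e) →
      ∃ a b, a ≠ b ∧ (Below 2 (child 2 v e) (C a) ∧ r q a) ∧
        Below 2 (child 2 v e) (C b) ∧ r q b := by
  induction h with
  | init => intro v h hg; exact absurd (by omega) (not_window_odometer m v)
  | @fire C C' g R x s hr hf ih =>
    intro v hv hg q h2
    have hpos := hr.one_le_of_fires le_rfl hn hf
    by_cases hx : x = v
    · subst hx
      rw [Function.update_self] at hg
      by_cases hQ : ∃ i, r q (s i)
      · obtain ⟨i, hi⟩ := hQ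
        exact hS.exists_pair_of_top hr hf hi h2
      · rw [beyond_fire_child q hS.one_le hS.le_two, if_neg fun h => hQ ⟨_, h⟩, add_zero] at h2
        have hne : x ≠ child 2 x e := (child_ne_self hS.one_le hS.le_two).symm
        rcases hr.exists_pair_or_exists hS x q h2 with
          ⟨a, b, hab, ⟨ha, hqa⟩, hb, hqb⟩ | ⟨a, ha, hqa⟩
        · exact ⟨a, b, hab, ⟨hf.below le_rfl hne ha, hqa⟩, hf.below le_rfl hne hb, hqb⟩
        · obtain ⟨i, rfl⟩ := (hr.exact le_rfl hn hf (by omega)).1 a ha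
          exact absurd ⟨i, hqa⟩ hQ
    · rw [beyond_fire_child_ne q hS.one_le hS.le_two hx] at h2
      rw [Function.update_of_ne (Ne.symm hx)] at hg
      have hxc : x ≠ child 2 v e := by
        rintro rfl
        have := (hr.window le_rfl hn v (by omega)).1 e hS.one_le hS.le_two
        omega
      obtain ⟨a, b, hab, ⟨ha, hqa⟩, hb, hqb⟩ := ih v hv hg q h2
      exact ⟨a, b, hab, ⟨hf.below le_rfl hxc ha, hqa⟩, hf.below le_rfl hxc hb, hqb⟩

/-- When no firing is left, the most extreme chip of a subtree lies below the extreme child. -/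
theorem Run.exists_extreme (hS : Side r e e') (hn : n = chipCount 2 m) (h : Run 2 m C g R)
    {v : ℕ} (hg : g v = 0) (hv : layer 2 v < m) {a : Fin n} (ha : Below 2 v (C a)) :
    ∃ b, Below 2 (child 2 v e) (C b) ∧ r a b := by
  classical
  refine h.exists_below hS _ (child_ne_zero hS.one_le) a ?_
  by_cases hav : C a = v
  · exact h.one_le_beyond hS hn v (by omega) a hav
  · obtain ⟨j, h1, hj, hb⟩ := exists_below_child (by omega) ha hav
    refine le_trans ?_ (hS.beyond_le h a h1 hj)
    refine le_trans ?_ (h.card_below_le le_rfl (r a) (child_ne_zero h1))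
    exact Finset.card_pos.2 ⟨a, Finset.mem_filter.2 ⟨Finset.mem_univ _, hS.refl a, hb⟩⟩

/-- When no firing is left, two chips below the extreme child are more extreme than the chip on
the vertex. -/
theorem Run.exists_two_extreme (hS : Side r e e') (hn : n = chipCount 2 m) (h : Run 2 m C g R)
    {v : ℕ} (hg : g v = 0) (hv : layer 2 v + 1 < m) {a : Fin n} (ha : C a = v) :
    ∃ b c, b ≠ c ∧ (Below 2 (child 2 v e) (C b) ∧ r a b) ∧ Below 2 (child 2 v e) (C c) ∧ r a c :=
  h.exists_pair hS hn v (by omega) hg a (h.two_le_beyond hS hn v (by omega) a ha)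

end BinaryExtremes

/-! ### The identification of a subtree with the whole tree. -/

section Subtree

variable {k : ℕ}

theorem vertex_induction (hk : 1 ≤ k) {p : ℕ → Prop} (h0 : p 0)
    (h : ∀ u j, 1 ≤ j → j ≤ k → p u → p (child k u j)) (u : ℕ) : p u := by
  have key : ∀ t u, layer k u ≤ t → p u := by
    intro t
    induction t with
    | zero =>
      intro u hu
      have := layer_pos (k := k) u
      omega
    | succ t ih =>
      intro u hu
      by_cases hu0 : u = 0
      · exact hu0 ▸ h0
      · obtain ⟨j, h1, hj, he⟩ := exists_eq_child hk hu0
        have := layer_eq_layer_parent hk hu0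
        rw [he]
        exact h _ _ h1 hj (ih _ (by omega))
  exact key _ u le_rfl

theorem below_inSubtree (hk : 1 ≤ k) (v u : ℕ) : Below k v (inSubtree k v u) := by
  induction u using vertex_induction hk with
  | h0 => rw [inSubtree_zero]; exact below_refl k v
  | h u j h1 hj ih => rw [inSubtree_child k v u j h1 hj]; exact below_child h1 hj ih

theorem mem_range_inSubtree (hk : 1 ≤ k) (v w : ℕ) :
    w ∈ Set.range (inSubtree k v) ↔ Below k v w := by
  constructor
  · rintro ⟨u, rfl⟩
    exact below_inSubtree hk v u
  · induction w using vertex_induction hk with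
    | h0 => intro h; rw [eq_zero_of_below_zero h]; exact ⟨0, inSubtree_zero k 0⟩
    | h w j h1 hj ih =>
      intro h
      rcases below_child_cases h1 hj h with rfl | h
      · exact ⟨0, inSubtree_zero k _⟩
      · obtain ⟨u, rfl⟩ := ih h
        exact ⟨child k u j, inSubtree_child k v u j h1 hj⟩

theorem inSubtree_root (hk : 1 ≤ k) (u : ℕ) : inSubtree k 0 u = u := by
  induction u using vertex_induction hk with
  | h0 => rw [inSubtree_zero]
  | h u j h1 hj ih => rw [inSubtree_child k 0 u j h1 hj, ih]

theorem layer_inSubtree (hk : 1 ≤ k) (v u : ℕ) :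
    layer k (inSubtree k v u) + 1 = layer k v + layer k u := by
  induction u using vertex_induction hk with
  | h0 => rw [inSubtree_zero, layer_zero]
  | h u j h1 hj ih =>
    rw [inSubtree_child k v u j h1 hj, layer_child h1 hj, layer_child h1 hj]
    omega

theorem inSubtree_inSubtree (hk : 1 ≤ k) (v u w : ℕ) :
    inSubtree k v (inSubtree k u w) = inSubtree k (inSubtree k v u) w := by
  induction w using vertex_induction hk with
  | h0 => rw [inSubtree_zero, inSubtree_zero]
  | h w j h1 hj ih =>
    rw [inSubtree_child k u w j h1 hj, inSubtree_child _ _ _ _ h1 hj, ih,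
      inSubtree_child _ _ _ _ h1 hj]

theorem inSubtree_injective (hk : 1 ≤ k) (v : ℕ) : Function.Injective (inSubtree k v) := by
  intro a
  induction a using vertex_induction hk with
  | h0 =>
    intro b h
    by_contra hb
    have h1 := layer_inSubtree hk v 0
    have h2 := layer_inSubtree hk v b
    have h3 := layer_eq_layer_parent hk (Ne.symm hb)
    have h4 := layer_pos (k := k) (parent k b)
    rw [h] at h1
    rw [layer_zero] at h1
    omega
  | h a j h1 hj ih =>
    intro b h
    by_cases hb : b = 0
    · subst hb
      have h2 := layer_inSubtree hk v 0
      have h3 := layer_inSubtree hk v (child k a j)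
      have h4 := layer_pos (k := k) a
      rw [h] at h3
      rw [layer_zero] at h2
      rw [layer_child h1 hj] at h3
      omega
    · obtain ⟨i, hi1, hi, he⟩ := exists_eq_child hk hb
      rw [he] at h ⊢
      rw [inSubtree_child _ _ _ _ h1 hj, inSubtree_child _ _ _ _ hi1 hi] at h
      obtain ⟨h5, rfl⟩ := child_inj h1 hj hi1 hi h
      rw [ih h5]

theorem below_inSubtree_iff (hk : 1 ≤ k) (v u w : ℕ) :
    Below k (inSubtree k v u) (inSubtree k v w) ↔ Below k u w := by
  rw [← mem_range_inSubtree hk, ← mem_range_inSubtree hk]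
  constructor
  · rintro ⟨a, ha⟩
    rw [← inSubtree_inSubtree hk] at ha
    exact ⟨a, inSubtree_injective hk v ha⟩
  · rintro ⟨a, rfl⟩
    exact ⟨a, by rw [inSubtree_inSubtree hk]⟩

/-- In breadth-first order the first `l` layers form an initial segment. -/
theorem lt_chipCount_iff (hk : 2 ≤ k) (u l : ℕ) : u < chipCount k l ↔ layer k u ≤ l := by
  induction u using vertex_induction (by omega : 1 ≤ k) generalizing l with
  | h0 =>
    rw [layer_zero]
    cases l with
    | zero => simp [chipCount_zero]
    | succ l => rw [chipCount_succ hk]; omega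
  | h u j h1 hj ih =>
    rw [layer_child h1 hj]
    cases l with
    | zero => simp [chipCount_zero]
    | succ l =>
      rw [chipCount_succ hk, Nat.add_le_add_iff_right, ← ih]
      unfold child
      constructor
      · intro h
        by_contra hlt
        have := Nat.mul_le_mul_left k (not_lt.1 hlt)
        omega
      · intro h
        have : k * (u + 1) ≤ k * chipCount k l := Nat.mul_le_mul_left k h
        rw [Nat.mul_succ] at this
        omega

theorem chipCount_one (hk : 2 ≤ k) : chipCount k 1 = 1 := by
  rw [chipCount_succ hk, chipCount_zero, mul_zero]

theorem chipCount_two (hk : 2 ≤ k) : chipCount k 2 = k + 1 := by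
  rw [chipCount_succ hk, chipCount_one hk, mul_one]

end Subtree

/-! ### Orderings of subtrees and the runs they come from. -/

section Orderings

variable {k : ℕ}

theorem mem_range_iff_below (hk : 1 ≤ k) {n N v : ℕ} {C : Configuration N}
    {s : Fin n → Fin N} (hs : Set.range s = {c | C c ∈ Set.range (inSubtree k v)}) (c : Fin N) :
    c ∈ Set.range s ↔ Below k v (C c) := by
  rw [hs, Set.mem_ofPred_eq, mem_range_inSubtree hk]

theorem IsSubtreeOrdering.trans (hk : 1 ≤ k) {n n' N v u : ℕ} {C : Configuration N}
    {D : Configuration n} {D' : Configuration n'} (h : IsSubtreeOrdering k v C D)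
    (h' : IsSubtreeOrdering k u D D') : IsSubtreeOrdering k (inSubtree k v u) C D' := by
  obtain ⟨s, hs, hr, hD⟩ := h
  obtain ⟨s', hs', hr', hD'⟩ := h'
  refine ⟨s ∘ s', hs.comp hs', ?_, fun c => ?_⟩
  · ext c
    rw [Set.mem_ofPred_eq, mem_range_inSubtree hk]
    constructor
    · rintro ⟨a, rfl⟩
      have := (mem_range_iff_below hk hr' (s' a)).1 ⟨a, rfl⟩
      rw [Function.comp_apply, hD, below_inSubtree_iff hk]
      exact this
    · intro hc
      obtain ⟨a, rfl⟩ := (mem_range_iff_below hk hr c).2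
        (below_trans (below_inSubtree hk v u) hc)
      rw [hD, below_inSubtree_iff hk] at hc
      obtain ⟨b, rfl⟩ := (mem_range_iff_below hk hr' a).2 hc
      exact ⟨b, rfl⟩
  · rw [Function.comp_apply, hD, hD', inSubtree_inSubtree hk]

theorem isSubtreeOrdering_root (hk : 1 ≤ k) {n : ℕ} (C : Configuration n) :
    IsSubtreeOrdering k 0 C C := by
  refine ⟨id, strictMono_id, ?_, fun c => (inSubtree_root hk _).symm⟩
  ext c
  simp [mem_range_inSubtree hk, below_zero hk]

theorem zConfigurations_subset (hk : 2 ≤ k) (l : ℕ) : zConfigurations k l ⊆ tOrderings k l :=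
  fun C hC => ⟨l, C, hC, 0, by rw [layer_zero, add_comm], isSubtreeOrdering_root (by omega) C⟩

theorem exists_run_of_mem_tOrderings (hk : 2 ≤ k) {l : ℕ} {D : Configuration (chipCount k l)}
    (hD : D ∈ tOrderings k l) :
    ∃ (m v : ℕ) (C : Configuration (chipCount k m)) (R : ℕ → Multiset (Fin (chipCount k m)))
      (s : Fin (chipCount k l) → Fin (chipCount k m)), Run k m C (fun _ => 0) R ∧
      layer k v + l = m + 1 ∧ StrictMono s ∧ (∀ c, c ∈ Set.range s ↔ Below k v (C c)) ∧
      (∀ c, C (s c) = inSubtree k v (D c)) ∧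
      ∀ w, cnt C w = if layer k w ≤ m then 1 else 0 := by
  obtain ⟨m, C, hC, v, hv, s, hs, hr, hD⟩ := hD
  obtain ⟨g, R, hR⟩ := exists_run (m := m) hC.1
  have hg : g = fun _ => 0 := funext fun w => hR.eq_zero_of_isStable hk rfl hC.2 w
  subst hg
  exact ⟨m, v, C, R, s, hR, hv, hs, mem_range_iff_below (by omega) hr, hD,
    fun w => cnt_of_mem_stableConfigurations hk rfl hC w⟩

end Orderings

/-! ### Properties that orderings inherit from runs. -/

section OrderingFacts

variable {k l : ℕ} {D : Configuration (chipCount k l)}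

theorem injective_of_mem_tOrderings (hk : 2 ≤ k) (hD : D ∈ tOrderings k l) :
    Function.Injective D := by
  obtain ⟨m, v, C, R, s, hR, hv, hs, hr, hC, hc⟩ := exists_run_of_mem_tOrderings hk hD
  intro a b hab
  have h1 : C (s a) = C (s b) := by rw [hC, hC, hab]
  have h2 : cnt C (C (s b)) ≤ 1 := by rw [hc]; split_ifs <;> omega
  exact hs.injective (Finset.card_le_one.1 h2 _ (by simp [h1]) _ (by simp))

theorem lt_of_mem_tOrderings (hk : 2 ≤ k) (hD : D ∈ tOrderings k l) (c : Fin (chipCount k l)) :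
    D c < chipCount k l := by
  obtain ⟨m, v, C, R, s, hR, hv, hs, hr, hC, hc⟩ := exists_run_of_mem_tOrderings hk hD
  have h1 : 0 < cnt C (C (s c)) := Finset.card_pos.2 ⟨s c, by simp⟩
  rw [hc, hC] at h1
  split_ifs at h1 with h
  · have := layer_inSubtree (k := k) (by omega) v (D c)
    rw [lt_chipCount_iff hk]
    omega
  · omega

theorem image_of_mem_tOrderings (hk : 2 ≤ k) (hD : D ∈ tOrderings k l) :
    Finset.univ.image D = Finset.range (chipCount k l) := by
  apply Finset.eq_of_subset_of_card_le
  · intro w hw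
    obtain ⟨c, -, rfl⟩ := Finset.mem_image.1 hw
    exact Finset.mem_range.2 (lt_of_mem_tOrderings hk hD c)
  · rw [Finset.card_image_of_injective _ (injective_of_mem_tOrderings hk hD)]
    simp

theorem exists_apply_eq_of_mem_tOrderings (hk : 2 ≤ k) (hD : D ∈ tOrderings k l) {w : ℕ}
    (hw : w < chipCount k l) : ∃ c, D c = w := by
  have : w ∈ Finset.univ.image D := by
    rw [image_of_mem_tOrderings hk hD]
    exact Finset.mem_range.2 hw
  obtain ⟨c, -, hc⟩ := Finset.mem_image.1 this
  exact ⟨c, hc⟩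

theorem finite_tOrderings (hk : 2 ≤ k) (l : ℕ) : (tOrderings k l).Finite := by
  refine (Set.Finite.pi (t := fun _ => Set.Iio (chipCount k l)) fun _ => Set.finite_Iio _).subset ?_
  intro D hD c _
  exact lt_of_mem_tOrderings hk hD c

theorem lt_of_children (hk : 2 ≤ k) (hD : D ∈ tOrderings k l) {u i j : ℕ} (hi : 1 ≤ i)
    (hij : i < j) (hj : j ≤ k) {a b : Fin (chipCount k l)} (ha : D a = child k u i)
    (hb : D b = child k u j) : a < b := by
  have hl := (lt_chipCount_iff hk _ _).1 (lt_of_mem_tOrderings hk hD a)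
  obtain ⟨m, v, C, R, s, hR, hv, hs, hr, hC, hc⟩ := exists_run_of_mem_tOrderings hk hD
  have h1 := layer_inSubtree (k := k) (by omega) v u
  rw [ha, layer_child hi (by omega)] at hl
  refine hs.lt_iff_lt.1 (hR.children_sorted hk rfl (inSubtree k v u) (by omega) rfl i j hi hij hj
    _ _ ?_ ?_)
  · rw [hC, ha, inSubtree_child _ _ _ _ hi (by omega)]
  · rw [hC, hb, inSubtree_child _ _ _ _ (by omega) hj]

theorem lt_of_grandchildren (hk : 2 ≤ k) (hD : D ∈ tOrderings k l) {u i j t : ℕ}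
    (hu : layer k u + 2 = l) (hi : 1 ≤ i) (hij : i < j) (hj : j ≤ k) (ht : 1 ≤ t) (htk : t ≤ k)
    {a b : Fin (chipCount k l)} (ha : D a = child k (child k u i) t)
    (hb : D b = child k (child k u j) t) : a < b := by
  obtain ⟨m, v, C, R, s, hR, hv, hs, hr, hC, hc⟩ := exists_run_of_mem_tOrderings hk hD
  have h1 := layer_inSubtree (k := k) (by omega) v u
  refine hs.lt_iff_lt.1 (hR.columns_sorted hk rfl (inSubtree k v u) (by omega) rfl i j t hi hij hj
    ht htk _ _ ?_ ?_)
  · rw [hC, ha, inSubtree_child _ _ _ _ ht htk, inSubtree_child _ _ _ _ hi (by omega)]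
  · rw [hC, hb, inSubtree_child _ _ _ _ ht htk, inSubtree_child _ _ _ _ (by omega) hj]

open Classical in
theorem card_below_of_mem_tOrderings (hk : 2 ≤ k) (hD : D ∈ tOrderings k l) {u l' : ℕ}
    (hu : layer k u + l' = l + 1) :
    (Finset.univ.filter fun c => Below k u (D c)).card = chipCount k l' := by
  have h2 := Finset.card_image_of_injective (Finset.range (chipCount k l'))
    (inSubtree_injective (by omega : 1 ≤ k) u)
  rw [Finset.card_range] at h2
  rw [← Finset.card_image_of_injective _ (injective_of_mem_tOrderings hk hD), ← h2]
  congr 1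
  ext w
  have hlt : ∀ w', inSubtree k u w' < chipCount k l ↔ w' < chipCount k l' := by
    intro w'
    have := layer_inSubtree (k := k) (by omega) u w'
    rw [lt_chipCount_iff hk, lt_chipCount_iff hk]
    omega
  rw [Finset.mem_image, Finset.mem_image]
  constructor
  · rintro ⟨c, hc, rfl⟩
    obtain ⟨w', hw'⟩ := (mem_range_inSubtree (by omega) _ _).2 (Finset.mem_filter.1 hc).2
    refine ⟨w', ?_, hw'⟩
    rw [Finset.mem_range, ← hlt, hw']
    exact lt_of_mem_tOrderings hk hD c
  · rintro ⟨w', hw', rfl⟩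
    rw [Finset.mem_range, ← hlt] at hw'
    obtain ⟨c, hc⟩ := exists_apply_eq_of_mem_tOrderings hk hD hw'
    refine ⟨c, Finset.mem_filter.2 ⟨Finset.mem_univ _, ?_⟩, hc⟩
    rw [hc]
    exact below_inSubtree (by omega) _ _

/-- A subtree of a subtree is a subtree of the same stable configuration. This closure property
makes the recursion run on `T` rather than on `Z`. -/
theorem exists_subtree_ordering (hk : 2 ≤ k) (hD : D ∈ tOrderings k l) {u l' : ℕ}
    (hu : layer k u + l' = l + 1) : ∃ D' ∈ tOrderings k l', IsSubtreeOrdering k u D D' := by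
  classical
  have hcard := card_below_of_mem_tOrderings hk hD hu
  set F := Finset.univ.filter fun c => Below k u (D c) with hF
  have hmem : ∀ c, c ∈ F ↔ D c ∈ Set.range (inSubtree k u) := fun c => by
    rw [mem_range_inSubtree (by omega), hF, Finset.mem_filter]
    simp
  choose D' hD' using fun c : Fin (chipCount k l') =>
    (hmem (F.orderEmbOfFin hcard c)).1 (F.orderEmbOfFin_mem hcard c)
  have hsub : IsSubtreeOrdering k u D D' := by
    refine ⟨F.orderEmbOfFin hcard, (F.orderEmbOfFin hcard).strictMono, ?_, fun c => (hD' c).symm⟩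
    rw [Finset.range_orderEmbOfFin]
    ext c
    exact hmem c
  refine ⟨D', ?_, hsub⟩
  obtain ⟨m, C, hC, v, hv, hCD⟩ := hD
  have := layer_inSubtree (k := k) (by omega) v u
  exact ⟨m, C, hC, inSubtree k v u, by omega, hCD.trans (by omega) hsub⟩

end OrderingFacts

/-! ### Extreme chips in orderings of the binary tree. -/

section BinaryOrderings

variable {l : ℕ} {D : Configuration (chipCount 2 l)}

/-- The relation is a family over `n` because it is used both on all chips and, after relabeling, on
those of the subtree; `hr` transfers it between the two. -/
theorem exists_extreme_of_mem_tOrderings (hD : D ∈ tOrderings 2 l) {u e e' : ℕ}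
    (hu : layer 2 u < l) {r : ∀ n, Fin n → Fin n → Prop} [∀ n, DecidableRel (r n)]
    (hS : ∀ n, Side (r n) e e')
    (hr : ∀ (n n' : ℕ) (s : Fin n → Fin n'), StrictMono s → ∀ a b, r n' (s a) (s b) → r n a b)
    {a : Fin (chipCount 2 l)} (ha : Below 2 u (D a)) :
    ∃ b, Below 2 (child 2 u e) (D b) ∧ r _ a b := by
  obtain ⟨m, v, C, R, s, hR, hv, hs, hsr, hC, hc⟩ := exists_run_of_mem_tOrderings le_rfl hD
  have h1 := layer_inSubtree (k := 2) (by omega) v u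
  obtain ⟨b, hb, hab⟩ := hR.exists_extreme (hS _) rfl (v := inSubtree 2 v u) rfl (by omega)
    (a := s a) (by rwa [hC, below_inSubtree_iff (by omega)])
  rw [← inSubtree_child _ _ _ _ (hS m).one_le (hS m).le_two] at hb
  obtain ⟨b, rfl⟩ := (hsr b).2 (below_trans (below_inSubtree (by omega) _ _) hb)
  rw [hC, below_inSubtree_iff (by omega)] at hb
  exact ⟨b, hb, hr _ _ s hs _ _ hab⟩

theorem exists_le_below (hD : D ∈ tOrderings 2 l) {u : ℕ} (hu : layer 2 u < l)
    {a : Fin (chipCount 2 l)} (ha : Below 2 u (D a)) :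
    ∃ b, Below 2 (child 2 u 2) (D b) ∧ a ≤ b :=
  exists_extreme_of_mem_tOrderings hD hu side_le (fun _ _ _ hs _ _ => hs.le_iff_le.1) ha

theorem exists_ge_below (hD : D ∈ tOrderings 2 l) {u : ℕ} (hu : layer 2 u < l)
    {a : Fin (chipCount 2 l)} (ha : Below 2 u (D a)) :
    ∃ b, Below 2 (child 2 u 1) (D b) ∧ b ≤ a :=
  exists_extreme_of_mem_tOrderings hD hu side_ge (fun _ _ _ hs _ _ => hs.le_iff_le.1) ha

theorem exists_two_lt_below (hD : D ∈ tOrderings 2 l) {u : ℕ} (hu : layer 2 u + 1 < l)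
    {a : Fin (chipCount 2 l)} (ha : D a = u) :
    ∃ b c, b ≠ c ∧ a < b ∧ a < c := by
  obtain ⟨m, v, C, R, s, hR, hv, hs, hsr, hC, hc⟩ := exists_run_of_mem_tOrderings le_rfl hD
  have h1 := layer_inSubtree (k := 2) (by omega) v u
  obtain ⟨b, c, hbc, ⟨hb, hab⟩, hc, hac⟩ := hR.exists_two_extreme (side_le _) rfl
    (v := inSubtree 2 v u) rfl (by omega) (a := s a) (by rw [hC, ha])
  rw [← inSubtree_child _ _ _ _ (by omega) le_rfl] at hb hc
  obtain ⟨b, rfl⟩ := (hsr b).2 (below_trans (below_inSubtree (by omega) _ _) hb)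
  obtain ⟨c, rfl⟩ := (hsr c).2 (below_trans (below_inSubtree (by omega) _ _) hc)
  rw [hC, below_inSubtree_iff (by omega)] at hb hc
  have hne : ∀ d, Below 2 (child 2 u 2) (D d) → a ≠ d := by
    rintro d hd rfl
    rw [ha] at hd
    exact not_below_child_self (by omega) (by omega) le_rfl hd
  exact ⟨b, c, fun h => hbc (h ▸ rfl), lt_of_le_of_ne (hs.le_iff_le.1 hab) (hne b hb),
    lt_of_le_of_ne (hs.le_iff_le.1 hac) (hne c hc)⟩

end BinaryOrderings

/-! ### Multinomial bounds for words. -/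

section Words

variable {α ι : Type*} [Fintype α] [DecidableEq ι]

/-- The words with the letters `i : ι` at `c i` places each. -/
def Content (c : ι → ℕ) (A : α → ι) : Prop := ∀ i, (Finset.univ.filter fun a => A a = i).card = c i

theorem exists_perm_of_content {c : ι → ℕ} {A B : α → ι} (hA : Content c A) (hB : Content c B) :
    ∃ σ : Equiv.Perm α, ∀ a, B (σ a) = A a := by
  have h : ∀ i, Nonempty ({a // A a = i} ≃ {a // B a = i}) := fun i => by
    rw [← Fintype.card_eq, Fintype.card_subtype, Fintype.card_subtype, hA i, hB i]
  exact ⟨Equiv.ofFiberEquiv fun i => (h i).some, Equiv.ofFiberEquiv_map _⟩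

variable [DecidableEq α] [Fintype ι]

/-- All words of the given content are rearrangements of one word `B`. A rearrangement chosen for
each word, composed with the stabilizer of `B`, yields distinct permutations, and the stabilizer has
order `∏ i, (c i)!`. -/
theorem card_content_mul_le (c : ι → ℕ) :
    Nat.card {A : α → ι // Content c A} * ∏ i, (c i).factorial ≤ (Fintype.card α).factorial := by
  rcases isEmpty_or_nonempty {A : α → ι // Content c A} with h | ⟨⟨B, hB⟩⟩
  · rw [Nat.card_of_isEmpty, zero_mul]
    exact Nat.zero_le _
  choose σ hσ using fun A : {A : α → ι // Content c A} => exists_perm_of_content A.2 hB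
  have h1 : ∏ i, (c i).factorial = Nat.card {τ : Equiv.Perm α // B ∘ τ = B} := by
    rw [Nat.card_eq_fintype_card, DomMulAct.stabilizer_card]
    exact Finset.prod_congr rfl fun i _ => by rw [Fintype.card_subtype, hB i]
  rw [h1, ← Nat.card_prod, ← Fintype.card_perm, ← Nat.card_eq_fintype_card]
  apply Nat.card_le_card_of_injective
    fun p : {A : α → ι // Content c A} × {τ : Equiv.Perm α // B ∘ τ = B} => p.2.1 * (σ p.1)
  rintro ⟨A, τ, hτ⟩ ⟨A', τ', hτ'⟩ h
  replace h : τ * σ A = τ' * σ A' := h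
  have hA : ∀ (A : {A : α → ι // Content c A}) (τ : Equiv.Perm α), B ∘ τ = B →
      ∀ a, B ((τ * σ A) a) = A.1 a := fun A τ hτ a => by
    rw [← hσ A a, Equiv.Perm.mul_apply]
    exact congrFun hτ _
  have hAA : A = A' := Subtype.ext (funext fun a => by rw [← hA A τ hτ, ← hA A' τ' hτ', h])
  subst hAA
  exact Prod.ext rfl (Subtype.ext (mul_right_cancel h))

/-- Deleting the place `a₀` leaves a word with one letter `i₀` fewer. -/
theorem card_content_apply_mul_le (c : ι → ℕ) (a₀ : α) (i₀ : ι) :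
    Nat.card {A : α → ι // Content c A ∧ A a₀ = i₀} *
      ∏ i, (Function.update c i₀ (c i₀ - 1) i).factorial ≤ (Fintype.card α - 1).factorial := by
  have h1 : Fintype.card {a // a ≠ a₀} = Fintype.card α - 1 := by
    rw [Fintype.card_subtype_compl, Fintype.card_subtype_eq]
  rw [← h1]
  refine le_trans (Nat.mul_le_mul_right _ ?_) (card_content_mul_le _)
  refine Nat.card_le_card_of_injective (fun A => ⟨fun a : {a // a ≠ a₀} => A.1 a, fun i => ?_⟩) ?_
  · obtain ⟨A, hA, hA0⟩ := A
    have h2 : (Finset.univ.filter fun a : {a // a ≠ a₀} => A a = i).card =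
        ((Finset.univ.filter fun a => A a = i).erase a₀).card := by
      rw [← Finset.card_map (Function.Embedding.subtype _)]
      congr 1
      ext a
      simp [and_comm]
    refine h2.trans ?_
    by_cases hi : i = i₀
    · subst hi
      rw [Finset.card_erase_of_mem (by simp [hA0]), hA i, Function.update_self]
    · rw [Finset.erase_eq_of_notMem (by simp [hA0, Ne.symm hi]), hA i,
        Function.update_of_ne hi]
  · rintro ⟨A, hA, hA0⟩ ⟨A', hA', hA0'⟩ h
    replace h := congrArg Subtype.val h
    apply Subtype.ext
    funext a
    by_cases ha : a = a₀
    · rw [ha]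
      exact hA0.trans hA0'.symm
    · exact congrFun h ⟨a, ha⟩

end Words

/-! ### The recursion for the number of orderings. -/

section Branch

variable {k : ℕ}

/-- The index of the child of the root below which the vertex lies; `0` for the root. -/
def branch (k : ℕ) : ℕ → ℕ
  | 0 => 0
  | u + 1 => if u < k then u + 1 else branch k (u / k)
  decreasing_by exact Nat.lt_succ_of_le (Nat.div_le_self u k)

theorem branch_zero (k : ℕ) : branch k 0 = 0 := by rw [branch]

theorem branch_child {u j : ℕ} (h1 : 1 ≤ j) (hj : j ≤ k) :
    branch k (child k u j) = if u = 0 then j else branch k u := by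
  obtain ⟨i, rfl⟩ : ∃ i, j = i + 1 := ⟨j - 1, by omega⟩
  have h : child k u (i + 1) = (i + k * u) + 1 := by unfold child; omega
  rw [h, branch, Nat.add_mul_div_left _ _ (by omega), Nat.div_eq_of_lt (by omega), zero_add]
  by_cases hu : u = 0
  · subst hu
    rw [if_pos (by omega), if_pos rfl, mul_zero, add_zero]
  · have : k * 1 ≤ k * u := Nat.mul_le_mul_left k (by omega)
    rw [if_neg (by omega), if_neg hu]

theorem branch_le (hk : 1 ≤ k) (u : ℕ) : branch k u ≤ k := by
  induction u using vertex_induction hk with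
  | h0 => rw [branch_zero]; exact Nat.zero_le _
  | h u j h1 hj ih => rw [branch_child h1 hj]; split_ifs <;> assumption

theorem branch_eq_zero_iff (hk : 1 ≤ k) (u : ℕ) : branch k u = 0 ↔ u = 0 := by
  induction u using vertex_induction hk with
  | h0 => simp [branch_zero]
  | h u j h1 hj ih =>
    have := child_ne_zero (k := k) (v := u) h1
    rw [branch_child h1 hj]
    split_ifs with h
    · exact ⟨fun h => by omega, fun h => absurd h this⟩
    · exact ⟨fun h' => absurd (ih.1 h') h, fun h => absurd h this⟩

theorem below_iff_branch_eq (hk : 1 ≤ k) {j : ℕ} (h1 : 1 ≤ j) (hj : j ≤ k) (u : ℕ) :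
    Below k (child k 0 j) u ↔ branch k u = j := by
  induction u using vertex_induction hk with
  | h0 =>
    rw [branch_zero]
    exact ⟨fun h => absurd (eq_zero_of_below_zero h) (child_ne_zero h1), by omega⟩
  | h u i hi1 hi ih =>
    rw [branch_child hi1 hi]
    split_ifs with hu
    · subst hu
      constructor
      · intro h
        rcases below_child_cases hi1 hi h with e | h
        · exact (child_inj h1 hj hi1 hi e).2.symm
        · exact absurd (eq_zero_of_below_zero h) (child_ne_zero h1)
      · rintro rfl
        exact below_refl _ _
    · rw [← ih]
      constructor
      · intro h
        rcases below_child_cases hi1 hi h with e | h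
        · exact absurd (child_inj h1 hj hi1 hi e).1.symm hu
        · exact h
      · exact below_child hi1 hi

/-- The set of chips in the subtree fixes the increasing relabeling, and with it the ordering fixes
their places. -/
theorem eq_of_isSubtreeOrdering (hk : 1 ≤ k) {n N u : ℕ} {D D' : Configuration N}
    {E : Configuration n} (h : IsSubtreeOrdering k u D E) (h' : IsSubtreeOrdering k u D' E)
    (hb : ∀ c, Below k u (D c) ↔ Below k u (D' c)) {c : Fin N} (hc : Below k u (D c)) :
    D c = D' c := by
  obtain ⟨s, hs, hr, hD⟩ := h
  obtain ⟨s', hs', hr', hD'⟩ := h'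
  have hss : s = s' := by
    refine (StrictMono.range_inj hs hs').1 ?_
    ext c
    rw [mem_range_iff_below hk hr, mem_range_iff_below hk hr', hb]
  subst hss
  obtain ⟨a, rfl⟩ := (mem_range_iff_below hk hr c).2 hc
  rw [hD, hD']

/-- An ordering is recovered from its branch word and the orderings of its `k` branches. The
predicate `P` leaves room for further information about the word. -/
theorem ncard_tOrderings_succ_le (hk : 2 ≤ k) (l : ℕ)
    (P : (Fin (chipCount k (l + 1)) → Fin (k + 1)) → Prop)
    (hP : ∀ D ∈ tOrderings k (l + 1), P fun c => ⟨branch k (D c),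
      Nat.lt_succ_of_le (branch_le (by omega) _)⟩) :
    (tOrderings k (l + 1)).ncard ≤
      Nat.card {A : Fin (chipCount k (l + 1)) → Fin (k + 1) //
        Content (fun j => if j = 0 then 1 else chipCount k l) A ∧ P A} *
      (tOrderings k l).ncard ^ k := by
  have hfin := (finite_tOrderings hk l).to_subtype
  have hsub : ∀ D : tOrderings k (l + 1), ∀ j : Fin k, ∃ E : tOrderings k l,
      IsSubtreeOrdering k (child k 0 (j + 1)) D.1 E.1 := by
    intro D j
    obtain ⟨E, hE, h⟩ := exists_subtree_ordering hk D.2 (u := child k 0 (j + 1)) (l' := l)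
      (by rw [layer_child (by omega) (by omega), layer_zero]; omega)
    exact ⟨⟨E, hE⟩, h⟩
  choose E hE using hsub
  rw [← Nat.card_coe_set_eq, ← Nat.card_coe_set_eq]
  have h1 : Nat.card (Fin k → tOrderings k l) = Nat.card (tOrderings k l) ^ k := by
    rw [Nat.card_fun, Nat.card_eq_fintype_card (α := Fin k), Fintype.card_fin]
  rw [← h1, ← Nat.card_prod]
  refine Nat.card_le_card_of_injective (fun D => (⟨_, ?_, hP D.1 D.2⟩, E D)) ?_
  · classical
    intro j
    by_cases hj : j = 0
    · subst hj
      change _ = 1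
      obtain ⟨c, hc⟩ := exists_apply_eq_of_mem_tOrderings hk D.2 (w := 0)
        (by rw [chipCount_succ hk]; omega)
      rw [Finset.card_eq_one]
      refine ⟨c, ?_⟩
      ext a
      rw [Finset.mem_filter, Finset.mem_singleton, Fin.ext_iff]
      simp only [Finset.mem_univ, true_and, Fin.val_zero]
      rw [branch_eq_zero_iff (by omega), ← hc]
      exact (injective_of_mem_tOrderings hk D.2).eq_iff
    · have hj1 : 1 ≤ (j : ℕ) := by
        have : (j : ℕ) ≠ 0 := fun h => hj (Fin.ext h)
        omega
      change _ = if j = 0 then 1 else chipCount k l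
      rw [if_neg hj, ← card_below_of_mem_tOrderings hk D.2 (u := child k 0 j) (l' := l)
        (by rw [layer_child hj1 (by omega), layer_zero]; omega)]
      congr 1
      ext a
      rw [Finset.mem_filter, Finset.mem_filter, Fin.ext_iff,
        below_iff_branch_eq (by omega) hj1 (by omega)]
  · intro D D' h
    rw [Prod.mk.injEq, Subtype.mk.injEq] at h
    obtain ⟨hw, hEE⟩ := h
    have hb : ∀ c, branch k (D.1 c) = branch k (D'.1 c) := fun c =>
      Fin.ext_iff.1 (congrFun hw c)
    apply Subtype.ext
    funext c
    by_cases h0 : branch k (D.1 c) = 0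
    · have h0' := h0
      rw [hb] at h0'
      rw [branch_eq_zero_iff (by omega)] at h0 h0'
      rw [h0, h0']
    · have hle := branch_le (k := k) (by omega) (D.1 c)
      obtain ⟨j, hj⟩ : ∃ j, branch k (D.1 c) = j + 1 := ⟨branch k (D.1 c) - 1, by omega⟩
      have h2 := hE D' ⟨j, by omega⟩
      rw [← hEE] at h2
      refine eq_of_isSubtreeOrdering (by omega) (hE D ⟨j, by omega⟩) h2 (fun c => ?_) ?_
      · rw [below_iff_branch_eq (by omega) (by omega) (by simp; omega),
          below_iff_branch_eq (by omega) (by omega) (by simp; omega), hb]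
      · rw [below_iff_branch_eq (by omega) (by omega) (by simp; omega), hj]

theorem ncard_tOrderings_succ_mul_le (hk : 2 ≤ k) (l : ℕ) :
    (tOrderings k (l + 1)).ncard * (chipCount k l).factorial ^ k ≤
      (chipCount k (l + 1)).factorial * (tOrderings k l).ncard ^ k := by
  have h1 := ncard_tOrderings_succ_le hk l (fun _ => True) fun _ _ => trivial
  have h2 := card_content_mul_le (α := Fin (chipCount k (l + 1)))
    (fun j : Fin (k + 1) => if j = 0 then 1 else chipCount k l)
  simp only [and_true] at h1
  rw [Fin.prod_univ_succ] at h2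
  simp only [Fin.succ_ne_zero, if_true, if_false, Nat.factorial_one, one_mul, Finset.prod_const,
    Finset.card_univ, Fintype.card_fin] at h2
  calc _ ≤ _ := Nat.mul_le_mul_right _ h1
    _ = _ := by rw [mul_right_comm]
    _ ≤ _ := Nat.mul_le_mul_right _ h2

/-- The largest chip lies in the right branch, so one letter of the branch word is prescribed. -/
theorem ncard_tOrderings_two_succ_mul_le (l : ℕ) :
    (tOrderings 2 (l + 2)).ncard * ((chipCount 2 (l + 1)).factorial *
      (chipCount 2 (l + 1) - 1).factorial) ≤
      (chipCount 2 (l + 2) - 1).factorial * (tOrderings 2 (l + 1)).ncard ^ 2 := by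
  have hlt : chipCount 2 (l + 2) - 1 < chipCount 2 (l + 2) := by
    rw [chipCount_succ le_rfl]; omega
  have h1 := ncard_tOrderings_succ_le le_rfl (l + 1) (fun A => A ⟨_, hlt⟩ = 2) (by
    intro D hD
    obtain ⟨b, hb, hle⟩ := exists_le_below hD (u := 0) (a := ⟨_, hlt⟩)
      (by rw [layer_zero]; omega) (below_zero (by omega) _)
    have : b = ⟨_, hlt⟩ := le_antisymm (Nat.le_sub_one_of_lt b.2) hle
    rw [this, below_iff_branch_eq (by omega) (by omega) le_rfl] at hb
    exact Fin.ext hb)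
  have h2 := card_content_apply_mul_le (α := Fin (chipCount 2 (l + 2)))
    (fun j : Fin (2 + 1) => if j = 0 then 1 else chipCount 2 (l + 1)) ⟨_, hlt⟩ 2
  rw [Fin.prod_univ_three] at h2
  simp at h2
  calc _ ≤ _ := Nat.mul_le_mul_right _ h1
    _ = _ := by rw [mul_right_comm]
    _ ≤ _ := Nat.mul_le_mul_right _ h2

end Branch

/-! ### Three layers: words of families. -/

section Rows

variable {k l : ℕ}

/-- `0` for the root, and `u + 1` for the children of `u`. -/
def family (k w : ℕ) : ℕ := if w = 0 then 0 else parent k w + 1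

theorem family_child {u j : ℕ} (h1 : 1 ≤ j) (hj : j ≤ k) : family k (child k u j) = u + 1 := by
  rw [family, if_neg (child_ne_zero h1), parent_child k u j h1 hj]

theorem family_eq_succ (hk : 1 ≤ k) {u w : ℕ} (h : family k w = u + 1) :
    ∃ j, 1 ≤ j ∧ j ≤ k ∧ w = child k u j := by
  unfold family at h
  split_ifs at h with h0
  obtain ⟨j, h1, hj, he⟩ := exists_eq_child hk h0
  exact ⟨j, h1, hj, by rw [he, Nat.succ_injective h]⟩

theorem child_lt_chipCount (hk : 2 ≤ k) {u j : ℕ} (h1 : 1 ≤ j) (hj : j ≤ k)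
    (hu : u < chipCount k l) : child k u j < chipCount k (l + 1) := by
  rw [lt_chipCount_iff hk] at hu ⊢
  rw [layer_child h1 hj]
  omega

theorem parent_lt_chipCount (hk : 2 ≤ k) {u j : ℕ} (h1 : 1 ≤ j) (hj : j ≤ k)
    (hu : child k u j < chipCount k (l + 1)) : u < chipCount k l := by
  rw [lt_chipCount_iff hk] at hu ⊢
  rw [layer_child h1 hj] at hu
  omega

/-- The chips on the children of a vertex, from left to right. -/
theorem exists_row (hk : 2 ≤ k) {D : Configuration (chipCount k (l + 1))}
    (hD : D ∈ tOrderings k (l + 1)) {u : ℕ} (hu : u < chipCount k l) :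
    ∃ f : Fin k → Fin (chipCount k (l + 1)), StrictMono f ∧ (∀ j, D (f j) = child k u (j + 1)) ∧
      ∀ c, c ∈ Set.range f ↔ family k (D c) = u + 1 := by
  choose f hf using fun j : Fin k => exists_apply_eq_of_mem_tOrderings hk hD
    (child_lt_chipCount hk (by omega : 1 ≤ (j : ℕ) + 1) (by omega) hu)
  refine ⟨f, fun i j hij => lt_of_children hk hD (u := u) (by omega) (Nat.succ_lt_succ hij)
    (by omega) (hf i) (hf j), hf, fun c => ?_⟩
  constructor
  · rintro ⟨j, rfl⟩
    rw [hf, family_child (by omega) (by omega)]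
  · intro h
    obtain ⟨j, h1, hj, he⟩ := family_eq_succ (by omega) h
    refine ⟨⟨j - 1, by omega⟩, injective_of_mem_tOrderings hk hD ?_⟩
    rw [hf, he]
    congr 1
    exact Nat.sub_add_cancel h1

/-- Siblings are sorted, so the set of chips in a family determines their places. -/
theorem eq_of_family_eq (hk : 2 ≤ k) {D D' : Configuration (chipCount k (l + 1))}
    (hD : D ∈ tOrderings k (l + 1)) (hD' : D' ∈ tOrderings k (l + 1))
    (h : ∀ c, family k (D c) = family k (D' c)) : D = D' := by
  funext c
  by_cases h0 : D c = 0
  · have := h c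
    unfold family at this
    rw [if_pos h0] at this
    split_ifs at this with h0'
    rw [h0, h0']
  · obtain ⟨j, h1, hj, he⟩ := exists_eq_child (k := k) (by omega) h0
    have hu := parent_lt_chipCount hk h1 hj (he ▸ lt_of_mem_tOrderings hk hD c)
    obtain ⟨f, hf, hDf, hr⟩ := exists_row hk hD hu
    obtain ⟨f', hf', hDf', hr'⟩ := exists_row hk hD' hu
    have hff : f = f' := by
      refine (StrictMono.range_inj hf hf').1 ?_
      ext c
      rw [hr, hr', h]
    subst hff
    obtain ⟨i, rfl⟩ := (hr c).2 (by rw [family, if_neg h0])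
    rw [hDf, hDf']

theorem card_family_succ (hk : 2 ≤ k) {D : Configuration (chipCount k (l + 1))}
    (hD : D ∈ tOrderings k (l + 1)) {u : ℕ} (hu : u < chipCount k l) :
    (Finset.univ.filter fun c => family k (D c) = u + 1).card = k := by
  obtain ⟨f, hf, hDf, hr⟩ := exists_row hk hD hu
  have : (Finset.univ.filter fun c => family k (D c) = u + 1) = Finset.univ.image f := by
    ext c
    rw [Finset.mem_filter, ← hr]
    simp
  rw [this, Finset.card_image_of_injective _ hf.injective, Finset.card_univ, Fintype.card_fin]

theorem card_family_zero (hk : 2 ≤ k) {D : Configuration (chipCount k (l + 1))}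
    (hD : D ∈ tOrderings k (l + 1)) :
    (Finset.univ.filter fun c => family k (D c) = 0).card = 1 := by
  obtain ⟨c, hc⟩ := exists_apply_eq_of_mem_tOrderings hk hD (w := 0)
    (by rw [chipCount_succ hk]; omega)
  rw [Finset.card_eq_one]
  refine ⟨c, ?_⟩
  ext a
  rw [Finset.mem_filter, Finset.mem_singleton, ← (injective_of_mem_tOrderings hk hD).eq_iff, hc]
  unfold family
  simp

theorem family_lt (hk : 2 ≤ k) {D : Configuration (chipCount k (l + 1))}
    (hD : D ∈ tOrderings k (l + 1)) (c : Fin (chipCount k (l + 1))) :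
    family k (D c) < chipCount k l + 1 := by
  by_cases h0 : D c = 0
  · rw [family, if_pos h0]
    omega
  · obtain ⟨j, h1, hj, he⟩ := exists_eq_child (k := k) (by omega) h0
    have hu := parent_lt_chipCount hk h1 hj (he ▸ lt_of_mem_tOrderings hk hD c)
    rw [family, if_neg h0]
    omega

/-- The chips at the left ends of the rows of leaves, for three layers. -/
theorem exists_first_column (hk : 2 ≤ k) {D : Configuration (chipCount k 3)}
    (hD : D ∈ tOrderings k 3) :
    ∃ f : Fin k → Fin (chipCount k 3), StrictMono f ∧ (∀ i : Fin k, family k (D (f i)) = i + 2) ∧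
      ∀ (i : Fin k) (c), family k (D c) = i + 2 → f i ≤ c := by
  have hu : ∀ i : Fin k, (i : ℕ) + 1 < chipCount k 2 := fun i => by
    rw [chipCount_two hk]; omega
  choose f hf hDf hr using fun i : Fin k => exists_row hk hD (hu i)
  have h0 : 0 < k := by omega
  refine ⟨fun i => f i ⟨0, h0⟩, fun i j hij => ?_, fun i => ?_, fun i c hc => ?_⟩
  · refine lt_of_grandchildren hk hD (u := 0) (t := 1) (i := i + 1) (j := j + 1)
      (by rw [layer_zero]) (by omega) (Nat.succ_lt_succ hij) (by omega) le_rfl (by omega) ?_ ?_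
    · rw [hDf]
      simp [child]
    · rw [hDf]
      simp [child]
  · exact (hr i _).1 ⟨_, rfl⟩
  · obtain ⟨t, rfl⟩ := (hr i c).2 hc
    exact (hf i).monotone (Fin.mk_le_mk.2 (Nat.zero_le _))

/-- The letter of a chip with family `n`, when the rows of leaves are renamed. -/
def letter (σ : Equiv.Perm (Fin k)) : ℕ → Option (Option (Fin k))
  | 0 => none
  | 1 => some none
  | i + 2 => if h : i < k then some (some (σ ⟨i, h⟩)) else none

theorem letter_eq_none {σ : Equiv.Perm (Fin k)} {n : ℕ} (hn : n < k + 2) :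
    letter σ n = none ↔ n = 0 := by
  rcases n with _ | _ | n
  · simp [letter]
  · simp [letter]
  · simp [letter, show n < k by omega]

theorem letter_eq_some_none {σ : Equiv.Perm (Fin k)} {n : ℕ} :
    letter σ n = some none ↔ n = 1 := by
  rcases n with _ | _ | n
  · simp [letter]
  · simp [letter]
  · simp only [letter]
    split_ifs <;> simp

theorem letter_eq_some_some {σ : Equiv.Perm (Fin k)} {n : ℕ} {x : Fin k} :
    letter σ n = some (some (σ x)) ↔ n = x + 2 := by
  rcases n with _ | _ | n
  · simp [letter]
  · simp [letter]
  · simp only [letter]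
    split_ifs with h
    · simp [Fin.ext_iff]
    · simp only [false_iff]
      omega

/-- The words of families determine the orderings; for three layers, the rows may be permuted. -/
theorem ncard_tOrderings_three_mul_le (hk : 2 ≤ k) :
    (tOrderings k 3).ncard * k.factorial ^ (k + 2) ≤ (chipCount k 3).factorial := by
  have hN2 := chipCount_two hk
  have h1 := card_content_mul_le (α := Fin (chipCount k 3))
    (fun j : Option (Option (Fin k)) => if j = none then 1 else k)
  rw [Fintype.prod_option, Fintype.prod_option] at h1
  simp only [reduceCtorEq, if_true, if_false, Nat.factorial_one, one_mul, Finset.prod_const,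
    Finset.card_univ, Fintype.card_fin] at h1
  refine le_trans ?_ h1
  -- One factor `k!` counts the renamings of the rows of leaves; the remaining `k + 1` belong to the
  -- content, one for each family other than the root.
  rw [pow_succ', pow_succ', ← mul_assoc]
  refine Nat.mul_le_mul_right _ ?_
  have h2 : k.factorial = Nat.card (Equiv.Perm (Fin k)) := by
    rw [Nat.card_eq_fintype_card, Fintype.card_perm, Fintype.card_fin]
  rw [h2, ← Nat.card_coe_set_eq, ← Nat.card_prod]
  have hlt : ∀ (D : tOrderings k 3) c, family k (D.1 c) < k + 2 := fun D c => by
    have := family_lt hk D.2 c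
    omega
  refine Nat.card_le_card_of_injective (fun p => ⟨fun c => letter p.2 (family k (p.1.1 c)), ?_⟩) ?_
  · obtain ⟨D, σ⟩ := p
    rintro (_ | _ | x)
    · refine Eq.trans ?_ (card_family_zero hk D.2)
      congr 1
      ext c
      rw [Finset.mem_filter, Finset.mem_filter, letter_eq_none (hlt D c)]
    · refine Eq.trans ?_ (card_family_succ hk D.2 (u := 0) (by omega))
      congr 1
      ext c
      rw [Finset.mem_filter, Finset.mem_filter, letter_eq_some_none]
    · obtain ⟨y, rfl⟩ := σ.surjective x
      refine Eq.trans ?_ (card_family_succ hk D.2 (u := y + 1) (by omega))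
      congr 1
      ext c
      rw [Finset.mem_filter, Finset.mem_filter, letter_eq_some_some]
  · rintro ⟨D, σ⟩ ⟨D', σ'⟩ h
    replace h : ∀ c, letter σ (family k (D.1 c)) = letter σ' (family k (D'.1 c)) :=
      fun c => congrFun (congrArg Subtype.val h) c
    obtain ⟨f, hf, hDf, hle⟩ := exists_first_column hk D.2
    obtain ⟨f', hf', hDf', hle'⟩ := exists_first_column hk D'.2
    -- Equal words have the same classes of leaf chips, hence the same class minima up to a
    -- renaming. Since the minima increase from row to row in both orderings, the renaming is
    -- trivial.
    have hff : ∀ i, f i = f' (σ'.symm (σ i)) := by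
      intro i
      have h3 := letter_eq_some_some (σ := σ).2 (hDf i)
      have h4 := letter_eq_some_some (σ := σ').2 (hDf' (σ'.symm (σ i)))
      rw [h, ← σ'.apply_symm_apply (σ i), letter_eq_some_some] at h3
      rw [← h, Equiv.apply_symm_apply, letter_eq_some_some] at h4
      exact le_antisymm (hle i _ h4) (hle' _ _ h3)
    have hσ : f = f' := by
      refine (StrictMono.range_inj hf hf').1 ?_
      have : f = f' ∘ (σ.trans σ'.symm) := funext hff
      rw [this]
      exact (σ.trans σ'.symm).surjective.range_comp f'
    have hσσ : σ = σ' := by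
      ext1 i
      have h3 := hff i
      rw [hσ] at h3
      rw [Equiv.eq_symm_apply σ' |>.1 (hf'.injective h3)]
    subst hσσ
    refine Prod.ext (Subtype.ext (eq_of_family_eq hk D.2 D'.2 fun c => ?_)) rfl
    have h3 := h c
    have h4 := hlt D c
    have h5 := hlt D' c
    generalize family k (D.1 c) = x at *
    generalize family k (D'.1 c) = y at *
    rcases x with _ | _ | x
    · exact ((letter_eq_none h5).1 h3.symm).symm
    · exact (letter_eq_some_none.1 h3.symm).symm
    · rw [letter_eq_some_some (x := ⟨x, by omega⟩) |>.2 rfl] at h3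
      exact (letter_eq_some_some.1 h3.symm).symm

end Rows

/-! ### The base case of three layers for `k = 2` and `k = 3`. -/

section SmallCases

theorem eq_of_below_of_layer_le {k c w : ℕ} (hk : 1 ≤ k) (h : Below k c w)
    (hw : layer k w ≤ layer k c) : w = c := by
  by_contra hne
  obtain ⟨j, h1, hj, hb⟩ := exists_below_child hk h hne
  have := layer_le_of_below hk hb
  rw [layer_child h1 hj] at this
  omega

/-- The constraints on the chips on the vertices `0`, `1`, `2`, `4`, `5`. -/
def BinaryLabels (p : Fin 7 × Fin 7 × Fin 7 × Fin 7 × Fin 7) : Prop :=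
  match p with
  | (r, a, b, a', b') =>
    (0 < r ∧ r < 5) ∧ (0 < a ∧ a < b ∧ b < 6) ∧ (a < a' ∧ a' < 6) ∧ (0 < b' ∧ b' < b) ∧
      r ≠ a ∧ r ≠ b ∧ r ≠ a' ∧ r ≠ b' ∧ a ≠ b' ∧ b ≠ a' ∧ a' ≠ b'

instance : DecidablePred BinaryLabels := fun ⟨r, a, b, a', b'⟩ => by
  unfold BinaryLabels; infer_instance

theorem card_binaryLabels : Fintype.card {p // BinaryLabels p} = 20 := by decide +kernel

theorem chipCount_two_three : chipCount 2 3 = 7 := by decide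

theorem chipCount_three_three : chipCount 3 3 = 13 := by decide

/-- The vertices `3` and `6` hold the smallest and the largest chip, and a finite check counts the
admissible labels of the other five. -/
theorem ncard_tOrderings_two_three_le : (tOrderings 2 3).ncard ≤ 20 := by
  have hex : ∀ (D : tOrderings 2 3) (w : Fin 7), ∃ c, D.1 c = w := fun D w =>
    exists_apply_eq_of_mem_tOrderings le_rfl D.2 (by rw [chipCount_two_three]; exact w.2)
  choose f hf using hex
  have hl : ∀ u : Fin 7, layer 2 u ≤ 3 := fun u => by
    rw [← lt_chipCount_iff le_rfl, chipCount_two_three]; exact u.2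
  have hl' : ∀ (D : tOrderings 2 3) c, layer 2 (D.1 c) ≤ 3 := fun D c => by
    rw [← lt_chipCount_iff le_rfl]
    exact lt_of_mem_tOrderings le_rfl D.2 c
  have l0 : layer 2 0 = 1 := layer_zero 2
  have l1 : layer 2 1 = 2 := (layer_child (v := 0) (j := 1) (by omega) (by omega)).trans (by rw [l0])
  have l2 : layer 2 2 = 2 := (layer_child (v := 0) (j := 2) (by omega) (by omega)).trans (by rw [l0])
  have l3 : layer 2 3 = 3 := (layer_child (v := 1) (j := 1) (by omega) (by omega)).trans (by rw [l1])
  have l4 : layer 2 4 = 3 := (layer_child (v := 1) (j := 2) (by omega) (by omega)).trans (by rw [l1])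
  have l5 : layer 2 5 = 3 := (layer_child (v := 2) (j := 1) (by omega) (by omega)).trans (by rw [l2])
  have l6 : layer 2 6 = 3 := (layer_child (v := 2) (j := 2) (by omega) (by omega)).trans (by rw [l2])
  have hinj : ∀ (D : tOrderings 2 3) u w, u ≠ w → f D u ≠ f D w := by
    intro D u w huw h
    have h1 := hf D u
    rw [h, hf] at h1
    exact huw (Fin.ext h1.symm)
  have heq : ∀ (D : tOrderings 2 3) c w, D.1 c = (w : Fin 7) → c = f D w := fun D c w h =>
    injective_of_mem_tOrderings le_rfl D.2 (h.trans (hf D w).symm)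
  have hup : ∀ (D : tOrderings 2 3) (u w : Fin 7) c, child 2 u 2 = w → layer 2 w = 3 →
      layer 2 u = 2 → Below 2 u (D.1 c) → c ≤ f D w := by
    intro D u w c huw hw hu hc
    obtain ⟨b, hb, hle⟩ := exists_le_below D.2 (by omega) hc
    rw [huw] at hb
    rwa [heq D b w (eq_of_below_of_layer_le (by omega) hb (by rw [hw]; exact hl' D b))] at hle
  have hdown : ∀ (D : tOrderings 2 3) (u w : Fin 7) c, child 2 u 1 = w → layer 2 w = 3 →
      layer 2 u = 2 → Below 2 u (D.1 c) → f D w ≤ c := by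
    intro D u w c huw hw hu hc
    obtain ⟨b, hb, hle⟩ := exists_ge_below D.2 (by omega) hc
    rw [huw] at hb
    rwa [heq D b w (eq_of_below_of_layer_le (by omega) hb (by rw [hw]; exact hl' D b))] at hle
  have hmax : ∀ (D : tOrderings 2 3) c, c ≤ f D 6 := by
    intro D c
    obtain ⟨b, hb, hle⟩ := exists_le_below D.2 (u := 0) (by omega) (below_zero (by omega) (D.1 c))
    exact hle.trans (hup D 2 6 b rfl l6 l2 hb)
  have hmin : ∀ (D : tOrderings 2 3) c, f D 3 ≤ c := by
    intro D c
    obtain ⟨b, hb, hle⟩ := exists_ge_below D.2 (u := 0) (by omega) (below_zero (by omega) (D.1 c))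
    exact (hdown D 1 3 b rfl l3 l1 hb).trans hle
  have hcast : ∀ (D : tOrderings 2 3) (w : Fin 7), (f D w : ℕ) < 7 := fun D w =>
    chipCount_two_three ▸ (f D w).2
  have h3 : ∀ D, (f D 3 : ℕ) = 0 := fun D =>
    Nat.le_zero.1 (hmin D ⟨0, by rw [chipCount_two_three]; omega⟩)
  have h6 : ∀ D, (f D 6 : ℕ) = 6 := fun D =>
    le_antisymm (Nat.le_of_lt_succ (hcast D 6)) (hmax D ⟨6, by rw [chipCount_two_three]; omega⟩)
  rw [← card_binaryLabels, ← Nat.card_eq_fintype_card, ← Nat.card_coe_set_eq]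
  refine Nat.card_le_card_of_injective (fun D => ⟨(⟨f D 0, hcast D 0⟩, ⟨f D 1, hcast D 1⟩,
    ⟨f D 2, hcast D 2⟩, ⟨f D 4, hcast D 4⟩, ⟨f D 5, hcast D 5⟩), ?_⟩) ?_
  · have hne : ∀ u w : Fin 7, u ≠ w → (f D u : ℕ) ≠ f D w := fun u w h h' =>
      hinj D u w h (Fin.ext h')
    have hlt : ∀ u w : Fin 7, u ≠ w → f D u ≤ f D w → (f D u : ℕ) < f D w := fun u w h h' =>
      lt_of_le_of_ne h' (hne u w h)
    have h12 : (f D 1 : ℕ) < f D 2 := lt_of_children le_rfl D.2 (u := 0) (i := 1) (j := 2)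
      le_rfl (by omega) le_rfl (hf D 1) (hf D 2)
    have h14 := hlt 1 4 (by decide) (hup D 1 4 _ rfl l4 l1 (by rw [hf]; exact below_refl _ _))
    have h52 := hlt 5 2 (by decide) (hdown D 2 5 _ rfl l5 l2 (by rw [hf]; exact below_refl _ _))
    -- Two larger chips among the labels `0, …, 6` force the chip on the root to be at most `4`.
    obtain ⟨b, c, hbc, hb, hc⟩ := exists_two_lt_below D.2 (u := 0) (by omega) (hf D 0)
    have hb1 : (f D 0 : ℕ) < b := hb
    have hc1 : (f D 0 : ℕ) < c := hc
    have hbc1 : (b : ℕ) ≠ c := fun h => hbc (Fin.ext h)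
    have hb7 : (b : ℕ) < 7 := chipCount_two_three ▸ b.2
    have hc7 : (c : ℕ) < 7 := chipCount_two_three ▸ c.2
    have e0 := h3 D
    have e6 := h6 D
    have n1 := hne 0 3 (by decide)
    have n2 := hne 1 3 (by decide)
    have n3 := hne 5 3 (by decide)
    have n4 := hne 2 6 (by decide)
    have n5 := hne 4 6 (by decide)
    have n6 := hcast D 2
    have n7 := hcast D 4
    simp only [BinaryLabels, Fin.lt_def, ne_eq, Fin.ext_iff, Fin.val_zero]
    refine ⟨⟨by omega, ?_⟩, ⟨by omega, h12, ?_⟩, ⟨h14, ?_⟩, ⟨by omega, h52⟩, hne 0 1 (by decide),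
      hne 0 2 (by decide), hne 0 4 (by decide), hne 0 5 (by decide), hne 1 5 (by decide),
      hne 2 4 (by decide), hne 4 5 (by decide)⟩
    · change (f D 0 : ℕ) < 5
      omega
    · change (f D 2 : ℕ) < 6
      omega
    · change (f D 4 : ℕ) < 6
      omega
  · intro D D' h
    simp only [Subtype.mk.injEq, Prod.mk.injEq, Fin.mk.injEq] at h
    have hall : ∀ w, f D w = f D' w := by
      intro w
      apply Fin.ext
      have e3 := (h3 D).trans (h3 D').symm
      have e6 := (h6 D).trans (h6 D').symm
      obtain ⟨h0, h1, h2, h4, h5⟩ := h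
      fin_cases w <;> assumption
    apply Subtype.ext
    funext c
    have hc := lt_of_mem_tOrderings le_rfl D.2 c
    replace hc := hc.trans_eq chipCount_two_three
    have h1 := heq D c ⟨_, hc⟩ rfl
    rw [hall] at h1
    have h2 := hf D' ⟨_, hc⟩
    rw [← h1] at h2
    exact h2.symm

/-- The constraints on the chips on the vertices `5`, `6`, `10`, `11` among the chips on the
leaves. -/
def TernaryLabels (p : Fin 9 × Fin 9 × Fin 9 × Fin 9) : Prop :=
  match p with
  | (a, b, c, d) =>
    (0 < a ∧ a < 4) ∧ (a < b ∧ b < 7) ∧ (1 < c ∧ c < d) ∧ (4 < d ∧ d < 8) ∧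
      a ≠ c ∧ a ≠ d ∧ b ≠ c ∧ b ≠ d

instance : DecidablePred TernaryLabels := fun ⟨a, b, c, d⟩ => by
  unfold TernaryLabels; infer_instance

theorem card_ternaryLabels : Fintype.card {p // TernaryLabels p} = 79 := by decide +kernel

theorem card_filter_of_mem_tOrderings {k l : ℕ} (hk : 2 ≤ k) {D : Configuration (chipCount k l)}
    (hD : D ∈ tOrderings k l) (p : ℕ → Prop) [DecidablePred p] :
    (Finset.univ.filter fun c => p (D c)).card =
      ((Finset.range (chipCount k l)).filter p).card := by
  rw [← image_of_mem_tOrderings hk hD, Finset.filter_image,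
    Finset.card_image_of_injective _ (injective_of_mem_tOrderings hk hD)]

/-- `e i` is the rank, among all leaf chips, of the chip on the `i`-th leaf. The leaves are the
vertices `4, …, 12`. -/
theorem exists_leaf_labels {D : Configuration (chipCount 3 3)} (hD : D ∈ tOrderings 3 3) :
    ∃ (s : Fin 9 → Fin (chipCount 3 3)) (e : Fin 9 → Fin 9), StrictMono s ∧
      (∀ c, c ∈ Set.range s ↔ 4 ≤ D c) ∧ (∀ i, D (s (e i)) = 4 + i) ∧ Function.Bijective e := by
  classical
  have hcard : (Finset.univ.filter fun c => 4 ≤ D c).card = 9 := by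
    rw [card_filter_of_mem_tOrderings (by omega) hD fun w => 4 ≤ w, chipCount_three_three]
    decide
  set F := Finset.univ.filter fun c => 4 ≤ D c with hF
  have hr : ∀ c, c ∈ Set.range (F.orderEmbOfFin hcard) ↔ 4 ≤ D c := fun c => by
    rw [Finset.range_orderEmbOfFin, Finset.mem_coe, hF, Finset.mem_filter]
    simp
  have hex : ∀ i : Fin 9, ∃ a, D (F.orderEmbOfFin hcard a) = 4 + i := fun i => by
    obtain ⟨c, hc⟩ := exists_apply_eq_of_mem_tOrderings (by omega) hD (w := 4 + i)
      (by rw [chipCount_three_three]; omega)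
    obtain ⟨a, rfl⟩ := (hr c).2 (by omega)
    exact ⟨a, hc⟩
  choose e he using hex
  refine ⟨_, e, (F.orderEmbOfFin hcard).strictMono, hr, he, Finite.injective_iff_bijective.1 ?_⟩
  intro i j hij
  have h1 := he i
  rw [hij, he] at h1
  omega

/-- The ranks form a 3 × 3 array increasing along rows (siblings) and columns (cousins in the same
position). -/
theorem labels_lt {D : Configuration (chipCount 3 3)} (hD : D ∈ tOrderings 3 3)
    {s : Fin 9 → Fin (chipCount 3 3)} {e : Fin 9 → Fin 9} (hs : StrictMono s)
    (he : ∀ i, D (s (e i)) = 4 + i) :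
    (∀ a b : Fin 9, (a : ℕ) / 3 = b / 3 → a < b → (e a : ℕ) < e b) ∧
      ∀ a b : Fin 9, (a : ℕ) % 3 = b % 3 → a < b → (e a : ℕ) < e b := by
  constructor
  · intro a b hab hlt
    refine hs.lt_iff_lt.1 (lt_of_children (by omega) hD (u := a / 3 + 1) (i := a % 3 + 1)
      (j := b % 3 + 1) (by omega) ?_ (by omega) ?_ ?_)
    · have : (a : ℕ) < b := hlt
      omega
    · rw [he, child]
      omega
    · rw [he, child]
      omega
  · intro a b hab hlt
    refine hs.lt_iff_lt.1 (lt_of_grandchildren (by omega) hD (u := 0) (i := a / 3 + 1)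
      (j := b / 3 + 1) (t := a % 3 + 1) (by rw [layer_zero]) (by omega) ?_ (by omega) (by omega)
      (by omega) ?_ ?_)
    · have : (a : ℕ) < b := hlt
      omega
    · rw [he, child, child]
      omega
    · rw [he, child, child]
      omega

/-- Two corners of the array are forced; the bounds on the other entries of the outer rows come from
counting the entries above and below them. For instance five entries exceed `e 1`. Only necessary
conditions are kept. -/
theorem ternaryLabels {D : Configuration (chipCount 3 3)} (hD : D ∈ tOrderings 3 3)
    {s : Fin 9 → Fin (chipCount 3 3)} {e : Fin 9 → Fin 9} (hs : StrictMono s)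
    (he : ∀ i, D (s (e i)) = 4 + i) (hb : Function.Bijective e) :
    (e 0 = 0 ∧ e 8 = 8) ∧ TernaryLabels (e 1, e 2, e 6, e 7) := by
  obtain ⟨hrow, hcol⟩ := labels_lt hD hs he
  have hne : ∀ a b : Fin 9, a ≠ b → (e a : ℕ) ≠ e b := fun a b h h' => h (hb.1 (Fin.ext h'))
  have r1 := hrow 0 1 (by decide) (by decide)
  have r2 := hrow 1 2 (by decide) (by decide)
  have r3 := hrow 3 4 (by decide) (by decide)
  have r4 := hrow 4 5 (by decide) (by decide)
  have r5 := hrow 6 7 (by decide) (by decide)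
  have r6 := hrow 7 8 (by decide) (by decide)
  have c1 := hcol 0 3 (by decide) (by decide)
  have c2 := hcol 3 6 (by decide) (by decide)
  have c3 := hcol 1 4 (by decide) (by decide)
  have c4 := hcol 4 7 (by decide) (by decide)
  have c5 := hcol 2 5 (by decide) (by decide)
  have c6 := hcol 5 8 (by decide) (by decide)
  have hmin : ∀ i, (e 0 : ℕ) ≤ e i := by
    intro i
    fin_cases i <;> simp only [Fin.reduceFinMk, Fin.mk_one, Fin.zero_eta] <;> omega
  have hmax : ∀ i, (e i : ℕ) ≤ e 8 := by
    intro i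
    fin_cases i <;> simp only [Fin.reduceFinMk, Fin.mk_one, Fin.zero_eta] <;> omega
  have h0 : e 0 = 0 := by
    obtain ⟨i, hi⟩ := hb.2 0
    have := hmin i
    rw [hi] at this
    exact Fin.ext (Nat.le_zero.1 this)
  have h8 : e 8 = 8 := by
    obtain ⟨i, hi⟩ := hb.2 8
    have := hmax i
    rw [hi] at this
    exact Fin.ext (le_antisymm (Nat.le_of_lt_succ (e 8).2) this)
  have n1 := hne 2 4 (by decide)
  have n2 := hne 2 7 (by decide)
  have n3 := hne 5 7 (by decide)
  have n4 := hne 1 3 (by decide)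
  have n5 := hne 1 6 (by decide)
  have n6 := hne 4 6 (by decide)
  have l8 := (e 8).2
  refine ⟨⟨h0, h8⟩, ?_⟩
  simp only [TernaryLabels, Fin.lt_def]
  refine ⟨⟨?_, ?_⟩, ⟨r2, ?_⟩, ⟨?_, r5⟩, ⟨?_, ?_⟩, hb.1.ne (by decide), hb.1.ne (by decide),
    hb.1.ne (by decide), hb.1.ne (by decide)⟩
  · change 0 < (e 1 : ℕ)
    omega
  · change (e 1 : ℕ) < 4
    clear hmin hmax h0 h8 n4 n5 n6
    omega
  · change (e 2 : ℕ) < 7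
    omega
  · change 1 < (e 6 : ℕ)
    omega
  · change 4 < (e 7 : ℕ)
    clear hmin hmax h0 h8 n1 n2 n3
    omega
  · change (e 7 : ℕ) < 8
    omega

theorem le_mul_of_le_mul_of_mul_le {a w x y z : ℕ} (h1 : a ≤ w * z) (h2 : w * y ≤ x) :
    a * y ≤ z * x :=
  calc a * y ≤ w * z * y := Nat.mul_le_mul_right _ h1
    _ = z * (w * y) := by ring
    _ ≤ z * x := Nat.mul_le_mul_left _ h2

/-- `0` for the root, `1` for its children, and `2` for the leaves of three layers. -/
def layerLetter (w : ℕ) : Fin 3 := if w = 0 then 0 else if w < 4 then 1 else 2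

/-- An ordering is determined by the layer of each chip and the outer rows of the leaf array: the
middle row is what remains, and rows are sorted. There are at most `13! / (3! 9!)` layer words and
`79` choices of outer rows. -/
theorem ncard_tOrderings_three_three_mul_le :
    (tOrderings 3 3).ncard * (Nat.factorial 3 * Nat.factorial 9) ≤ 79 * Nat.factorial 13 := by
  classical
  choose s e hs hr he hb using fun D : tOrderings 3 3 => exists_leaf_labels D.2
  have h1 := card_content_mul_le (α := Fin (chipCount 3 3)) (![1, 3, 9] : Fin 3 → ℕ)
  have h13 : Fintype.card (Fin (chipCount 3 3)) = 13 := by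
    rw [Fintype.card_fin, chipCount_three_three]
  rw [h13, Fin.prod_univ_three] at h1
  simp only [Matrix.cons_val_zero, Matrix.cons_val_one, Matrix.cons_val, Nat.factorial_one,
    one_mul] at h1
  have h2 : (tOrderings 3 3).ncard ≤
      Nat.card {A : Fin (chipCount 3 3) → Fin 3 // Content (![1, 3, 9] : Fin 3 → ℕ) A} * 79 := by
    rw [← card_ternaryLabels, ← Nat.card_eq_fintype_card (α := {p // TernaryLabels p}),
      ← Nat.card_coe_set_eq, ← Nat.card_prod]
    refine Nat.card_le_card_of_injective (fun D => (⟨fun c => layerLetter (D.1 c), ?_⟩,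
      ⟨_, (ternaryLabels D.2 (hs D) (he D) (hb D)).2⟩)) ?_
    · intro i
      refine (card_filter_of_mem_tOrderings (by omega) D.2 fun w => layerLetter w = i).trans ?_
      rw [chipCount_three_three]
      revert i
      decide
    · intro D D' h
      simp only [Prod.mk.injEq, Subtype.mk.injEq] at h
      obtain ⟨hw, h1, h2, h6, h7⟩ := h
      replace hw : ∀ c, layerLetter (D.1 c) = layerLetter (D'.1 c) :=
        congrFun (congrArg Subtype.val hw)
      have hlw : ∀ w, layerLetter w = 2 ↔ 4 ≤ w := by
        intro w
        unfold layerLetter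
        split_ifs <;> simp <;> omega
      have hss : s D = s D' := by
        refine (StrictMono.range_inj (hs D) (hs D')).1 ?_
        ext c
        rw [hr, hr, ← hlw, ← hlw, hw]
      obtain ⟨⟨h0, h8⟩, -⟩ := ternaryLabels D.2 (hs D) (he D) (hb D)
      obtain ⟨⟨h0', h8'⟩, -⟩ := ternaryLabels D'.2 (hs D') (he D') (hb D')
      have hee : ∀ i : Fin 9, (i : ℕ) / 3 ≠ 1 → e D i = e D' i := by
        intro i hi
        fin_cases i <;> first | assumption | (exact absurd rfl hi) | skip
        · exact h0.trans h0'.symm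
        · exact h8.trans h8'.symm
      apply Subtype.ext
      refine eq_of_family_eq (by omega) D.2 D'.2 fun c => ?_
      by_cases hc : 4 ≤ D.1 c
      · obtain ⟨a, rfl⟩ := (hr D c).2 hc
        obtain ⟨i, rfl⟩ := (hb D).2 a
        obtain ⟨i', hi'⟩ := (hb D').2 (e D i)
        have h3 := he D' i'
        rw [hi', ← hss] at h3
        rw [he, h3]
        -- A leaf outside the middle row of either ordering is the same in both; two leaves of the
        -- middle row belong to the same family.
        by_cases hi : (i : ℕ) / 3 = 1
        · by_cases hi1 : (i' : ℕ) / 3 = 1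
          · simp only [family, parent]
            rw [if_neg (by omega), if_neg (by omega)]
            omega
          · rw [← hee i' hi1] at hi'
            rw [(hb D).1 hi']
        · rw [hee i hi] at hi'
          rw [(hb D').1 hi']
      · have h3 := hw c
        unfold layerLetter at h3
        unfold family parent
        split_ifs at h3 ⊢ <;> omega
  exact le_mul_of_le_mul_of_mul_le h2 h1

end SmallCases

/-! ### Growth of the zigzag numbers. -/

section Zigzag

/-- Alternating words. -/
def Alternating {n : ℕ} (f : Fin n → Fin n) : Prop :=
  ∀ (i : ℕ) (h : i + 1 < n),
    if Even i then f ⟨i, by omega⟩ < f ⟨i + 1, h⟩ else f ⟨i + 1, h⟩ < f ⟨i, by omega⟩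

theorem zigzagNumber_eq (n : ℕ) :
    zigzagNumber n = Nat.card {σ : Equiv.Perm (Fin n) // Alternating σ} := rfl

/-- The word with `r` appended, after the letters from `r` on have been raised. -/
def append {p : ℕ} (σ : Fin (p + 1) → Fin (p + 1)) (r : Fin (p + 2)) (i : Fin (p + 2)) :
    Fin (p + 2) := if h : (i : ℕ) < p + 1 then r.succAbove (σ ⟨i, h⟩) else r

theorem append_injective {p : ℕ} {σ : Fin (p + 1) → Fin (p + 1)} (hσ : Function.Injective σ)
    (r : Fin (p + 2)) : Function.Injective (append σ r) := by
  intro i j h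
  unfold append at h
  split_ifs at h with hi hj hj
  · have := Fin.ext_iff.1 (hσ (Fin.succAbove_right_injective h))
    exact Fin.ext this
  · exact absurd h (Fin.succAbove_ne r _)
  · exact absurd h.symm (Fin.succAbove_ne r _)
  · exact Fin.ext (by omega)

theorem append_lt_append {p : ℕ} (σ : Fin (p + 1) → Fin (p + 1)) (r : Fin (p + 2)) {i j : ℕ}
    (hi : i < p + 1) (hj : j < p + 1) :
    append σ r ⟨i, by omega⟩ < append σ r ⟨j, by omega⟩ ↔ σ ⟨i, hi⟩ < σ ⟨j, hj⟩ := by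
  unfold append
  rw [dif_pos hi, dif_pos hj]
  exact (Fin.strictMono_succAbove r).lt_iff_lt

/-- The last two letters are in the right order. -/
def LastTwo {p : ℕ} (f : Fin (p + 2) → Fin (p + 2)) : Prop :=
  if Even p then f ⟨p, by omega⟩ < f ⟨p + 1, by omega⟩ else f ⟨p + 1, by omega⟩ < f ⟨p, by omega⟩

theorem alternating_append {p : ℕ} {σ : Fin (p + 1) → Fin (p + 1)} (hσ : Alternating σ)
    (r : Fin (p + 2)) (h : LastTwo (append σ r)) : Alternating (append σ r) := by
  intro i hi
  by_cases hip : i = p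
  · subst hip
    exact h
  · have := hσ i (by omega)
    rwa [append_lt_append σ r (by omega) (by omega), append_lt_append σ r (by omega) (by omega)]

/-- If the last comparison fails, exchanging the last two letters repairs it. It also moves the
letter at place `p` further in the direction required by its predecessor. -/
theorem alternating_append_swap {p : ℕ} {σ : Fin (p + 1) → Fin (p + 1)}
    (hinj : Function.Injective σ) (hσ : Alternating σ)
    (r : Fin (p + 2)) (h : ¬ LastTwo (append σ r)) :
    Alternating (append σ r ∘ Equiv.swap ⟨p, by omega⟩ ⟨p + 1, by omega⟩) := by
  have hne : append σ r ⟨p, by omega⟩ ≠ append σ r ⟨p + 1, by omega⟩ := fun h => by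
    have := Fin.ext_iff.1 (append_injective hinj r h)
    simp at this
  have h' : if Even p then append σ r ⟨p + 1, by omega⟩ < append σ r ⟨p, by omega⟩
      else append σ r ⟨p, by omega⟩ < append σ r ⟨p + 1, by omega⟩ := by
    unfold LastTwo at h
    split_ifs at h ⊢
    · exact lt_of_le_of_ne (not_lt.1 h) hne.symm
    · exact lt_of_le_of_ne (not_lt.1 h) hne
  intro i hi
  have hsw : ∀ (j : ℕ) (hj : j < p + 2), j < p → (append σ r ∘ Equiv.swap (⟨p, by omega⟩ :
      Fin (p + 2)) ⟨p + 1, by omega⟩) ⟨j, hj⟩ = append σ r ⟨j, hj⟩ := fun j hj hjp => by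
    rw [Function.comp_apply, Equiv.swap_apply_of_ne_of_ne]
    · exact fun h => by simp at h; omega
    · exact fun h => by simp at h; omega
  by_cases hip : i = p
  · subst hip
    rw [Function.comp_apply, Function.comp_apply, Equiv.swap_apply_left, Equiv.swap_apply_right]
    exact h'
  · rw [hsw i _ (by omega)]
    by_cases hip' : i + 1 = p
    · subst hip'
      rw [Function.comp_apply, Equiv.swap_apply_left]
      have := hσ i (by omega)
      rw [← append_lt_append σ r (by omega) (by omega),
        ← append_lt_append σ r (by omega) (by omega)] at this
      simp only [Nat.even_add_one] at h'
      split_ifs at h' this ⊢ with he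
      · exact this.trans h'
      · exact h'.trans this
    · rw [hsw (i + 1) _ (by omega)]
      have := hσ i (by omega)
      rwa [append_lt_append σ r (by omega) (by omega), append_lt_append σ r (by omega) (by omega)]

/-- Append any of the `p + 2` letters to an alternating word and swap the last two letters if
necessary. The result, together with one bit recording the swap, determines the appended letter and
the word. -/
theorem succ_mul_zigzagNumber_le (p : ℕ) :
    (p + 2) * zigzagNumber (p + 1) ≤ 2 * zigzagNumber (p + 2) := by
  classical
  have h1 : ∀ x : Fin (p + 2) × {σ : Equiv.Perm (Fin (p + 1)) // Alternating σ},
      ∃ y : Bool × {σ : Equiv.Perm (Fin (p + 2)) // Alternating σ},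
        append x.2.1 x.1 = fun i => if y.1 then y.2.1 i
          else y.2.1 (Equiv.swap ⟨p, by omega⟩ ⟨p + 1, by omega⟩ i) := by
    rintro ⟨r, σ, hσ⟩
    by_cases h : LastTwo (append σ r)
    · exact ⟨⟨true, Equiv.ofBijective _ (Finite.injective_iff_bijective.1
        (append_injective σ.injective r)), alternating_append hσ r h⟩, by simp⟩
    · exact ⟨⟨false, (Equiv.swap (⟨p, by omega⟩ : Fin (p + 2)) ⟨p + 1, by omega⟩).trans
        (Equiv.ofBijective _ (Finite.injective_iff_bijective.1 (append_injective σ.injective r))),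
        alternating_append_swap σ.injective hσ r h⟩, by simp⟩
  choose f hf using h1
  have h2 : Nat.card (Fin (p + 2) × {σ : Equiv.Perm (Fin (p + 1)) // Alternating σ}) =
      (p + 2) * zigzagNumber (p + 1) := by rw [Nat.card_prod, Nat.card_fin, zigzagNumber_eq]
  have h3 : Nat.card (Bool × {σ : Equiv.Perm (Fin (p + 2)) // Alternating σ}) =
      2 * zigzagNumber (p + 2) := by
    rw [Nat.card_prod, zigzagNumber_eq, Nat.card_eq_fintype_card (α := Bool), Fintype.card_bool]
  rw [← h2, ← h3]
  refine Nat.card_le_card_of_injective f ?_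
  rintro ⟨r, σ, hσ⟩ ⟨r', σ', hσ'⟩ h
  have h4 : append σ r = append σ' r' := (hf (r, ⟨σ, hσ⟩)).trans (by rw [h, ← hf])
  have hr : r = r' := by simpa [append] using congrFun h4 (Fin.last _)
  subst hr
  refine Prod.ext rfl (Subtype.ext (Equiv.ext fun i => ?_))
  have := congrFun h4 i.castSucc
  simp only [append, Fin.val_castSucc, i.2, dif_pos] at this
  exact Fin.succAbove_right_injective this

theorem zigzagNumber_one : zigzagNumber 1 = 1 := by
  rw [zigzagNumber_eq, Nat.card_eq_one_iff_unique]
  exact ⟨inferInstance, ⟨1, fun i h => absurd h (by omega)⟩⟩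

theorem zigzagNumber_pos (p : ℕ) : 0 < zigzagNumber (p + 1) := by
  induction p with
  | zero => rw [zigzagNumber_one]; exact one_pos
  | succ p ih =>
    have h1 := succ_mul_zigzagNumber_le p
    have h2 : 0 < (p + 2) * zigzagNumber (p + 1) := by positivity
    change 0 < zigzagNumber (p + 2)
    omega

theorem two_le_zigzagNumber_three : 2 ≤ zigzagNumber 3 := by
  have h1 := succ_mul_zigzagNumber_le 1
  have h2 := zigzagNumber_pos 1
  norm_num at h1 h2
  omega

end Zigzag

/-! ### The numbers `beta` and their ratios. -/

section Beta

variable {k : ℕ}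

theorem le_chipCount (hk : 2 ≤ k) (l : ℕ) : l ≤ chipCount k l := by
  induction l with
  | zero => exact Nat.zero_le _
  | succ l ih =>
    rw [chipCount_succ hk]
    have : 1 * chipCount k l ≤ k * chipCount k l := Nat.mul_le_mul_right _ (by omega)
    omega

theorem chipCount_pos (hk : 2 ≤ k) (l : ℕ) : 0 < chipCount k (l + 1) := by
  rw [chipCount_succ hk]; omega

theorem add_two_le_chipCount (hk : 2 ≤ k) (l : ℕ) : l + 5 ≤ chipCount k (l + 3) := by
  have h1 := le_chipCount hk (l + 2)
  rw [chipCount_succ hk]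
  have : 2 * chipCount k (l + 2) ≤ k * chipCount k (l + 2) := Nat.mul_le_mul_right _ hk
  omega

theorem factorial_pow_eq {n k : ℕ} (hn : 0 < n) (hk : 2 ≤ k) :
    (n.factorial : ℚ) ^ (k - 1) = n * ((n - 1).factorial * (n.factorial : ℚ) ^ (k - 2)) := by
  obtain ⟨k, rfl⟩ : ∃ j, k = j + 2 := ⟨k - 2, by omega⟩
  obtain ⟨n, rfl⟩ : ∃ j, n = j + 1 := ⟨n - 1, by omega⟩
  simp only [Nat.add_sub_cancel, show k + 2 - 1 = k + 1 by omega]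
  rw [pow_succ, Nat.factorial_succ]
  push_cast
  ring

/-- `beta` without denominators: the binomial coefficient merges with the factorial, and the two
incomplete powers are completed at the cost of the factors N_{t+2} and N_{t+1}. The product is then
uniform in `t`, so consecutive values can be compared. -/
theorem beta_mul (hk : 2 ≤ k) (t : ℕ) :
    beta k (t + 3) * ((t + 3).factorial *
      ∏ i ∈ Finset.Icc 1 (t + 2), ((chipCount k i).factorial : ℚ) ^ (k - 1)) =
      (chipCount k (t + 3) - 2).factorial * zigzagNumber (t + 3) * chipCount k (t + 2) *
        chipCount k (t + 1) := by
  have h1 : ((chipCount k (t + 3) - 2).choose (t + 3) : ℚ) * (t + 3).factorial *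
      (chipCount k (t + 3) - (t + 3) - 2).factorial = (chipCount k (t + 3) - 2).factorial := by
    have h := add_two_le_chipCount hk t
    rw [Nat.sub_right_comm]
    exact_mod_cast Nat.choose_mul_factorial_mul_factorial
      (show t + 3 ≤ chipCount k (t + 3) - 2 by omega)
  rw [Finset.prod_Icc_succ_top (by omega), Finset.prod_Icc_succ_top (by omega),
    factorial_pow_eq (chipCount_pos hk t) hk, factorial_pow_eq (chipCount_pos hk (t + 1)) hk, ← h1,
    beta]
  simp only [show t + 3 - 1 = t + 2 by omega, show t + 3 - 2 = t + 1 by omega,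
    show t + 3 - 3 = t by omega]
  have h2 : ∏ i ∈ Finset.Icc 1 t, ((chipCount k i).factorial : ℚ) ^ (k - 1) ≠ 0 :=
    Finset.prod_ne_zero_iff.2 fun i _ => by positivity
  have h3 : ∀ n : ℕ, (n.factorial : ℚ) ≠ 0 := fun n => by positivity
  have h4 := h3 (chipCount k (t + 2) - 1)
  have h5 := h3 (chipCount k (t + 1) - 1)
  have h6 := h3 (chipCount k (t + 1))
  have h7 := h3 (chipCount k (t + 2))
  field_simp

theorem beta_pos (hk : 2 ≤ k) (t : ℕ) : 0 < beta k (t + 3) := by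
  have h1 := beta_mul hk t
  have h2 : (0 : ℚ) < ∏ i ∈ Finset.Icc 1 (t + 2), ((chipCount k i).factorial : ℚ) ^ (k - 1) :=
    Finset.prod_pos fun i _ => by positivity
  have h3 : (0 : ℚ) < (t + 3).factorial := by positivity
  have h4 : (0 : ℚ) < zigzagNumber (t + 3) := by exact_mod_cast zigzagNumber_pos (t + 2)
  have h5 : (0 : ℚ) < chipCount k (t + 2) := by exact_mod_cast chipCount_pos hk (t + 1)
  have h6 : (0 : ℚ) < chipCount k (t + 1) := by exact_mod_cast chipCount_pos hk t
  have h7 : (0 : ℚ) < (chipCount k (t + 3) - 2).factorial := by positivity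
  have : 0 < beta k (t + 3) * ((t + 3).factorial *
      ∏ i ∈ Finset.Icc 1 (t + 2), ((chipCount k i).factorial : ℚ) ^ (k - 1)) := by
    rw [h1]; positivity
  exact pos_of_mul_pos_left this (by positivity)

/-- The quotient of consecutive `beta k (t + 3)`. -/
theorem beta_succ_mul (hk : 2 ≤ k) (t : ℕ) :
    beta k (t + 3) * ((chipCount k (t + 4) - 2).factorial * chipCount k (t + 3)) ≤
      2 * beta k (t + 4) * ((chipCount k (t + 3)).factorial ^ (k - 1) *
        ((chipCount k (t + 3) - 2).factorial * chipCount k (t + 1))) := by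
  have h1 := beta_mul hk t
  have h2 := beta_mul hk (t + 1)
  have h3 : ((t + 4 : ℕ) : ℚ) * zigzagNumber (t + 3) ≤ 2 * zigzagNumber (t + 4) := by
    exact_mod_cast succ_mul_zigzagNumber_le (t + 2)
  rw [Finset.prod_Icc_succ_top (by omega), Nat.factorial_succ] at h2
  simp only [show t + 1 + 3 = t + 4 by omega, show t + 1 + 2 = t + 3 by omega,
    show t + 1 + 1 = t + 2 by omega, Nat.cast_mul] at h2
  have hP : (0 : ℚ) < ∏ i ∈ Finset.Icc 1 (t + 2), ((chipCount k i).factorial : ℚ) ^ (k - 1) :=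
    Finset.prod_pos fun i _ => by positivity
  have hf : (0 : ℚ) < (t + 3).factorial := by positivity
  have hZ : (0 : ℚ) < zigzagNumber (t + 4) := by exact_mod_cast zigzagNumber_pos (t + 3)
  have hN2 : (0 : ℚ) < chipCount k (t + 2) := by exact_mod_cast chipCount_pos hk (t + 1)
  have ht : (0 : ℚ) < ((t + 4 : ℕ) : ℚ) := by positivity
  generalize ∏ i ∈ Finset.Icc 1 (t + 2), ((chipCount k i).factorial : ℚ) ^ (k - 1) = P at *
  generalize ((t + 3).factorial : ℚ) = f at *
  generalize ((t + 4 : ℕ) : ℚ) = u at *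
  generalize (zigzagNumber (t + 3) : ℚ) = Z at *
  generalize (zigzagNumber (t + 4) : ℚ) = Z' at *
  generalize (chipCount k (t + 2) : ℚ) = n2 at *
  have hn1 : (0 : ℚ) ≤ chipCount k (t + 1) := by positivity
  have hn3 : (0 : ℚ) ≤ chipCount k (t + 3) := by positivity
  generalize (chipCount k (t + 1) : ℚ) = n1 at *
  generalize (chipCount k (t + 3) : ℚ) = n3 at *
  have hF : (0 : ℚ) ≤ (chipCount k (t + 3) - 2).factorial := by positivity
  have hF' : (0 : ℚ) ≤ (chipCount k (t + 4) - 2).factorial := by positivity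
  generalize ((chipCount k (t + 3) - 2).factorial : ℚ) = F at *
  generalize ((chipCount k (t + 4) - 2).factorial : ℚ) = F' at *
  generalize ((chipCount k (t + 3)).factorial : ℚ) ^ (k - 1) = G at *
  -- The multiplier contains `f * P`, common to the two instances of `beta_mul`; what remains is `u
  -- * Z ≤ 2 * Z'`.
  refine le_of_mul_le_mul_right ?_ (show 0 < u * (f * P) * n2 by positivity)
  calc _ = (beta k (t + 3) * (f * P)) * (F' * n3 * u * n2) := by ring
    _ = (F * F' * n1 * n2 * n2 * n3) * (u * Z) := by rw [h1]; ring
    _ ≤ (F * F' * n1 * n2 * n2 * n3) * (2 * Z') := mul_le_mul_of_nonneg_left h3 (by positivity)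
    _ = 2 * (F' * Z' * n3 * n2) * (F * n1) * n2 := by ring
    _ = _ := by rw [← h2]; ring

end Beta

/-! ### The recursion of the bound, and numerical inequalities. -/

section Bound

variable {k : ℕ}

theorem prod_Icc_one_eq_prod_range (f : ℕ → ℚ) (n : ℕ) :
    ∏ i ∈ Finset.Icc 1 n, f i = ∏ i ∈ Finset.range n, f (i + 1) := by
  induction n with
  | zero => simp
  | succ n ih => rw [Finset.prod_Icc_succ_top (by omega), Finset.prod_range_succ, ih]

/-- Raising the bound to the power `k` multiplies every exponent in its product by `k`, as does
passing to the next layer. The leading `beta` gets exponent `k` instead of `k - 1`, which the extra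
factor `beta k (t + 3)` compensates. -/
theorem zigzagBound_succ (hk : 2 ≤ k) (t : ℕ) :
    zigzagBound k (t + 4) * beta k (t + 3) = zigzagBound k (t + 3) ^ k * beta k (t + 4) := by
  obtain ⟨k, rfl⟩ : ∃ j, k = j + 1 := ⟨k - 1, by omega⟩
  rw [zigzagBound, zigzagBound, prod_Icc_one_eq_prod_range, prod_Icc_one_eq_prod_range]
  simp only [show t + 4 - 3 = t + 1 by omega, show t + 3 - 3 = t by omega, Nat.add_sub_cancel]
  rw [Finset.prod_range_succ']
  have h1 : ∏ i ∈ Finset.range t, beta (k + 1) (t + 4 - (i + 1 + 1)) ^ (k * (k + 1) ^ (i + 1)) =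
      (∏ i ∈ Finset.range t, beta (k + 1) (t + 3 - (i + 1)) ^ (k * (k + 1) ^ i)) ^ (k + 1) := by
    rw [← Finset.prod_pow]
    refine Finset.prod_congr rfl fun i _ => ?_
    rw [← pow_mul, mul_assoc, ← pow_succ]
    congr 2
    omega
  rw [h1, pow_succ (k + 1) t, ← mul_assoc k, pow_mul]
  simp only [show t + 4 - (0 + 1) = t + 3 by omega, pow_zero, mul_one, mul_pow]
  ring

theorem zigzagBound_three (k : ℕ) : zigzagBound k 3 = ((k : ℚ) - 1) ^ (k - 1) * beta k 3 := by
  simp [zigzagBound]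

theorem zigzagBound_pos (hk : 2 ≤ k) (t : ℕ) : 0 < zigzagBound k (t + 3) := by
  induction t with
  | zero =>
    have h1 : (2 : ℚ) ≤ k := by exact_mod_cast hk
    have h2 : (0 : ℚ) < (k : ℚ) - 1 := by linarith
    have h3 := beta_pos hk 0
    rw [zigzagBound_three]
    positivity
  | succ t ih =>
    have h1 := zigzagBound_succ hk t
    have h2 := beta_pos hk t
    have h3 := beta_pos hk (t + 1)
    have h4 : 0 < zigzagBound k (t + 4) * beta k (t + 3) := by
      rw [h1]
      have : 0 < beta k (t + 4) := h3
      positivity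
    exact pos_of_mul_pos_left h4 h2.le

/-- The ratios of consecutive chip counts decrease towards `k`. -/
theorem chipCount_succ_mul_le (hk : 2 ≤ k) (l : ℕ) :
    chipCount k (l + 3) * chipCount k l ≤ chipCount k (l + 2) * chipCount k (l + 1) := by
  rw [chipCount_succ hk (l + 2), chipCount_succ hk (l + 1), chipCount_succ hk l]
  nlinarith [Nat.zero_le (chipCount k l), Nat.zero_le (k * chipCount k l),
    Nat.zero_le (k * (k * chipCount k l)), Nat.mul_le_mul_right (chipCount k l) hk]

theorem factorial_eq_mul_sub_two {n : ℕ} (hn : 2 ≤ n) :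
    (n.factorial : ℚ) = n * (n - 1) * (n - 2).factorial := by
  obtain ⟨n, rfl⟩ : ∃ j, n = j + 2 := ⟨n - 2, by omega⟩
  rw [Nat.factorial_succ, Nat.factorial_succ, Nat.add_sub_cancel]
  push_cast
  ring

theorem factorial_sub_one_eq {n : ℕ} (hn : 2 ≤ n) :
    ((n - 1).factorial : ℚ) = (n - 1) * (n - 2).factorial := by
  obtain ⟨n, rfl⟩ : ∃ j, n = j + 2 := ⟨n - 2, by omega⟩
  rw [show n + 2 - 1 = n + 1 by omega, Nat.factorial_succ, Nat.add_sub_cancel]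
  push_cast
  ring

theorem chipCount_succ_cast (hk : 2 ≤ k) (l : ℕ) :
    (chipCount k (l + 1) : ℚ) = k * chipCount k l + 1 := by
  rw [chipCount_succ hk]; push_cast; ring

/-- The factor by which the word count exceeds what one step of the bound provides is at most `2`.
-/
theorem factorial_mul_beta_le (hk : 2 ≤ k) (t : ℕ) :
    ((chipCount k (t + 4)).factorial : ℚ) * beta k (t + 3) ≤
      2 * beta k (t + 4) * ((chipCount k (t + 3)).factorial : ℚ) ^ k := by
  have h1 := beta_succ_mul hk t
  have h2 := add_two_le_chipCount hk t
  have h3 := add_two_le_chipCount hk (t + 1)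
  have h4 : (chipCount k (t + 4) : ℚ) * chipCount k (t + 1) ≤
      chipCount k (t + 3) * chipCount k (t + 2) := by
    exact_mod_cast chipCount_succ_mul_le hk (t + 1)
  have hb := beta_pos hk t
  have hn1 : (0 : ℚ) < chipCount k (t + 1) := by exact_mod_cast chipCount_pos hk t
  have e4 : (chipCount k (t + 4) : ℚ) - 1 = k * chipCount k (t + 3) := by
    rw [chipCount_succ_cast hk (t + 3)]; ring
  have e3 : (chipCount k (t + 3) : ℚ) - 1 = k * chipCount k (t + 2) := by
    rw [chipCount_succ_cast hk (t + 2)]; ring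
  have hpow : ((chipCount k (t + 3)).factorial : ℚ) ^ k =
      ((chipCount k (t + 3)).factorial : ℚ) ^ (k - 1) * (chipCount k (t + 3)).factorial := by
    rw [← pow_succ]
    congr 1
    omega
  rw [hpow, factorial_eq_mul_sub_two (show 2 ≤ chipCount k (t + 4) by
    rw [show t + 4 = t + 1 + 3 by omega]; omega), e4]
  have hfac := factorial_eq_mul_sub_two (show 2 ≤ chipCount k (t + 3) by omega)
  rw [e3] at hfac
  have hF' : (0 : ℚ) < (chipCount k (t + 4) - 2).factorial := by positivity
  have hn3 : (0 : ℚ) ≤ chipCount k (t + 3) := by positivity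
  have hn2 : (0 : ℚ) ≤ chipCount k (t + 2) := by positivity
  have hk0 : (0 : ℚ) ≤ k := by positivity
  generalize ((chipCount k (t + 3)).factorial : ℚ) ^ (k - 1) = G at *
  rw [hfac]
  generalize ((chipCount k (t + 4) - 2).factorial : ℚ) = F' at *
  generalize ((chipCount k (t + 3) - 2).factorial : ℚ) = F at *
  generalize (chipCount k (t + 1) : ℚ) = n1 at *
  generalize (chipCount k (t + 2) : ℚ) = n2 at *
  generalize (chipCount k (t + 3) : ℚ) = n3 at *
  generalize (chipCount k (t + 4) : ℚ) = n4 at *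
  generalize beta k (t + 3) = b at *
  generalize beta k (t + 4) = b' at *
  refine le_of_mul_le_mul_right ?_ hn1
  calc _ = (k * n3 * F' * b) * (n4 * n1) := by ring
    _ ≤ (k * n3 * F' * b) * (n3 * n2) := mul_le_mul_of_nonneg_left h4 (by positivity)
    _ = (b * (F' * n3)) * (k * n3 * n2) := by ring
    _ ≤ (2 * b' * (G * (F * n1))) * (k * n3 * n2) := mul_le_mul_of_nonneg_right h1 (by positivity)
    _ = _ := by ring

/-- Prescribing one letter multiplies the word count by N_{t+3} / N_{t+4}, slightly less than one
half, which cancels the factor `2` of `beta_succ_mul`. -/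
theorem factorial_mul_beta_two_le (t : ℕ) :
    ((chipCount 2 (t + 4) - 1).factorial : ℚ) * beta 2 (t + 3) ≤
      beta 2 (t + 4) * ((chipCount 2 (t + 3)).factorial * (chipCount 2 (t + 3) - 1).factorial) := by
  have h1 := beta_succ_mul (k := 2) le_rfl t
  have h2 := add_two_le_chipCount (k := 2) le_rfl t
  have h3 := add_two_le_chipCount (k := 2) le_rfl (t + 1)
  have hb := beta_pos (k := 2) le_rfl t
  have hn1 : (0 : ℚ) < chipCount 2 (t + 1) := by exact_mod_cast chipCount_pos le_rfl t
  have e4 : (chipCount 2 (t + 4) : ℚ) - 1 = 2 * chipCount 2 (t + 3) := by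
    rw [chipCount_succ_cast le_rfl (t + 3)]; push_cast; ring
  have e3 : (chipCount 2 (t + 3) : ℚ) - 1 = 4 * chipCount 2 (t + 1) + 2 := by
    rw [chipCount_succ_cast le_rfl (t + 2), chipCount_succ_cast le_rfl (t + 1)]; push_cast; ring
  rw [factorial_sub_one_eq (show 2 ≤ chipCount 2 (t + 4) by
    rw [show t + 4 = t + 1 + 3 by omega]; omega), e4,
    factorial_sub_one_eq (show 2 ≤ chipCount 2 (t + 3) by omega), e3]
  have hF' : (0 : ℚ) < (chipCount 2 (t + 4) - 2).factorial := by positivity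
  have hn3 : (0 : ℚ) ≤ chipCount 2 (t + 3) := by positivity
  norm_num at h1
  generalize ((chipCount 2 (t + 3)).factorial : ℚ) = G at *
  generalize ((chipCount 2 (t + 4) - 2).factorial : ℚ) = F' at *
  generalize ((chipCount 2 (t + 3) - 2).factorial : ℚ) = F at *
  generalize (chipCount 2 (t + 1) : ℚ) = n1 at *
  generalize (chipCount 2 (t + 3) : ℚ) = n3 at *
  generalize beta 2 (t + 3) = b at *
  generalize beta 2 (t + 4) = b' at *
  refine le_of_mul_le_mul_right ?_ hn1
  have h5 : 0 ≤ b * (F' * n3) := by positivity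
  calc _ = (b * (F' * n3)) * (2 * n1) := by ring
    _ ≤ (b * (F' * n3)) * (2 * n1 + 1) := mul_le_mul_of_nonneg_left (by linarith) h5
    _ ≤ (2 * b' * (G * (F * n1))) * (2 * n1 + 1) := mul_le_mul_of_nonneg_right h1 (by linarith)
    _ = _ := by ring

/-- `beta_mul` for three layers with `A_3 ≥ 2`; the constant `3` is `3! / 2`. -/
theorem beta_three_mul_ge (hk : 2 ≤ k) :
    ((chipCount k 3 - 2).factorial : ℚ) * (k + 1) ≤
      beta k 3 * (3 * ((k + 1).factorial : ℚ) ^ (k - 1)) := by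
  have h1 := beta_mul hk 0
  have h2 : (2 : ℚ) ≤ zigzagNumber 3 := by exact_mod_cast two_le_zigzagNumber_three
  rw [Finset.prod_Icc_succ_top (by omega), Finset.prod_Icc_succ_top (by omega)] at h1
  simp only [zero_add, chipCount_one hk, chipCount_two hk] at h1
  norm_num [Nat.factorial] at h1
  have h3 : ((k + 1).factorial : ℚ) = (k + 1) * k.factorial := by
    rw [Nat.factorial_succ]; push_cast; ring
  rw [← h3] at h1
  have h4 : (0 : ℚ) ≤ (chipCount k 3 - 2).factorial * (k + 1) := by positivity
  nlinarith [mul_le_mul_of_nonneg_left h2 h4]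

theorem factorial_bound (t : ℕ) : 6 * 2 ^ (t + 2) ≤ (t + 4).factorial ∧
    2 * ((t + 4) * (t + 3)) ≤ (t + 4).factorial := by
  constructor
  · induction t with
    | zero => decide
    | succ t ih =>
      rw [show t + 1 + 4 = (t + 4) + 1 by omega, Nat.factorial_succ]
      calc 6 * 2 ^ (t + 1 + 2) = 2 * (6 * 2 ^ (t + 2)) := by ring
        _ ≤ (t + 4 + 1) * (t + 4).factorial := Nat.mul_le_mul (by omega) ih
  · rw [Nat.factorial_succ, Nat.factorial_succ]
    have : 2 ≤ (t + 2).factorial := Nat.factorial_le (show 2 ≤ t + 2 by omega)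
    calc 2 * ((t + 4) * (t + 3)) = (t + 4) * ((t + 3) * 2) := by ring
      _ ≤ (t + 3 + 1) * ((t + 2 + 1) * (t + 2).factorial) := by gcongr

/-- With `k = t + 4` and N = k² + k + 1, this is what remains of 3 T ≤ 2 B at three layers after
inserting T ≤ N! / k!^(k+2) and the lower bound for `beta k 3`. -/
theorem pow_mul_le_pow_mul_factorial (t : ℕ) :
    9 * (((t + 4) ^ 2 + (t + 4) + 1) * ((t + 4) ^ 2 + (t + 4))) * (t + 5) ^ (t + 2) ≤
      2 * (t + 3) ^ (t + 3) * (t + 4).factorial ^ 3 := by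
  obtain ⟨h1, h2⟩ := factorial_bound t
  have h3 : (t + 5) ^ (t + 2) ≤ 2 ^ (t + 2) * (t + 3) ^ (t + 2) := by
    rw [← mul_pow]
    exact Nat.pow_le_pow_left (by omega) _
  calc _ ≤ 9 * (((t + 4) ^ 2 + (t + 4) + 1) * ((t + 4) ^ 2 + (t + 4))) *
        (2 ^ (t + 2) * (t + 3) ^ (t + 2)) := Nat.mul_le_mul_left _ h3
    _ = 9 * (((t + 4) ^ 2 + (t + 4) + 1) * ((t + 4) ^ 2 + (t + 4))) * 2 ^ (t + 2) *
        (t + 3) ^ (t + 2) := by ring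
    _ ≤ 2 * (t + 3) * (6 * 2 ^ (t + 2)) * (2 * ((t + 4) * (t + 3))) ^ 2 * (t + 3) ^ (t + 2) := by
      refine Nat.mul_le_mul_right _ ?_
      calc _ ≤ 48 * ((t + 4) ^ 2 * (t + 3) ^ 3) * 2 ^ (t + 2) := by
            refine Nat.mul_le_mul_right _ ?_
            ring_nf
            nlinarith [Nat.zero_le t, Nat.zero_le (t ^ 2), Nat.zero_le (t ^ 3), Nat.zero_le (t ^ 4),
              Nat.zero_le (t ^ 5)]
        _ = _ := by ring
    _ ≤ 2 * (t + 3) * (t + 4).factorial * (t + 4).factorial ^ 2 * (t + 3) ^ (t + 2) := by gcongr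
    _ = _ := by ring

end Bound

/-! ### The induction on the number of layers. -/

section Main

variable {k : ℕ}

/-- The lower bound on `beta 2 3` is `5! * 3 / (3 * 6) = 20`, just the count of the base case: there
is no slack at the start, and none is lost later. -/
theorem ncard_tOrderings_two_le (t : ℕ) :
    ((tOrderings 2 (t + 3)).ncard : ℚ) ≤ zigzagBound 2 (t + 3) := by
  induction t with
  | zero =>
    have h1 := beta_three_mul_ge (k := 2) le_rfl
    have h2 : ((tOrderings 2 3).ncard : ℚ) ≤ 20 := by exact_mod_cast ncard_tOrderings_two_three_le
    rw [zigzagBound_three]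
    rw [chipCount_two_three] at h1
    norm_num [Nat.factorial] at h1 ⊢
    linarith
  | succ t ih =>
    have h1 : ((tOrderings 2 (t + 4)).ncard : ℚ) * ((chipCount 2 (t + 3)).factorial *
        (chipCount 2 (t + 3) - 1).factorial) ≤
        (chipCount 2 (t + 4) - 1).factorial * (tOrderings 2 (t + 3)).ncard ^ 2 := by
      exact_mod_cast ncard_tOrderings_two_succ_mul_le (t + 2)
    have h2 := factorial_mul_beta_two_le t
    have h3 := zigzagBound_succ (k := 2) le_rfl t
    have hb := beta_pos (k := 2) le_rfl t
    have hsq : ((tOrderings 2 (t + 3)).ncard : ℚ) ^ 2 ≤ zigzagBound 2 (t + 3) ^ 2 :=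
      pow_le_pow_left₀ (by positivity) ih 2
    have hG : (0 : ℚ) < (chipCount 2 (t + 3)).factorial * (chipCount 2 (t + 3) - 1).factorial := by
      positivity
    have hF : (0 : ℚ) ≤ (chipCount 2 (t + 4) - 1).factorial := by positivity
    change ((tOrderings 2 (t + 4)).ncard : ℚ) ≤ zigzagBound 2 (t + 4)
    generalize ((chipCount 2 (t + 3)).factorial * (chipCount 2 (t + 3) - 1).factorial : ℚ) = G at *
    generalize ((chipCount 2 (t + 4) - 1).factorial : ℚ) = F at *
    refine le_of_mul_le_mul_right ?_ (mul_pos hb hG)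
    calc _ = ((tOrderings 2 (t + 4)).ncard : ℚ) * G * beta 2 (t + 3) := by ring
      _ ≤ F * (tOrderings 2 (t + 3)).ncard ^ 2 * beta 2 (t + 3) :=
        mul_le_mul_of_nonneg_right h1 hb.le
      _ ≤ F * zigzagBound 2 (t + 3) ^ 2 * beta 2 (t + 3) := by gcongr
      _ = zigzagBound 2 (t + 3) ^ 2 * (F * beta 2 (t + 3)) := by ring
      _ ≤ zigzagBound 2 (t + 3) ^ 2 * (beta 2 (t + 4) * G) :=
        mul_le_mul_of_nonneg_left h2 (by positivity)
      _ = (zigzagBound 2 (t + 3) ^ 2 * beta 2 (t + 4)) * G := by ring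
      _ = _ := by rw [← h3]; ring

/-- `225940 = 79 * 13! / (3! * 9!)`, against two thirds of a bound that is at least `4 * 92400`. -/
theorem three_mul_ncard_tOrderings_three_three_le :
    3 * ((tOrderings 3 3).ncard : ℚ) ≤ 2 * zigzagBound 3 3 := by
  have h1 := beta_three_mul_ge (k := 3) (by omega)
  have h2 : (tOrderings 3 3).ncard ≤ 225940 := by
    refine Nat.le_of_mul_le_mul_right (ncard_tOrderings_three_three_mul_le.trans (le_of_eq ?_))
      (by positivity : 0 < Nat.factorial 3 * Nat.factorial 9)
    simp only [Nat.factorial]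
  have h2' : ((tOrderings 3 3).ncard : ℚ) ≤ 225940 := by exact_mod_cast h2
  rw [zigzagBound_three]
  rw [chipCount_three_three] at h1
  norm_num [Nat.factorial] at h1 ⊢
  linarith

theorem three_mul_ncard_tOrderings_three_le (t : ℕ) :
    3 * ((tOrderings (t + 4) 3).ncard : ℚ) ≤ 2 * zigzagBound (t + 4) 3 := by
  have h1 := beta_three_mul_ge (k := t + 4) (by omega)
  have h2 : ((tOrderings (t + 4) 3).ncard : ℚ) * ((t + 4).factorial : ℚ) ^ (t + 6) ≤
      (chipCount (t + 4) 3).factorial := by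
    exact_mod_cast ncard_tOrderings_three_mul_le (k := t + 4) (by omega)
  have h3 : 9 * ((((t : ℚ) + 4) ^ 2 + (t + 4) + 1) * ((t + 4) ^ 2 + (t + 4))) * (t + 5) ^ (t + 2) ≤
      2 * (t + 3) ^ (t + 3) * ((t + 4).factorial : ℚ) ^ 3 := by
    exact_mod_cast pow_mul_le_pow_mul_factorial t
  have hN : (chipCount (t + 4) 3 : ℚ) = (t + 4) ^ 2 + (t + 4) + 1 := by
    rw [chipCount_succ_cast (by omega), chipCount_two (by omega)]; push_cast; ring
  have hN2 : 5 ≤ chipCount (t + 4) 3 := add_two_le_chipCount (by omega) 0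
  rw [factorial_eq_mul_sub_two (n := chipCount (t + 4) 3) (by omega), hN] at h2
  have hfac : ((t + 4 + 1).factorial : ℚ) = (t + 5) * (t + 4).factorial := by
    rw [Nat.factorial_succ]; push_cast; ring
  rw [hfac, show t + 4 - 1 = t + 3 by omega] at h1
  rw [zigzagBound_three, show t + 4 - 1 = t + 3 by omega]
  push_cast at h1 ⊢
  have ht : (0 : ℚ) ≤ t := by positivity
  have hf : (0 : ℚ) < (t + 4).factorial := by positivity
  have hF : (0 : ℚ) < (chipCount (t + 4) 3 - 2).factorial := by positivity
  generalize ((t + 4).factorial : ℚ) = f at *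
  generalize ((chipCount (t + 4) 3 - 2).factorial : ℚ) = F at *
  generalize ((tOrderings (t + 4) 3).ncard : ℚ) = T at *
  generalize beta (t + 4) 3 = b at *
  rw [show (t : ℚ) + 4 - 1 = t + 3 by ring]
  rw [show (t : ℚ) + 4 + 1 = t + 5 by ring] at h1
  generalize (t : ℚ) = x at *
  refine le_of_mul_le_mul_right ?_ (show 0 < f ^ (t + 6) * (3 * (x + 5) ^ (t + 2)) by positivity)
  calc 3 * T * (f ^ (t + 6) * (3 * (x + 5) ^ (t + 2)))
      = T * f ^ (t + 6) * (9 * (x + 5) ^ (t + 2)) := by ring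
    _ ≤ ((x + 4) ^ 2 + (x + 4) + 1) * ((x + 4) ^ 2 + (x + 4) + 1 - 1) * F *
        (9 * (x + 5) ^ (t + 2)) := mul_le_mul_of_nonneg_right h2 (by positivity)
    _ = (9 * (((x + 4) ^ 2 + (x + 4) + 1) * ((x + 4) ^ 2 + (x + 4))) * (x + 5) ^ (t + 2)) * F := by
      ring
    _ ≤ (2 * (x + 3) ^ (t + 3) * f ^ 3) * F := mul_le_mul_of_nonneg_right h3 hF.le
    _ = (2 * (x + 3) ^ (t + 3) * f ^ 3) * (F * (x + 5)) / (x + 5) := by field_simp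
    _ ≤ (2 * (x + 3) ^ (t + 3) * f ^ 3) * (b * (3 * ((x + 5) * f) ^ (t + 3))) / (x + 5) := by
      gcongr
    _ = _ := by
      rw [mul_pow, pow_succ (x + 5) (t + 2)]
      field_simp
      ring

/-- The factor 2/3 makes the induction self-sustaining: its `k`-th power, `k ≥ 3`, beats the loss of
`2` per layer. -/
theorem three_mul_ncard_tOrderings_le (hk : 3 ≤ k) (t : ℕ) :
    3 * ((tOrderings k (t + 3)).ncard : ℚ) ≤ 2 * zigzagBound k (t + 3) := by
  have hk2 : 2 ≤ k := by omega
  induction t with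
  | zero =>
    rcases Nat.eq_or_lt_of_le hk with rfl | h
    · exact three_mul_ncard_tOrderings_three_three_le
    · obtain ⟨t, rfl⟩ : ∃ t, k = t + 4 := ⟨k - 4, by omega⟩
      exact three_mul_ncard_tOrderings_three_le t
  | succ t ih =>
    have h1 : ((tOrderings k (t + 4)).ncard : ℚ) * ((chipCount k (t + 3)).factorial : ℚ) ^ k ≤
        (chipCount k (t + 4)).factorial * ((tOrderings k (t + 3)).ncard : ℚ) ^ k := by
      exact_mod_cast ncard_tOrderings_succ_mul_le hk2 (t + 3)
    have h2 := factorial_mul_beta_le hk2 t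
    have h3 := zigzagBound_succ hk2 t
    have hb := beta_pos hk2 t
    have hB := zigzagBound_pos hk2 t
    have hB' : 0 < zigzagBound k (t + 4) := zigzagBound_pos hk2 (t + 1)
    have hpow : ((tOrderings k (t + 3)).ncard : ℚ) ^ k ≤ (2 / 3 * zigzagBound k (t + 3)) ^ k :=
      pow_le_pow_left₀ (by positivity) (by linarith) k
    have hpow' : (2 / 3 : ℚ) ^ k ≤ (2 / 3) ^ 3 :=
      pow_le_pow_of_le_one (by norm_num) (by norm_num) hk
    have hG : (0 : ℚ) < ((chipCount k (t + 3)).factorial : ℚ) ^ k := by positivity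
    have hF : (0 : ℚ) ≤ (chipCount k (t + 4)).factorial := by positivity
    change 3 * ((tOrderings k (t + 4)).ncard : ℚ) ≤ 2 * zigzagBound k (t + 4)
    generalize ((chipCount k (t + 3)).factorial : ℚ) ^ k = G at *
    generalize ((chipCount k (t + 4)).factorial : ℚ) = F at *
    have h4 : ((tOrderings k (t + 4)).ncard : ℚ) ≤ 2 * (2 / 3) ^ 3 * zigzagBound k (t + 4) := by
      refine le_of_mul_le_mul_right ?_ (mul_pos hb hG)
      calc _ = ((tOrderings k (t + 4)).ncard : ℚ) * G * beta k (t + 3) := by ring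
        _ ≤ F * ((tOrderings k (t + 3)).ncard : ℚ) ^ k * beta k (t + 3) :=
          mul_le_mul_of_nonneg_right h1 hb.le
        _ ≤ F * (2 / 3 * zigzagBound k (t + 3)) ^ k * beta k (t + 3) := by gcongr
        _ = (2 / 3) ^ k * zigzagBound k (t + 3) ^ k * (F * beta k (t + 3)) := by
          rw [mul_pow]; ring
        _ ≤ (2 / 3) ^ k * zigzagBound k (t + 3) ^ k * (2 * beta k (t + 4) * G) :=
          mul_le_mul_of_nonneg_left h2 (by positivity)
        _ = (2 / 3) ^ k * (2 * (zigzagBound k (t + 3) ^ k * beta k (t + 4)) * G) := by ring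
        _ = (2 / 3) ^ k * (2 * (zigzagBound k (t + 4) * beta k (t + 3)) * G) := by rw [← h3]
        _ ≤ (2 / 3) ^ 3 * (2 * (zigzagBound k (t + 4) * beta k (t + 3)) * G) :=
          mul_le_mul_of_nonneg_right hpow' (by positivity)
        _ = _ := by ring
    linarith

theorem ncard_tOrderings_le (hk : 2 ≤ k) (t : ℕ) :
    ((tOrderings k (t + 3)).ncard : ℚ) ≤ zigzagBound k (t + 3) := by
  rcases Nat.eq_or_lt_of_le hk with rfl | h
  · exact ncard_tOrderings_two_le t
  · have h1 := three_mul_ncard_tOrderings_le h t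
    have h2 := zigzagBound_pos hk t
    linarith

end Main

end ChipFiring

theorem mainTheorem1 (k ℓ : ℕ) (hk : 2 ≤ k) (hℓ : 3 ≤ ℓ) :
    ((ChipFiring.tOrderings k ℓ).Finite ∧
      ((ChipFiring.tOrderings k ℓ).ncard : ℚ) ≤ ChipFiring.zigzagBound k ℓ) ∧
    ((ChipFiring.zConfigurations k ℓ).Finite ∧
      ((ChipFiring.zConfigurations k ℓ).ncard : ℚ) ≤ ChipFiring.zigzagBound k ℓ) := by
  obtain ⟨t, rfl⟩ : ∃ t, ℓ = t + 3 := ⟨ℓ - 3, by omega⟩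
  have hfin := ChipFiring.finite_tOrderings hk (t + 3)
  have hsub := ChipFiring.zConfigurations_subset hk (t + 3)
  have hle := ChipFiring.ncard_tOrderings_le hk t
  refine ⟨⟨hfin, hle⟩, hfin.subset hsub, le_trans ?_ hle⟩
  exact_mod_cast Set.ncard_le_ncard hsub hfin
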